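/- Let $\mathbf{k}$ be an algebraically closed field of characteristic zero. For a finite poset $\mathcal P$, let $\mathfrak g_A(\mathcal P)$ be the Lie algebra of trace-zero matrices (rows and columns indexed by $\mathcal P$, entries in $\mathbf k$) in the span of the matrix units $E_{p,q}$ with $p\preceq q$, with the commutator bracket; $E_{p,q}^*$ denotes the functional that reads off the $(p,q)$-entry. A Lie algebra $\mathfrak g$ of dimension $2n+1$ is contact if there is a one-form $\varphi\in\mathfrak g^*$ with $\varphi\wedge(d\varphi)^n\neq 0$, where $d\varphi(x,y)=-\varphi([x,y])$; such a $\varphi$ is called a contact form. The height of a poset is one less than the largest cardinality of a chain, and a poset is connected if its Hasse diagram is connected. **Blocks.** $\mathcal P(1,1)$ is $c\prec a_1$; $\mathcal P(1,1,1)$ is $c\prec m\prec a_1$; $\mathcal P(1,1,2)$ is $c\prec m\prec a_1,a_2$; $\mathcal P(2,1,1)$ is $a_1,a_2\prec m\prec c$ (with distinct elements). **Gluing.** Adjoining a copy of a block $\mathcal S$ to a poset $\mathcal Q$ means forming the union of $\mathcal Q$ and $\mathcal S$, with the union of the two order relations, after identifying some minimal (resp. maximal) elements of $\mathcal S$ with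 distinct minimal (resp. maximal) elements of $\mathcal Q$. The rules say which of $c,a_1,a_2$ are identified with an element of $\mathcal Q$ (a condition "$a_2$ is not identified" is void if $\mathcal S$ has no $a_2$, and a rule that identifies $a_2$ does not apply in that case): * $A_1$: only $a_1$; $A_2$: only $a_2$; $C$: only $c$; * $D_1$: only $c$ and $a_1$, with elements $x,y$ of $\mathcal Q$ that are comparable in $\mathcal Q$; $D_2$: only $c$ and $a_2$, with elements $x,z$ that are comparable in $\mathcal Q$; * $F$: $c$, $a_1$ and $a_2$, with elements $x,y,z$ of $\mathcal Q$ such that $y$ and $z$ are each comparable with $x$ in $\mathcal Q$. **Contact sequences.** A contact sequence is a sequence $\mathcal P_0,\dots,\mathcal P_n$ ($n\ge 0$) of connected posets of height at most two, together with blocks $\mathcal S_0,\dots,\mathcal S_n$, each of the form $\mathcal P(1,1)$, $\mathcal P(1,1,1)$, $\mathcal P(1,1,2)$ or $\mathcal P(2,1,1)$, such that $\mathcal P_0=\mathcal S_0$; for $1\le j\le n$ the poset $\mathcal P_j$ is obtained by adjoining $\mathcal S_j$ to $\mathcal P_{j-1}$ by one of the rules $A_1,A_2,C,D_1,D_2,F$;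 and there is exactly one $j\in\{0,\dots,n\}$ with $\mathcal S_j=\mathcal P(1,1,1)$. **The one-form.** For a contact sequence with $\mathcal P_0=\mathcal S_0=\mathcal P(1,1,1)$ put $\varphi_{\mathcal P_0}=E^*_{m,m}+E^*_{c,a_1}+E^*_{m,a_1}$ (labels of $\mathcal S_0$), and let $\varphi_{\mathcal P_j}$ be $\varphi_{\mathcal P_{j-1}}$ plus the following sum (labels of $\mathcal S_j$, regarded as elements of $\mathcal P_j$), where all functionals are restricted to $\mathfrak g_A(\mathcal P_j)$: * for $A_1,A_2,C$: $E^*_{c,a_1}$ if $\mathcal S_j=\mathcal P(1,1)$; $E^*_{c,a_1}+E^*_{c,a_2}+E^*_{m,a_2}$ if $\mathcal S_j=\mathcal P(1,1,2)$; $E^*_{a_1,c}+E^*_{a_2,c}+E^*_{a_2,m}$ if $\mathcal S_j=\mathcal P(2,1,1)$; * for $D_1$: $0$ if $\mathcal S_j=\mathcal P(1,1)$ (then $\mathcal P_j=\mathcal P_{j-1}$); $E^*_{c,a_2}+E^*_{m,a_2}$ if $\mathcal S_j=\mathcal P(1,1,2)$; $E^*_{a_2,c}+E^*_{a_2,m}$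 if $\mathcal S_j=\mathcal P(2,1,1)$; * for $D_2$: $E^*_{c,a_1}+E^*_{m,a_2}$ if $\mathcal S_j=\mathcal P(1,1,2)$; $E^*_{a_1,c}+E^*_{a_2,m}$ if $\mathcal S_j=\mathcal P(2,1,1)$; * for $F$: $E^*_{m,a_2}$ if $\mathcal S_j=\mathcal P(1,1,2)$; $E^*_{a_2,m}$ if $\mathcal S_j=\mathcal P(2,1,1)$. **Theorem.** Let $\mathcal P$ be a finite connected poset of height two. Then $\mathfrak g_A(\mathcal P)$ is contact if and only if there is a contact sequence $\mathcal P_0,\dots,\mathcal P_n$ with $\mathcal P_n=\mathcal P$. Moreover, if there is such a sequence, then there is one with $\mathcal P_0=\mathcal P(1,1,1)$; and for every contact sequence with $\mathcal P_n=\mathcal P$ and $\mathcal P_0=\mathcal P(1,1,1)$, the one-form $\varphi_{\mathcal P_n}$ is a contact form on $\mathfrak g_A(\mathcal P)$. -/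

import Mathlib

attribute [local instance 100] LieRing.ofAssociativeRing

/-! ### Contact Lie algebras -/

section Contact

variable {k L : Type*} [Field k] [LieRing L] [LieAlgebra k L]

/-- The exterior derivative `dφ` of a one-form, `dφ(x, y) = -φ([x, y])`. -/
def oneFormDeriv (φ : Module.Dual k L) (x y : L) : k := -φ ⁅x, y⁆

/-- The `(2n+1)`-form `φ ∧ (dφ)ⁿ`, written out by the usual formula for the wedge product of a
one-form and `n` two-forms: antisymmetrise over all permutations of the `2n+1` arguments and
divide by `1! (2!)ⁿ`. -/
noncomputable def contactVolumeForm (φ : Module.Dual k L) (n : ℕ) (v : Fin (2 * n + 1) → L) : k :=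
  ((2 : k) ^ n)⁻¹ * ∑ σ : Equiv.Perm (Fin (2 * n + 1)),
    ((Equiv.Perm.sign σ : ℤ) : k) *
      (φ (v (σ ⟨0, by omega⟩)) *
        ∏ i : Fin n, oneFormDeriv φ (v (σ ⟨2 * i.1 + 1, by omega⟩)) (v (σ ⟨2 * i.1 + 2, by omega⟩)))

variable (k L) in
/-- `φ` is a contact form: `dim L = 2n+1` and `φ ∧ (dφ)ⁿ ≠ 0`. -/
def IsContactForm (φ : Module.Dual k L) : Prop :=
  ∃ n : ℕ, Module.finrank k L = 2 * n + 1 ∧ ∃ v, contactVolumeForm φ n v ≠ 0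

variable (k L) in
/-- A Lie algebra is contact if it admits a contact form. -/
def IsContactLieAlgebra : Prop := ∃ φ : Module.Dual k L, IsContactForm k L φ

end Contact

/-! ### Type-A Lie poset algebras -/

section LiePoset

variable (k α : Type*) [Field k] [Fintype α] [DecidableEq α] [PartialOrder α]

/-- The Lie poset algebra: the span of the matrix units `E i j` with `i ≤ j`, under the
commutator bracket. -/
def liePosetAlgebra : LieSubalgebra k (Matrix α α k) where
  carrier := {M | ∀ i j, ¬ i ≤ j → M i j = 0}
  add_mem' := fun {a b} ha hb i j h => by
    rw [Matrix.add_apply, ha i j h, hb i j h, add_zero]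
  zero_mem' := fun _ _ _ => rfl
  smul_mem' := fun c M hM i j h => by
    rw [Matrix.smul_apply, hM i j h, smul_zero]
  lie_mem' := fun {a b} ha hb i j h => by
    have key : ∀ c d : Matrix α α k, (∀ i j, ¬ i ≤ j → c i j = 0) →
        (∀ i j, ¬ i ≤ j → d i j = 0) → (c * d) i j = 0 := by
      intro c d hc hd
      rw [Matrix.mul_apply]
      refine Finset.sum_eq_zero fun l _ => ?_
      by_cases hil : i ≤ l
      · rw [hd l j fun hlj => h (hil.trans hlj), mul_zero]
      · rw [hc i l hil, zero_mul]
    rw [LieRing.of_associative_ring_bracket, Matrix.sub_apply, key a b ha hb, key b a hb ha,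
      sub_zero]

/-- The type-A Lie poset algebra: the trace-zero elements of the Lie poset algebra. -/
def typeALiePosetAlgebra : LieSubalgebra k (Matrix α α k) :=
  liePosetAlgebra k α ⊓ LieAlgebra.SpecialLinear.sl α k

end LiePoset

/-! ### Posets on subsets of a fixed set -/

/-- A poset whose underlying set is a subset of `α`, given by its strict order relation. -/
@[ext]
structure SubPoset (α : Type*) where
  carrier : Set α
  lt : α → α → Prop
  left_mem : ∀ x y, lt x y → x ∈ carrier
  right_mem : ∀ x y, lt x y → y ∈ carrier
  irrefl : ∀ x, ¬ lt x x
  trans : ∀ x y z, lt x y → lt y z → lt x z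

namespace SubPoset

variable {α : Type*}

/-- The elements of the poset, as a type. -/
def Elem (P : SubPoset α) : Type _ := {x : α // x ∈ P.carrier}

instance (P : SubPoset α) : PartialOrder P.Elem where
  le x y := x = y ∨ P.lt x.1 y.1
  lt x y := P.lt x.1 y.1
  le_refl x := Or.inl rfl
  le_trans := by
    rintro x y z (rfl | hxy) (rfl | hyz)
    · exact Or.inl rfl
    · exact Or.inr hyz
    · exact Or.inr hxy
    · exact Or.inr (P.trans _ _ _ hxy hyz)
  le_antisymm := by
    rintro x y (rfl | hxy) (hyx | hyx)
    · rfl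
    · rfl
    · exact hyx.symm
    · exact absurd (P.trans _ _ _ hxy hyx) (P.irrefl _)
  lt_iff_le_not_ge := by
    intro x y
    constructor
    · intro h
      refine ⟨Or.inr h, ?_⟩
      rintro (rfl | h')
      · exact P.irrefl _ h
      · exact P.irrefl _ (P.trans _ _ _ h h')
    · rintro ⟨rfl | h, h'⟩
      · exact absurd (Or.inl rfl) h'
      · exact h

/-- The Hasse diagram of the poset is connected. -/
def Connected (P : SubPoset α) : Prop := (SimpleGraph.hasse P.Elem).Connected

/-- `x` is a minimal element. -/
def IsMinimal (P : SubPoset α) (x : α) : Prop := x ∈ P.carrier ∧ ∀ y, ¬ P.lt y x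

/-- `x` is a maximal element. -/
def IsMaximal (P : SubPoset α) (x : α) : Prop := x ∈ P.carrier ∧ ∀ y, ¬ P.lt x y

/-- `x ∼ y`: the two elements are comparable. -/
def Related (P : SubPoset α) (x y : α) : Prop := x = y ∨ P.lt x y ∨ P.lt y x

/-- The poset `α` itself. -/
def whole (α : Type*) [PartialOrder α] : SubPoset α where
  carrier := Set.univ
  lt x y := x < y
  left_mem _ _ _ := trivial
  right_mem _ _ _ := trivial
  irrefl := lt_irrefl
  trans _ _ _ := lt_trans

end SubPoset

/-! ### Building blocks -/

/-- A copy in `α` of one of the posets `P(1,1)`, `P(1,1,1)`, `P(1,1,2)`, `P(2,1,1)`, with its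
elements labelled. The extremal elements are `c, a₁` and, for the last two, `a₂`; the remaining
element, if there is one, is `m`. -/
inductive Block (α : Type*)
  /-- `c ≺ a₁` -/
  | P11 (c a₁ : α) (h : [c, a₁].Nodup)
  /-- `c ≺ m ≺ a₁` -/
  | P111 (c m a₁ : α) (h : [c, m, a₁].Nodup)
  /-- `c ≺ m ≺ a₁, a₂` -/
  | P112 (c m a₁ a₂ : α) (h : [c, m, a₁, a₂].Nodup)
  /-- `a₁, a₂ ≺ m ≺ c` -/
  | P211 (a₁ a₂ m c : α) (h : [a₁, a₂, m, c].Nodup)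

namespace Block

variable {α : Type*}

/-- The list of elements of a block. -/
def elems : Block α → List α
  | P11 c a₁ _ => [c, a₁]
  | P111 c m a₁ _ => [c, m, a₁]
  | P112 c m a₁ a₂ _ => [c, m, a₁, a₂]
  | P211 a₁ a₂ m c _ => [a₁, a₂, m, c]

/-- The list of strict relations of a block. -/
def rels : Block α → List (α × α)
  | P11 c a₁ _ => [(c, a₁)]
  | P111 c m a₁ _ => [(c, m), (c, a₁), (m, a₁)]
  | P112 c m a₁ a₂ _ => [(c, m), (c, a₁), (c, a₂), (m, a₁), (m, a₂)]
  | P211 a₁ a₂ m c _ => [(a₁, m), (a₂, m), (a₁, c), (a₂, c), (m, c)]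

/-- The block as a poset on a subset of `α`. -/
def poset (b : Block α) : SubPoset α where
  carrier := {x | x ∈ b.elems}
  lt x y := (x, y) ∈ b.rels
  left_mem x y h := by
    cases b <;> simp [rels, elems] at h ⊢ <;> grind
  right_mem x y h := by
    cases b <;> simp [rels, elems] at h ⊢ <;> grind
  irrefl x h := by
    cases b <;> simp [rels] at * <;> grind
  trans x y z hxy hyz := by
    cases b <;> simp [rels] at * <;> grind

/-- The extremal element `c`. -/
def c : Block α → α
  | P11 c _ _ => c
  | P111 c _ _ _ => c
  | P112 c _ _ _ _ => c
  | P211 _ _ _ c _ => c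

/-- The extremal element `a₁`. -/
def a₁ : Block α → α
  | P11 _ a₁ _ => a₁
  | P111 _ _ a₁ _ => a₁
  | P112 _ _ a₁ _ _ => a₁
  | P211 a₁ _ _ _ _ => a₁

/-- The extremal element `a₂`, which only `P(1,1,2)` and `P(2,1,1)` have. -/
def a₂ : Block α → Option α
  | P11 _ _ _ => none
  | P111 _ _ _ _ => none
  | P112 _ _ _ a₂ _ => some a₂
  | P211 _ a₂ _ _ _ => some a₂

/-- The block is a copy of `P(1,1,1)`. -/
def IsP111 : Block α → Prop
  | P111 _ _ _ _ => True
  | _ => False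

end Block

/-! ### Gluing -/

/-- The poset `P` is obtained from the posets `Q` and `S` by identifying minimal elements of `S`
with minimal elements of `Q` and maximal elements of `S` with maximal elements of `Q`, the
identified elements being the common elements of `Q` and `S`. (The union of the two relations is
already transitive, since all common elements are extremal in both posets.) -/
structure IsGluing {α : Type*} (Q S P : SubPoset α) : Prop where
  carrier_eq : P.carrier = Q.carrier ∪ S.carrier
  lt_iff : ∀ x y, P.lt x y ↔ Q.lt x y ∨ S.lt x y
  common : ∀ x, x ∈ Q.carrier → x ∈ S.carrier →
    (Q.IsMinimal x ∧ S.IsMinimal x) ∨ (Q.IsMaximal x ∧ S.IsMaximal x)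

/-- The names of the gluing rules that are allowed in a contact sequence. -/
inductive GluingRule
  | A₁ | A₂ | C | D₁ | D₂ | F

/-- Which of the extremal elements `c, a₁, a₂` of the block `b` each rule identifies with elements
of `Q`, and which of these have to be comparable in `Q`. -/
def GluingRule.Applies {α : Type*} (Q : SubPoset α) (b : Block α) : GluingRule → Prop
  | A₁ => b.c ∉ Q.carrier ∧ b.a₁ ∈ Q.carrier ∧ (∀ z ∈ b.a₂, z ∉ Q.carrier)
  | A₂ => b.c ∉ Q.carrier ∧ b.a₁ ∉ Q.carrier ∧ (∃ z ∈ b.a₂, z ∈ Q.carrier)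
  | C => b.c ∈ Q.carrier ∧ b.a₁ ∉ Q.carrier ∧ (∀ z ∈ b.a₂, z ∉ Q.carrier)
  | D₁ => b.c ∈ Q.carrier ∧ (b.a₁ ∈ Q.carrier ∧ Q.Related b.a₁ b.c) ∧
      (∀ z ∈ b.a₂, z ∉ Q.carrier)
  | D₂ => b.c ∈ Q.carrier ∧ b.a₁ ∉ Q.carrier ∧
      (∃ z ∈ b.a₂, z ∈ Q.carrier ∧ Q.Related z b.c)
  | F => b.c ∈ Q.carrier ∧ (b.a₁ ∈ Q.carrier ∧ Q.Related b.a₁ b.c) ∧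
      (∃ z ∈ b.a₂, z ∈ Q.carrier ∧ Q.Related z b.c)

/-! ### Contact sequences -/

/-- A contact sequence `P 0, …, P n` of posets on subsets of `α`, with the blocks `S 0, …, S n`
and the rules `rule 1, …, rule n` (the values at other indices play no role). -/
structure ContactSequence (α : Type*) (n : ℕ) where
  P : ℕ → SubPoset α
  S : ℕ → Block α
  rule : ℕ → GluingRule
  connected : ∀ j ≤ n, (P j).Connected
  height_le_two : ∀ j ≤ n, Order.krullDim (P j).Elem ≤ 2
  start : P 0 = (S 0).poset
  gluing : ∀ j < n, IsGluing (P j) (S (j + 1)).poset (P (j + 1))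
  rule_applies : ∀ j < n, (rule (j + 1)).Applies (P j) (S (j + 1))
  existsUnique_P111 : ∃! j, j ≤ n ∧ (S j).IsP111

/-! ### The recursively defined one-form -/

section Form

variable (k : Type*) [Field k] {α : Type*}

/-- The coordinate functional `E i j ^*` on matrices. -/
def coordForm (i j : α) : Module.Dual k (Matrix α α k) := Matrix.entryLinearMap k k i j

/-- The one-form of the initial poset `1 ≺ 2 ≺ 3`, namely `E₂₂^* + E₁₃^* + E₂₃^*`. For the other
blocks nothing is prescribed, and the value is `0`. -/
def Block.initialForm : Block α → Module.Dual k (Matrix α α k)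
  | .P111 c m a₁ _ => coordForm k m m + coordForm k c a₁ + coordForm k m a₁
  | _ => 0

/-- The summand that is added when a block of type `P(1,1)`, `P(1,1,2)` or `P(2,1,1)` is adjoined
by a given rule. In the last line are the case `D₁` with `P(1,1)`, where the poset does not change,
cases where the rule does not apply, and `P(1,1,1)`, which does not occur again. -/
def GluingRule.stepForm : GluingRule → Block α → Module.Dual k (Matrix α α k)
  | .A₁, .P11 c a₁ _ | .A₂, .P11 c a₁ _ | .C, .P11 c a₁ _ => coordForm k c a₁
  | .A₁, .P112 c m a₁ a₂ _ | .A₂, .P112 c m a₁ a₂ _ | .C, .P112 c m a₁ a₂ _ =>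
      coordForm k c a₁ + coordForm k c a₂ + coordForm k m a₂
  | .A₁, .P211 a₁ a₂ m c _ | .A₂, .P211 a₁ a₂ m c _ | .C, .P211 a₁ a₂ m c _ =>
      coordForm k a₁ c + coordForm k a₂ c + coordForm k a₂ m
  | .D₁, .P112 c m _ a₂ _ => coordForm k c a₂ + coordForm k m a₂
  | .D₁, .P211 _ a₂ m c _ => coordForm k a₂ c + coordForm k a₂ m
  | .D₂, .P112 c m a₁ a₂ _ => coordForm k c a₁ + coordForm k m a₂
  | .D₂, .P211 a₁ a₂ m c _ => coordForm k a₁ c + coordForm k a₂ m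
  | .F, .P112 _ m _ a₂ _ => coordForm k m a₂
  | .F, .P211 _ a₂ m _ _ => coordForm k a₂ m
  | _, _ => 0

/-- The one-form of the `j`-th poset of a contact sequence that starts with `P(1,1,1)`, as a
linear combination of coordinate functionals. -/
def ContactSequence.form {n : ℕ} (s : ContactSequence α n) : ℕ → Module.Dual k (Matrix α α k)
  | 0 => (s.S 0).initialForm k
  | j + 1 => ContactSequence.form s j + (s.rule (j + 1)).stepForm k (s.S (j + 1))

/-- The one-form `φ` of the last poset of a contact sequence, restricted to the type-A Lie poset
algebra. -/
def ContactSequence.contactForm [Fintype α] [DecidableEq α] [PartialOrder α] {n : ℕ}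
    (s : ContactSequence α n) : Module.Dual k (typeALiePosetAlgebra k α) :=
  (s.form k n).comp (typeALiePosetAlgebra k α).toSubmodule.subtype

end Form

/-! A form `φ` with `φ ∧ (dφ)ⁿ ≠ 0` in top degree has no nonzero vector that lies both in the kernel
of `φ` and in the radical of `dφ`. Conversely, if there is no such vector and some `z` in the
radical has `φ z ≠ 0`, a symplectic Gram–Schmidt argument shows that the dimension is odd and `φ` is
contact. On matrices, `φ` is the pairing with a coefficient matrix `f`, and `x` is in the radical
exactly when `fᵀx` and `xfᵀ` agree in the positions `(q, p)` with `p ≤ q` (`RadicalEq`). Everything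
is thereby reduced to linear equations between entries, organised by the bipartite graph `minMaxRel`
of minimal and maximal elements and by the remaining, middle elements.

Necessity (`IsContactLieAlgebra.isContactPoset`). Explicit vectors in kernel and radical restrict
the poset. A vanishing coefficient on a min–max edge gives a matrix unit, and a circulation on the
bipartite graph gives a weighted sum of matrix units; so the graph is a forest, and by connectedness
a tree. A middle element cannot have two lower and two upper neighbours, because they would form a
4-cycle, nor one on one side and three on the other, by a dimension count. Thus its type is (1,1),
(1,2) or (2,1). Each (1,1) element contributes a radical vector to those of the full Lie poset
algebra, which already contain the identity; two such elements would leave a common solution of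
trace zero and form zero. If there were none, a standard 0/1 form would have nondegenerate
derivative and the dimension would be even. Hence there is exactly one. These conditions are
`IsContactPoset`.

Contact sequences are the same thing. The gluing rules attach the min–max edges of a block as leaves
or along edges already present, so the graph stays a tree (`IsGluing.grownTree`), while middle
elements are never identified and keep the neighbourhood of their block. In the other direction
(`IsContactPoset.reachable`), `P(1,1,1)` is placed at the (1,1) element, the tree is grown by copies
of `P(1,1)`, and each remaining middle element is glued in by the rule `F`.

The recursive one-form. Whatever rules are used, its coefficients are 1 on every min–max edge,
standard at every middle element, and 1 at the diagonal place of the (1,1) element `m₀`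
(`SequenceCoefficients`). Solving the radical equations (`IsStandard.radical`) leaves two
parameters, the common diagonal value `t` and the entry at `(m₀, m₀)`. Trace zero leaves one, and
the form is nonzero on the resulting line. -/

/-! ### Linear algebra of contact forms -/

section ContactLinearAlgebra

variable {k V : Type*} [Field k] [AddCommGroup V] [Module k V]

/-- The product of a one-form and `n` copies of a two-form, before antisymmetrisation. -/
noncomputable def wedgeTerm (φ : Module.Dual k V) (ω : V →ₗ[k] V →ₗ[k] k) (n : ℕ)
    (v : Fin (2 * n + 1) → V) : k :=
  φ (v ⟨0, by omega⟩) *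
    ∏ i : Fin n, ω (v ⟨2 * i.1 + 1, by omega⟩) (v ⟨2 * i.1 + 2, by omega⟩)

/-- Each slot is occupied by `φ` or by one side of exactly one factor `ω`. With the other arguments
frozen, the term is a multiple of `φ`, of `ω(·, y)` or of `ω(y, ·)`, which gives linearity and
vanishing on the kernel and radical at once. -/
theorem exists_linear_wedgeTerm_update (φ : Module.Dual k V) (ω : V →ₗ[k] V →ₗ[k] k) (n : ℕ)
    (v : Fin (2 * n + 1) → V) (j : Fin (2 * n + 1)) :
    ∃ l : V →ₗ[k] k, (∀ x, wedgeTerm φ ω n (Function.update v j x) = l x) ∧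
      ∀ x, φ x = 0 → (∀ y, ω x y = 0) → (∀ y, ω y x = 0) → l x = 0 := by
  obtain h0 | ⟨i, hi⟩ : j.1 = 0 ∨ ∃ i : Fin n, j.1 = 2 * i.1 + 1 ∨ j.1 = 2 * i.1 + 2 := by
    by_cases h : j.1 = 0
    · exact Or.inl h
    · refine Or.inr ⟨⟨(j.1 - 1) / 2, by omega⟩, ?_⟩
      dsimp only
      omega
  · obtain ⟨j, hj⟩ := j
    obtain rfl : j = 0 := h0
    refine ⟨(∏ i : Fin n, ω (v ⟨2 * i.1 + 1, by omega⟩) (v ⟨2 * i.1 + 2, by omega⟩)) • φ,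
      fun x => ?_, fun x hx _ _ => by simp [hx]⟩
    simp [wedgeTerm, Fin.ext_iff, mul_comm]
  · have hother : ∀ x, ∏ i' ∈ Finset.univ.erase i,
        ω (Function.update v j x ⟨2 * i'.1 + 1, by omega⟩)
          (Function.update v j x ⟨2 * i'.1 + 2, by omega⟩) =
        ∏ i' ∈ Finset.univ.erase i,
          ω (v ⟨2 * i'.1 + 1, by omega⟩) (v ⟨2 * i'.1 + 2, by omega⟩) := by
      intro x
      refine Finset.prod_congr rfl fun i' hi' => ?_
      have hne : i'.1 ≠ i.1 := fun h => (Finset.mem_erase.1 hi').1 (Fin.ext h)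
      rw [Function.update_of_ne, Function.update_of_ne] <;> simp only [ne_eq, Fin.ext_iff] <;> omega
    have hsplit : ∀ x, wedgeTerm φ ω n (Function.update v j x) = φ (v ⟨0, by omega⟩) *
        (ω (Function.update v j x ⟨2 * i.1 + 1, by omega⟩)
          (Function.update v j x ⟨2 * i.1 + 2, by omega⟩) *
        ∏ i' ∈ Finset.univ.erase i,
          ω (v ⟨2 * i'.1 + 1, by omega⟩) (v ⟨2 * i'.1 + 2, by omega⟩)) := by
      intro x
      rw [wedgeTerm, ← Finset.mul_prod_erase _ _ (Finset.mem_univ i), hother,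
        Function.update_of_ne]
      simp only [ne_eq, Fin.ext_iff]
      omega
    obtain hi | hi := hi
    · obtain ⟨j, hj⟩ := j
      obtain rfl : j = 2 * i.1 + 1 := hi
      refine ⟨(φ (v ⟨0, by omega⟩) * ∏ i' ∈ Finset.univ.erase i,
          ω (v ⟨2 * i'.1 + 1, by omega⟩) (v ⟨2 * i'.1 + 2, by omega⟩)) •
          ω.flip (v ⟨2 * i.1 + 2, by omega⟩), fun x => ?_, fun x _ hx _ => by simp [hx]⟩
      rw [hsplit, Function.update_self, Function.update_of_ne (by simp)]
      simp only [LinearMap.smul_apply, LinearMap.flip_apply, smul_eq_mul]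
      ring
    · obtain ⟨j, hj⟩ := j
      obtain rfl : j = 2 * i.1 + 2 := hi
      refine ⟨(φ (v ⟨0, by omega⟩) * ∏ i' ∈ Finset.univ.erase i,
          ω (v ⟨2 * i'.1 + 1, by omega⟩) (v ⟨2 * i'.1 + 2, by omega⟩)) •
          ω (v ⟨2 * i.1 + 1, by omega⟩), fun x => ?_, fun x _ _ hx => by simp [hx]⟩
      rw [hsplit, Function.update_self, Function.update_of_ne (by simp)]
      simp only [LinearMap.smul_apply, smul_eq_mul]
      ring

/-- `wedgeTerm` as a multilinear map. -/
noncomputable def wedgeMultilinear (φ : Module.Dual k V) (ω : V →ₗ[k] V →ₗ[k] k) (n : ℕ) :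
    MultilinearMap k (fun _ : Fin (2 * n + 1) => V) k :=
  MultilinearMap.mk' (wedgeTerm φ ω n)
    (fun v j x y => by
      obtain ⟨l, hl, -⟩ := exists_linear_wedgeTerm_update φ ω n v j
      rw [hl, hl, hl, map_add])
    (fun v j c x => by
      obtain ⟨l, hl, -⟩ := exists_linear_wedgeTerm_update φ ω n v j
      rw [hl, hl, map_smul])

/-- A vector in the kernel of `φ` and in the radical of `ω` is zero if `φ ∧ ωⁿ` is a nonzero form
of top degree. -/
theorem eq_zero_of_alternatization_ne_zero {φ : Module.Dual k V} {ω : V →ₗ[k] V →ₗ[k] k} {n : ℕ}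
    (hdim : Module.finrank k V = 2 * n + 1) {v : Fin (2 * n + 1) → V}
    (hv : (wedgeMultilinear φ ω n).alternatization v ≠ 0) {x : V} (hφ : φ x = 0)
    (hl : ∀ y, ω x y = 0) (hr : ∀ y, ω y x = 0) : x = 0 := by
  have hli : LinearIndependent k v := by
    by_contra h
    exact hv (AlternatingMap.map_linearDependent _ _ h)
  let b := basisOfLinearIndependentOfCardEqFinrank hli (by simp [hdim])
  have hb : ⇑b = v := coe_basisOfLinearIndependentOfCardEqFinrank hli _
  -- Every term of the antisymmetrisation has `x` in some slot, where it is annihilated.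
  have hzero : ∀ i, (wedgeMultilinear φ ω n).alternatization (Function.update v i x) = 0 := by
    intro i
    rw [MultilinearMap.alternatization_apply]
    refine Finset.sum_eq_zero fun σ _ => ?_
    obtain ⟨l, h1, h2⟩ := exists_linear_wedgeTerm_update φ ω n (fun j => v (σ j)) (σ.symm i)
    have : (fun j => Function.update v i x (σ j)) =
        Function.update (fun j => v (σ j)) (σ.symm i) x := by
      ext j
      by_cases hj : j = σ.symm i
      · subst hj
        simp
      · rw [Function.update_of_ne hj, Function.update_of_ne]
        rintro rfl
        simp at hj
    rw [MultilinearMap.domDomCongr_apply]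
    change _ • wedgeTerm φ ω n (fun j => Function.update v i x (σ j)) = 0
    rw [this, h1, h2 x hφ hl hr, smul_zero]
  -- Expanding `x` in the basis inside slot `i`, only the `i`-th term survives: the coordinate times
  -- the nonzero value on the basis.
  refine b.ext_elem fun i => ?_
  have h := hzero i
  rw [← b.sum_repr x, AlternatingMap.map_update_sum, Finset.sum_eq_single i] at h
  · rw [AlternatingMap.map_update_smul, hb, Function.update_eq_self, smul_eq_mul, mul_eq_zero] at h
    simpa using h.resolve_right hv
  · intro j _ hj
    rw [AlternatingMap.map_update_smul, hb, AlternatingMap.map_update_self _ _ (Ne.symm hj),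
      smul_zero]
  · simp

/-- The index set `{0} ∪ {1, 2} ∪ {3, 4} ∪ …`, arranged in pairs. -/
noncomputable def pairEquiv (n : ℕ) : Option (Fin n × Bool) ≃ Fin (2 * n + 1) :=
  Equiv.ofBijective
    (fun o => o.elim ⟨0, by omega⟩ fun p => ⟨2 * p.1.1 + 1 + p.2.toNat, by
      have := p.2.toNat_le; omega⟩) (by
    rw [Fintype.bijective_iff_injective_and_card]
    refine ⟨?_, by simp; ring⟩
    rintro (_ | ⟨i, bi⟩) (_ | ⟨j, bj⟩) h
    · rfl
    · simp [Fin.ext_iff] at h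
      omega
    · simp [Fin.ext_iff] at h
    · have h' : 2 * i.1 + 1 + bi.toNat = 2 * j.1 + 1 + bj.toNat := by
        simpa [Fin.ext_iff] using h
      cases bi <;> cases bj <;> simp at h' ⊢ <;> omega)

/-- The elements `z, e i, f i` form a basis in which `φ` and `ω` have their standard form. -/
structure IsDarbouxFamily (φ : Module.Dual k V) (ω : V →ₗ[k] V →ₗ[k] k) (z : V) {n : ℕ}
    (e f : Fin n → V) : Prop where
  φ_z : φ z = 1
  φ_e : ∀ i, φ (e i) = 0
  φ_f : ∀ i, φ (f i) = 0
  ω_ee : ∀ i j, ω (e i) (e j) = 0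
  ω_ff : ∀ i j, ω (f i) (f j) = 0
  ω_ef : ∀ i j, ω (e i) (f j) = if i = j then 1 else 0
  ω_fe : ∀ i j, ω (f i) (e j) = if i = j then -1 else 0
  ω_z : ∀ x, ω z x = 0
  ω_z' : ∀ x, ω x z = 0

/-- In a nonzero term `π` fixes `none` and carries each pair `e i, f i` to a pair, possibly swapped.
Permuting the pairs acts on both members and so has sign `+1`; each swap contributes `-1` to the
sign and `-1` to the product of the `ω`. -/
theorem IsDarbouxFamily.signed_term {φ : Module.Dual k V} {ω : V →ₗ[k] V →ₗ[k] k} {z : V} {n : ℕ}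
    {e f : Fin n → V} (h : IsDarbouxFamily φ ω z e f) (u : Option (Fin n × Bool) → V)
    (hu : u = fun o => o.elim z fun p => if p.2 then f p.1 else e p.1)
    (π : Equiv.Perm (Option (Fin n × Bool)))
    (hne : φ (u (π none)) *
      ∏ i, ω (u (π (some (i, false)))) (u (π (some (i, true)))) ≠ 0) :
    ((Equiv.Perm.sign π : ℤ) : k) * (φ (u (π none)) *
      ∏ i, ω (u (π (some (i, false)))) (u (π (some (i, true))))) = 1 := by
  have h0 : π none = none := by
    have := left_ne_zero_of_mul hne
    rcases hp : π none with _ | ⟨i, b⟩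
    · rfl
    · cases b <;> simp [hp, hu, h.φ_e, h.φ_f] at this
  have hi : ∀ i, ∃ (j : Fin n) (s : Bool), (∀ b, π (some (i, b)) = some (j, xor b s)) ∧
      ω (u (π (some (i, false)))) (u (π (some (i, true)))) = if s then -1 else 1 := by
    intro i
    have := Finset.prod_ne_zero_iff.1 (right_ne_zero_of_mul hne) i (Finset.mem_univ _)
    rcases hp : π (some (i, false)) with _ | ⟨j, b⟩
    · simp [hp, hu, h.ω_z] at this
    rcases hq : π (some (i, true)) with _ | ⟨j', b'⟩
    · simp [hq, hu, h.ω_z'] at this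
    cases b <;> cases b' <;> simp [hp, hq, hu, h.ω_ee, h.ω_ff, h.ω_ef, h.ω_fe] at this
    · subst this
      refine ⟨j, false, ?_, by simp [hu, h.ω_ef]⟩
      rintro (_ | _) <;> simp [hp, hq]
    · subst this
      refine ⟨j, true, ?_, by simp [hu, h.ω_fe]⟩
      rintro (_ | _) <;> simp [hp, hq]
  choose τ s hπ hω using hi
  have hτ : Function.Injective τ := by
    intro i j hij
    have : π (some (i, false)) = π (some (j, xor (s i) (s j))) := by
      rw [hπ, hπ, hij]
      simp
    simpa using (congrArg Prod.fst (Option.some_injective _ (π.injective this)))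
  let T : Equiv.Perm (Fin n) := Equiv.ofBijective τ (Finite.injective_iff_bijective.1 hτ)
  have hdec : π = Equiv.optionCongr ((Equiv.prodCongrLeft fun _ : Bool => T) *
      Equiv.prodCongrRight fun i => if s i then Equiv.swap false true else 1) := by
    ext1 o
    rcases o with _ | ⟨i, b⟩
    · simpa using h0
    · rw [hπ]
      cases hs : s i <;> cases b <;> simp [T, hs]
  have hsign : (Equiv.Perm.sign π : ℤˣ) = ∏ i, if s i then -1 else 1 := by
    rw [hdec, Equiv.optionCongr_sign, Equiv.Perm.sign_mul, Equiv.Perm.sign_prodCongrLeft,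
      Equiv.Perm.sign_prodCongrRight]
    simp only [Fintype.univ_bool, Finset.mem_singleton, Bool.true_eq_false, not_false_eq_true,
      Finset.prod_insert, Finset.prod_singleton, Int.units_mul_self, one_mul]
    refine Finset.prod_congr rfl fun i _ => ?_
    cases s i <;> simp
  rw [hsign, h0, Finset.prod_congr rfl fun i _ => hω i]
  simp only [hu, Option.elim, h.φ_z, one_mul]
  push_cast
  rw [← Finset.prod_mul_distrib]
  refine Finset.prod_eq_one fun i _ => ?_
  cases s i <;> simp

/-- All nonzero terms equal `1`, so the sum counts them. The identity is one of them, and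
characteristic zero keeps the count nonzero. -/
theorem IsDarbouxFamily.sum_ne_zero [CharZero k] {φ : Module.Dual k V} {ω : V →ₗ[k] V →ₗ[k] k}
    {z : V} {n : ℕ} {e f : Fin n → V} (h : IsDarbouxFamily φ ω z e f) :
    ∃ v : Fin (2 * n + 1) → V, ∑ σ : Equiv.Perm (Fin (2 * n + 1)),
      ((Equiv.Perm.sign σ : ℤ) : k) * wedgeTerm φ ω n (fun j => v (σ j)) ≠ 0 := by
  classical
  set u : Option (Fin n × Bool) → V :=
    fun o => o.elim z fun p => if p.2 then f p.1 else e p.1 with hu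
  refine ⟨u ∘ (pairEquiv n).symm, ?_⟩
  let t : Equiv.Perm (Option (Fin n × Bool)) → k := fun π =>
    ((Equiv.Perm.sign π : ℤ) : k) * (φ (u (π none)) *
      ∏ i, ω (u (π (some (i, false)))) (u (π (some (i, true)))))
  have hsum : ∑ σ : Equiv.Perm (Fin (2 * n + 1)),
      ((Equiv.Perm.sign σ : ℤ) : k) *
        wedgeTerm φ ω n (fun j => (u ∘ (pairEquiv n).symm) (σ j)) = ∑ π, t π := by
    refine (Fintype.sum_equiv (pairEquiv n).permCongr _ _ fun π => ?_).symm
    simp only [t, Equiv.Perm.sign_permCongr, wedgeTerm]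
    have e0 : (pairEquiv n).symm ⟨0, by omega⟩ = none := by
      rw [Equiv.symm_apply_eq]; rfl
    have e1 : ∀ i : Fin n, (pairEquiv n).symm ⟨2 * i.1 + 1, by omega⟩ = some (i, false) := by
      intro i; rw [Equiv.symm_apply_eq]; rfl
    have e2 : ∀ i : Fin n, (pairEquiv n).symm ⟨2 * i.1 + 2, by omega⟩ = some (i, true) := by
      intro i; rw [Equiv.symm_apply_eq]; rfl
    simp only [Equiv.permCongr_apply, Function.comp_apply, Equiv.symm_apply_apply, e0, e1, e2]
  have ht : ∀ π, t π = if t π ≠ 0 then 1 else 0 := by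
    intro π
    split_ifs with hπ
    · exact h.signed_term u hu π (right_ne_zero_of_mul hπ)
    · exact not_not.1 hπ
  rw [hsum, Finset.sum_congr rfl fun π _ => ht π, Finset.sum_boole, Nat.cast_ne_zero,
    Finset.card_ne_zero]
  refine ⟨1, Finset.mem_filter.2 ⟨Finset.mem_univ _, ?_⟩⟩
  simp [t, hu, h.φ_z, h.ω_ef]

/-- A Darboux family is a basis, or it can be enlarged. -/
theorem IsDarbouxFamily.extend {φ : Module.Dual k V} {ω : V →ₗ[k] V →ₗ[k] k}
    (halt : ∀ x, ω x x = 0) (hskew : ∀ x y, ω x y = -ω y x)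
    (hnd : ∀ x, φ x = 0 → (∀ y, ω x y = 0) → x = 0) {z : V} {n : ℕ} {e f : Fin n → V}
    (h : IsDarbouxFamily φ ω z e f) :
    (∀ x, ∃ (a : k) (b c : Fin n → k), x = a • z + ∑ i, b i • e i + ∑ i, c i • f i) ∨
    ∃ e' f' : Fin (n + 1) → V, IsDarbouxFamily φ ω z e' f' := by
  classical
  -- The projection onto the vectors in the kernel of `φ` that are `ω`-orthogonal to the family. If
  -- it is not zero, a vector in its image and a rescaled partner provide the next hyperbolic pair.
  let pr : V → V := fun x => x - (φ x • z + ∑ i, ω x (f i) • e i - ∑ i, ω x (e i) • f i)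
  have hφpr : ∀ x, φ (pr x) = 0 := by
    intro x
    simp [pr, h.φ_z, h.φ_e, h.φ_f]
  have hepr : ∀ x i, ω (pr x) (e i) = 0 := by
    intro x i
    simp [pr, h.ω_z, h.ω_ee, h.ω_fe]
  have hfpr : ∀ x i, ω (pr x) (f i) = 0 := by
    intro x i
    simp [pr, h.ω_z, h.ω_ff, h.ω_ef]
  by_cases hall : ∀ x, pr x = 0
  · refine Or.inl fun x => ⟨φ x, fun i => ω x (f i), fun i => -ω x (e i), ?_⟩
    rw [← sub_eq_zero, ← hall x]
    simp only [pr, neg_smul, Finset.sum_neg_distrib]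
    abel
  · right
    push Not at hall
    obtain ⟨x, hx⟩ := hall
    obtain ⟨y, hy⟩ : ∃ y, ω (pr x) y ≠ 0 := by
      by_contra hc
      push Not at hc
      exact hx (hnd _ (hφpr x) hc)
    have hxy : ω (pr x) (pr y) = ω (pr x) y := by
      have hz : ω (pr x) z = 0 := h.ω_z' _
      conv_lhs => rw [show pr y = y - (φ y • z + ∑ i, ω y (f i) • e i - ∑ i, ω y (e i) • f i)
        from rfl]
      simp [hz, hepr, hfpr]
    have hg : ω (pr x) ((ω (pr x) y)⁻¹ • pr y) = 1 := by
      rw [map_smul, hxy, smul_eq_mul, inv_mul_cancel₀ hy]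
    refine ⟨Fin.snoc e (pr x), Fin.snoc f ((ω (pr x) y)⁻¹ • pr y), ?_⟩
    have hne : ∀ i : Fin n, i.castSucc ≠ Fin.last n := fun i => (Fin.castSucc_lt_last i).ne
    constructor
    · exact h.φ_z
    · intro i
      refine Fin.lastCases ?_ (fun i => ?_) i <;> simp [hφpr, h.φ_e]
    · intro i
      refine Fin.lastCases ?_ (fun i => ?_) i <;> simp [hφpr, h.φ_f]
    · intro i j
      refine Fin.lastCases ?_ (fun i => ?_) i <;> refine Fin.lastCases ?_ (fun j => ?_) j <;>
        simp [halt, hepr, h.ω_ee, hskew (e _) (pr x)]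
    · intro i j
      refine Fin.lastCases ?_ (fun i => ?_) i <;> refine Fin.lastCases ?_ (fun j => ?_) j <;>
        simp [halt, hfpr, h.ω_ff, hskew (f _) (pr y)]
    · intro i j
      refine Fin.lastCases ?_ (fun i => ?_) i <;> refine Fin.lastCases ?_ (fun j => ?_) j <;>
        simp only [Fin.snoc_last, Fin.snoc_castSucc, hg, hfpr, h.ω_ef, if_true, hne,
          (hne _).symm, if_false, map_smul, hskew (e _) (pr y), hepr, neg_zero, smul_zero,
          Fin.castSucc_inj]
    · intro i j
      rw [hskew]
      refine Fin.lastCases ?_ (fun i => ?_) i <;> refine Fin.lastCases ?_ (fun j => ?_) j <;>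
        simp only [Fin.snoc_last, Fin.snoc_castSucc, hg, hfpr, h.ω_ef, if_true, hne,
          (hne _).symm, if_false, map_smul, hskew (e _) (pr y), hepr, neg_zero, smul_zero,
          Fin.castSucc_inj, @eq_comm _ j]
      split_ifs <;> simp
    · exact h.ω_z
    · exact h.ω_z'

theorem IsDarbouxFamily.linearIndependent {φ : Module.Dual k V} {ω : V →ₗ[k] V →ₗ[k] k}
    {z : V} {n : ℕ} {e f : Fin n → V} (h : IsDarbouxFamily φ ω z e f) :
    LinearIndependent k
      (fun o : Option (Fin n × Bool) => o.elim z fun p => if p.2 then f p.1 else e p.1) := by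
  classical
  rw [Fintype.linearIndependent_iff]
  intro g hg
  simp only [Fintype.sum_option, Fintype.sum_prod_type, Fintype.sum_bool, Option.elim, if_true,
    Bool.false_eq_true, if_false] at hg
  rintro (_ | ⟨i, b⟩)
  · have := congrArg φ hg
    simpa [h.φ_z, h.φ_e, h.φ_f] using this
  · cases b
    · have := congrArg (fun x => ω x (f i)) hg
      simpa [h.ω_z, h.ω_ff, h.ω_ef] using this
    · have := congrArg (fun x => ω x (e i)) hg
      simpa [h.ω_z, h.ω_ee, h.ω_fe] using this

/-- Enlarging the family from `z` alone must end, since its members are linearly independent; where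
it ends it is a basis. The oddness of the dimension is thus a conclusion. -/
theorem exists_isDarbouxFamily_finrank [FiniteDimensional k V] {φ : Module.Dual k V}
    {ω : V →ₗ[k] V →ₗ[k] k} (halt : ∀ x, ω x x = 0) (hskew : ∀ x y, ω x y = -ω y x)
    (hnd : ∀ x, φ x = 0 → (∀ y, ω x y = 0) → x = 0) {z : V} (hφz : φ z = 1)
    (hz : ∀ x, ω z x = 0) :
    ∃ (n : ℕ) (e f : Fin n → V), IsDarbouxFamily φ ω z e f ∧ Module.finrank k V = 2 * n + 1 := by
  by_contra hcon
  push Not at hcon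
  have hall : ∀ n : ℕ, ∃ e f : Fin n → V, IsDarbouxFamily φ ω z e f := by
    intro n
    induction n with
    | zero =>
      exact ⟨Fin.elim0, Fin.elim0, hφz, fun i => i.elim0, fun i => i.elim0, fun i => i.elim0,
        fun i => i.elim0, fun i => i.elim0, fun i => i.elim0, hz,
        fun x => by rw [hskew, hz, neg_zero]⟩
    | succ n ih =>
      obtain ⟨e, f, h⟩ := ih
      refine (h.extend halt hskew hnd).resolve_left fun hspan => hcon n e f h ?_
      have hb : ⊤ ≤ Submodule.span k (Set.range
          (fun o : Option (Fin n × Bool) => o.elim z fun p => if p.2 then f p.1 else e p.1)) := by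
        intro x _
        obtain ⟨a, b, c, rfl⟩ := hspan x
        refine add_mem (add_mem ?_ (sum_mem fun i _ => ?_)) (sum_mem fun i _ => ?_)
        · exact Submodule.smul_mem _ _ (Submodule.subset_span ⟨none, rfl⟩)
        · exact Submodule.smul_mem _ _ (Submodule.subset_span ⟨some (i, false), by simp⟩)
        · exact Submodule.smul_mem _ _ (Submodule.subset_span ⟨some (i, true), by simp⟩)
      rw [Module.finrank_eq_card_basis (Module.Basis.mk h.linearIndependent hb)]
      simp
      ring
  obtain ⟨e, f, h⟩ := hall (Module.finrank k V + 1)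
  have := h.linearIndependent.fintype_card_le_finrank
  simp at this
  omega

/-- An alternating form on a space of odd dimension is degenerate. -/
theorem exists_ne_zero_radical_of_odd [CharZero k] {ω : V →ₗ[k] V →ₗ[k] k} {n : ℕ}
    (hdim : Module.finrank k V = 2 * n + 1) (hskew : ∀ x y, ω x y = -ω y x) :
    ∃ x, x ≠ 0 ∧ ∀ y, ω x y = 0 := by
  have : FiniteDimensional k V := FiniteDimensional.of_finrank_pos (by omega)
  let b := Module.finBasisOfFinrankEq k V hdim
  let M : Matrix (Fin (2 * n + 1)) (Fin (2 * n + 1)) k := Matrix.of fun i j => ω (b j) (b i)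
  have hM : M.transpose = -M := by
    ext i j
    simp [M, hskew (b i) (b j)]
  have hdet : M.det = 0 := by
    -- The matrix is skew of odd size, so transposition changes the sign of the determinant.
    have h1 : M.det = -M.det := by
      conv_lhs => rw [← Matrix.det_transpose, hM, Matrix.det_neg]
      simp [pow_add, pow_mul]
    exact self_eq_neg.1 h1
  obtain ⟨c, hc, hMc⟩ := Matrix.exists_mulVec_eq_zero_iff.2 hdet
  refine ⟨∑ i, c i • b i, fun h0 => hc ?_, fun y => ?_⟩
  · exact funext (Fintype.linearIndependent_iff.1 b.linearIndependent c h0)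
  · have : ω (∑ i, c i • b i) = 0 := by
      refine b.ext fun j => ?_
      have := congrFun hMc j
      simp only [Matrix.mulVec, dotProduct, M, Matrix.of_apply, Pi.zero_apply] at this
      simpa [mul_comm] using this
    rw [this, LinearMap.zero_apply]

end ContactLinearAlgebra

/-! ### The contact condition in terms of kernel and radical. -/

section ContactCriterion

variable {k L : Type*} [Field k] [LieRing L] [LieAlgebra k L]

/-- The exterior derivative of a one-form, as a bilinear form. -/
def oneFormDerivBilin (φ : Module.Dual k L) : L →ₗ[k] L →ₗ[k] k :=
  LinearMap.mk₂ k (oneFormDeriv φ)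
    (by intros; simp [oneFormDeriv]; ring) (by intros; simp [oneFormDeriv])
    (by intros; simp [oneFormDeriv]; ring) (by intros; simp [oneFormDeriv])

theorem oneFormDerivBilin_apply (φ : Module.Dual k L) (x y : L) :
    oneFormDerivBilin φ x y = -φ ⁅x, y⁆ := rfl

theorem oneFormDerivBilin_skew (φ : Module.Dual k L) (x y : L) :
    oneFormDerivBilin φ x y = -oneFormDerivBilin φ y x := by
  rw [oneFormDerivBilin_apply, oneFormDerivBilin_apply, ← lie_skew, map_neg]

/-- The kernel of a contact form meets the radical of its derivative trivially. -/
theorem IsContactForm.eq_zero {φ : Module.Dual k L} (h : IsContactForm k L φ) {x : L}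
    (hφ : φ x = 0) (hx : ∀ y, φ ⁅x, y⁆ = 0) : x = 0 := by
  obtain ⟨n, hdim, v, hv⟩ := h
  refine eq_zero_of_alternatization_ne_zero (ω := oneFormDerivBilin φ) hdim (v := v) (fun h0 => hv ?_) hφ
    (fun y => by rw [oneFormDerivBilin_apply, hx, neg_zero])
    (fun y => by rw [oneFormDerivBilin_skew, oneFormDerivBilin_apply, hx, neg_zero, neg_zero])
  rw [MultilinearMap.alternatization_apply] at h0
  rw [contactVolumeForm, mul_eq_zero]
  right
  rw [← h0]
  refine Finset.sum_congr rfl fun σ _ => ?_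
  rw [Units.smul_def, zsmul_eq_mul]
  rfl

/-- The multiple of `z` with `φ`-value `1` is the Reeb vector, from which a Darboux basis is built.
-/
theorem isContactForm_of_radical [CharZero k] [FiniteDimensional k L] {φ : Module.Dual k L}
    (hnd : ∀ x, φ x = 0 → (∀ y, φ ⁅x, y⁆ = 0) → x = 0) {z : L} (hφz : φ z ≠ 0)
    (hz : ∀ y, φ ⁅z, y⁆ = 0) : IsContactForm k L φ := by
  obtain ⟨n, e, f, h, hdim⟩ := exists_isDarbouxFamily_finrank (φ := φ)
    (ω := oneFormDerivBilin φ) (z := (φ z)⁻¹ • z)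
    (fun x => by rw [oneFormDerivBilin_apply, lie_self, map_zero, neg_zero])
    (oneFormDerivBilin_skew φ)
    (fun x h1 h2 => hnd x h1 fun y => by
      simpa [oneFormDerivBilin_apply] using h2 y)
    (by rw [map_smul, smul_eq_mul, inv_mul_cancel₀ hφz])
    (fun x => by rw [oneFormDerivBilin_apply, smul_lie, map_smul, hz, smul_zero, neg_zero])
  obtain ⟨v, hv⟩ := h.sum_ne_zero
  exact ⟨n, hdim, v, mul_ne_zero (inv_ne_zero (pow_ne_zero _ two_ne_zero)) hv⟩

theorem exists_ne_zero_radical_of_finrank_odd [CharZero k] {n : ℕ}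
    (hdim : Module.finrank k L = 2 * n + 1) (φ : Module.Dual k L) :
    ∃ x : L, x ≠ 0 ∧ ∀ y, φ ⁅x, y⁆ = 0 := by
  obtain ⟨x, hx, h⟩ := exists_ne_zero_radical_of_odd hdim (oneFormDerivBilin_skew φ)
  exact ⟨x, hx, fun y => by simpa [oneFormDerivBilin_apply] using h y⟩

end ContactCriterion

/-! ### The radical of a one-form on a type-A Lie poset algebra -/

section Radical

variable {k α : Type*} [Field k] [Fintype α]

/-- The one-form `∑ f i j E i j ^*` evaluated at `x`. -/
def matrixPairing (f x : Matrix α α k) : k := ∑ i, ∑ j, f i j * x i j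

theorem matrixPairing_eq_trace (f x : Matrix α α k) :
    matrixPairing f x = (f.transpose * x).trace := by
  simp only [matrixPairing, Matrix.trace, Matrix.diag, Matrix.mul_apply, Matrix.transpose_apply]
  exact Finset.sum_comm

/-- Cyclicity of the trace moves the commutator from `y` to `fᵀ`, so the entries of `y` become
independent test variables. -/
theorem matrixPairing_commutator (f x y : Matrix α α k) :
    matrixPairing f (x * y - y * x) = ∑ p, ∑ q,
      ((f.transpose * x) q p - (x * f.transpose) q p) * y p q := by
  have h : matrixPairing f (x * y - y * x) =
      ((f.transpose * x - x * f.transpose) * y).trace := by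
    rw [matrixPairing_eq_trace, mul_sub, sub_mul, Matrix.trace_sub, Matrix.trace_sub, mul_assoc,
      ← mul_assoc f.transpose y x, Matrix.trace_mul_comm (f.transpose * y) x, mul_assoc x]
  rw [h, Matrix.trace, Finset.sum_comm]
  simp [Matrix.diag, Matrix.mul_apply (M := f.transpose * x - x * f.transpose)]

theorem dual_eq_matrixPairing [DecidableEq α] (ψ : Module.Dual k (Matrix α α k)) (x : Matrix α α k) :
    ψ x = matrixPairing (Matrix.of fun i j => ψ (Matrix.single i j 1)) x := by
  conv_lhs => rw [Matrix.matrix_eq_sum_single x]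
  simp only [map_sum, matrixPairing, Matrix.of_apply]
  refine Finset.sum_congr rfl fun i _ => Finset.sum_congr rfl fun j _ => ?_
  rw [show Matrix.single i j (x i j) = x i j • Matrix.single i j (1 : k) by simp, map_smul,
    smul_eq_mul, mul_comm]

variable [PartialOrder α]

/-- The matrix `x` is in the radical of the two-form `(x, y) ↦ f([x, y])`. -/
def RadicalEq (f x : Matrix α α k) : Prop :=
  ∀ p q, p ≤ q → ∑ r, f r q * x r p = ∑ r, x q r * f p r

theorem RadicalEq.matrixPairing_eq_zero {f x y : Matrix α α k} (h : RadicalEq f x)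
    (hy : ∀ i j, ¬ i ≤ j → y i j = 0) : matrixPairing f (x * y - y * x) = 0 := by
  rw [matrixPairing_commutator]
  refine Finset.sum_eq_zero fun p _ => Finset.sum_eq_zero fun q _ => ?_
  by_cases hpq : p ≤ q
  · have := h p q hpq
    simp only [Matrix.mul_apply, Matrix.transpose_apply]
    rw [this, sub_self, zero_mul]
  · rw [hy p q hpq, mul_zero]

variable [DecidableEq α]

theorem mem_typeALiePosetAlgebra_iff {x : Matrix α α k} :
    x ∈ typeALiePosetAlgebra k α ↔ (∀ i j, ¬ i ≤ j → x i j = 0) ∧ x.trace = 0 := Iff.rfl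

theorem coe_bracket_typeA (x y : typeALiePosetAlgebra k α) :
    ((⁅x, y⁆ : typeALiePosetAlgebra k α) : Matrix α α k) = x.1 * y.1 - y.1 * x.1 := rfl

theorem exists_matrixPairing (φ : Module.Dual k (typeALiePosetAlgebra k α)) :
    ∃ f : Matrix α α k, ∀ x, φ x = matrixPairing f x.1 := by
  obtain ⟨ψ, hψ⟩ := LinearMap.exists_extend (p := (typeALiePosetAlgebra k α).toSubmodule) φ
  exact ⟨_, fun x => by rw [← dual_eq_matrixPairing ψ]; exact (LinearMap.congr_fun hψ x).symm⟩

/-- Off the diagonal, test with matrix units. On the diagonal only differences `E p p - E q q` have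
trace zero, so the diagonal entries of `[fᵀ, x]` are merely seen to be equal; but their sum is the
trace of a commutator, hence zero, and characteristic zero makes each of them vanish. -/
theorem radicalEq_of_forall [CharZero k] [Nonempty α] {f x : Matrix α α k}
    (h : ∀ y : typeALiePosetAlgebra k α, matrixPairing f (x * y.1 - y.1 * x) = 0) :
    RadicalEq f x := by
  have key : ∀ p q, ∀ a : k, matrixPairing f (x * Matrix.single p q a - Matrix.single p q a * x) =
      ((f.transpose * x) q p - (x * f.transpose) q p) * a := by
    intro p q a
    rw [matrixPairing_commutator, Finset.sum_eq_single p, Finset.sum_eq_single q]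
    · simp
    · intro b _ hb
      simp [hb.symm]
    · simp
    · intro b _ hb
      exact Finset.sum_eq_zero fun c _ => by simp [hb.symm]
    · simp
  have hlt : ∀ p q, p < q → (f.transpose * x) q p - (x * f.transpose) q p = 0 := by
    intro p q hpq
    have := h ⟨Matrix.single p q 1, mem_typeALiePosetAlgebra_iff.2 ⟨fun i j hij => ?_, ?_⟩⟩
    · simpa [key] using this
    · rw [Matrix.single_apply, if_neg]
      rintro ⟨rfl, rfl⟩
      exact hij hpq.le
    · exact Matrix.trace_single_eq_of_ne p q 1 hpq.ne
  have hdiag : ∀ p q, (f.transpose * x) p p - (x * f.transpose) p p =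
      (f.transpose * x) q q - (x * f.transpose) q q := by
    intro p q
    have h1 := h ⟨Matrix.single p p 1 - Matrix.single q q 1,
      mem_typeALiePosetAlgebra_iff.2 ⟨fun i j hij => ?_, ?_⟩⟩
    · have h2 : matrixPairing f (x * Matrix.single p p 1 - Matrix.single p p 1 * x) -
          matrixPairing f (x * Matrix.single q q 1 - Matrix.single q q 1 * x) = 0 := by
        rw [← h1]
        simp only [matrixPairing_eq_trace, ← Matrix.trace_sub, ← mul_sub, sub_mul]
        congr 2
        simp only [mul_sub]
        abel
      rw [key, key, mul_one, mul_one] at h2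
      exact sub_eq_zero.1 h2
    · rw [Matrix.sub_apply, Matrix.single_apply, Matrix.single_apply, if_neg, if_neg, sub_zero]
      · rintro ⟨rfl, rfl⟩
        exact hij le_rfl
      · rintro ⟨rfl, rfl⟩
        exact hij le_rfl
    · simp [Matrix.trace_sub]
  have hzero : ∀ p, (f.transpose * x) p p - (x * f.transpose) p p = 0 := by
    intro p
    have htr : ∑ q, ((f.transpose * x) q q - (x * f.transpose) q q) = 0 := by
      have := Matrix.trace_mul_comm f.transpose x
      simp only [Matrix.trace, Matrix.diag] at this
      rw [Finset.sum_sub_distrib, this, sub_self]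
    rw [Finset.sum_congr rfl fun q _ => hdiag q p, Finset.sum_const, nsmul_eq_mul,
      mul_eq_zero] at htr
    exact htr.resolve_left (by simp)
  intro p q hpq
  have h3 : (f.transpose * x) q p - (x * f.transpose) q p = 0 := by
    rcases hpq.eq_or_lt with rfl | hpq
    · exact hzero p
    · exact hlt p q hpq
  simpa [Matrix.mul_apply] using sub_eq_zero.1 h3

/-- A contact form has trivial kernel on the radical, in terms of matrices. -/
theorem IsContactForm.matrix_eq_zero {φ : Module.Dual k (typeALiePosetAlgebra k α)}
    (hφ : IsContactForm k _ φ) {f : Matrix α α k} (hf : ∀ x, φ x = matrixPairing f x.1)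
    {x : Matrix α α k} (hx : ∀ i j, ¬ i ≤ j → x i j = 0) (htr : x.trace = 0)
    (hrad : RadicalEq f x) (h0 : matrixPairing f x = 0) : x = 0 := by
  have := hφ.eq_zero (x := ⟨x, mem_typeALiePosetAlgebra_iff.2 ⟨hx, htr⟩⟩)
    (by rw [hf]; exact h0) fun y => by
      rw [hf, coe_bracket_typeA]
      exact hrad.matrixPairing_eq_zero y.2.1
  exact congrArg Subtype.val this

theorem isContactForm_of_matrix [CharZero k] [Nonempty α]
    {φ : Module.Dual k (typeALiePosetAlgebra k α)}
    {f : Matrix α α k} (hf : ∀ x, φ x = matrixPairing f x.1)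
    (hnd : ∀ x : Matrix α α k, (∀ i j, ¬ i ≤ j → x i j = 0) → x.trace = 0 → RadicalEq f x →
      matrixPairing f x = 0 → x = 0)
    {z : Matrix α α k} (hz : ∀ i j, ¬ i ≤ j → z i j = 0) (htr : z.trace = 0)
    (hrad : RadicalEq f z) (h0 : matrixPairing f z ≠ 0) : IsContactForm k _ φ := by
  refine isContactForm_of_radical (z := ⟨z, mem_typeALiePosetAlgebra_iff.2 ⟨hz, htr⟩⟩)
    (fun x hx hxr => Subtype.ext ?_) (by rwa [hf]) fun y => ?_
  · refine hnd x.1 x.2.1 x.2.2 (radicalEq_of_forall fun y => ?_) (by rw [← hf, hx])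
    rw [← coe_bracket_typeA, ← hf, hxr]
  · rw [hf, coe_bracket_typeA]
    exact hrad.matrixPairing_eq_zero y.2.1

theorem exists_radicalEq_of_finrank_odd [CharZero k] [Nonempty α] {n : ℕ}
    (hdim : Module.finrank k (typeALiePosetAlgebra k α) = 2 * n + 1) (f : Matrix α α k) :
    ∃ x : Matrix α α k, x ≠ 0 ∧ (∀ i j, ¬ i ≤ j → x i j = 0) ∧ x.trace = 0 ∧ RadicalEq f x := by
  let φ : Module.Dual k (typeALiePosetAlgebra k α) :=
    { toFun := fun x => matrixPairing f x.1
      map_add' := fun x y => by simp [matrixPairing_eq_trace, mul_add]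
      map_smul' := fun c x => by simp [matrixPairing_eq_trace] }
  obtain ⟨x, hx, h⟩ := exists_ne_zero_radical_of_finrank_odd hdim φ
  exact ⟨x.1, fun h0 => hx (Subtype.ext h0), x.2.1, x.2.2, radicalEq_of_forall h⟩

end Radical

/-! ### Flows and trees -/

section Flow

variable {k α : Type*} [Field k] [Fintype α]

/-- The net flow out of the vertex `v`. -/
def netFlow (w : Matrix α α k) (v : α) : k := ∑ y, w v y - ∑ x, w x v

theorem netFlow_add (w w' : Matrix α α k) (v : α) :
    netFlow (w + w') v = netFlow w v + netFlow w' v := by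
  simp only [netFlow, Matrix.add_apply, Finset.sum_add_distrib]
  ring

theorem netFlow_sub (w w' : Matrix α α k) (v : α) :
    netFlow (w - w') v = netFlow w v - netFlow w' v := by
  simp only [netFlow, Matrix.sub_apply, Finset.sum_sub_distrib]
  ring

theorem sum_netFlow (w : Matrix α α k) : ∑ v, netFlow w v = 0 := by
  simp only [netFlow, Finset.sum_sub_distrib]
  rw [Finset.sum_comm, sub_self]

theorem netFlow_single [DecidableEq α] (p q : α) (t : k) (v : α) :
    netFlow (Matrix.single p q t) v = (if v = p then t else 0) - if v = q then t else 0 := by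
  simp only [netFlow, Matrix.single_apply, ite_and, Finset.sum_ite_irrel, Finset.sum_ite_eq,
    Finset.mem_univ, if_true, Finset.sum_const_zero, @eq_comm _ v]

variable (k) in
/-- There is no nonzero circulation on the edge set `E`: the underlying graph is a forest. -/
def FlowFree (E : Set (α × α)) : Prop :=
  ∀ w : Matrix α α k, (∀ x y, (x, y) ∉ E → w x y = 0) → (∀ v, netFlow w v = 0) → w = 0

end Flow

/-- Trees with edge set `E` and vertex set `V`, built up from the edge `(c, a)` by adding leaves. -/
inductive GrownTree {α : Type*} (c a : α) : Set (α × α) → Set α → Prop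
  | base : c ≠ a → GrownTree c a {(c, a)} {c, a}
  | up {E V p q} : GrownTree c a E V → p ∈ V → q ∉ V → GrownTree c a (insert (p, q) E) (insert q V)
  | down {E V p q} : GrownTree c a E V → p ∉ V → q ∈ V →
      GrownTree c a (insert (p, q) E) (insert p V)

namespace GrownTree

variable {k α : Type*} [Field k] {c a : α} {E : Set (α × α)} {V : Set α}

theorem mem (h : GrownTree c a E V) {x y : α} (hxy : (x, y) ∈ E) : x ∈ V ∧ y ∈ V := by
  induction h with
  | base => simp_all
  | up _ _ _ ih => simp only [Set.mem_insert_iff, Prod.mk.injEq] at hxy ⊢; grind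
  | down _ _ _ ih => simp only [Set.mem_insert_iff, Prod.mk.injEq] at hxy ⊢; grind

theorem base_mem (h : GrownTree c a E V) : (c, a) ∈ E := by
  induction h with
  | base => rfl
  | up _ _ _ ih => exact Or.inr ih
  | down _ _ _ ih => exact Or.inr ih

variable [Fintype α]

/-- Conservation at the leaf added last forces the flow on its edge to vanish; what remains is a
circulation on the smaller tree. -/
theorem flowFree (h : GrownTree c a E V) : FlowFree k E := by
  classical
  induction h with
  | base hca =>
    intro w hw hflow
    have h1 := hflow a
    rw [netFlow, Finset.sum_eq_zero, Finset.sum_eq_single c, zero_sub, neg_eq_zero] at h1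
    · ext x y
      by_cases hxy : (x, y) = (c, a)
      · simp only [Prod.mk.injEq] at hxy
        rw [hxy.1, hxy.2, h1, Matrix.zero_apply]
      · exact hw x y hxy
    · exact fun b _ hb => hw _ _ (by simp [hb])
    · simp
    · exact fun b _ => hw _ _ (by simp [hca.symm])
  | @up E V p q h hp hq ih =>
    intro w hw hflow
    have hpq : p ≠ q := fun h => hq (h ▸ hp)
    have h1 := hflow q
    rw [netFlow, Finset.sum_eq_zero, Finset.sum_eq_single p, zero_sub, neg_eq_zero] at h1
    · refine ih w (fun x y hxy => ?_) hflow
      by_cases hxy' : (x, y) = (p, q)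
      · simp only [Prod.mk.injEq] at hxy'
        rw [hxy'.1, hxy'.2, h1]
      · exact hw x y (by simp [hxy, hxy'])
    · refine fun b _ hb => hw _ _ ?_
      simp only [Set.mem_insert_iff, Prod.mk.injEq, not_or]
      exact ⟨fun h => hb h.1, fun hb' => hq (h.mem hb').2⟩
    · simp
    · refine fun b _ => hw _ _ ?_
      simp only [Set.mem_insert_iff, Prod.mk.injEq, not_or]
      exact ⟨fun h => hpq h.1.symm, fun hb' => hq (h.mem hb').1⟩
  | @down E V p q h hp hq ih =>
    intro w hw hflow
    have hpq : p ≠ q := fun h => hp (h ▸ hq)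
    have h1 := hflow p
    rw [netFlow, Finset.sum_eq_single q, Finset.sum_eq_zero, sub_zero] at h1
    · refine ih w (fun x y hxy => ?_) hflow
      by_cases hxy' : (x, y) = (p, q)
      · simp only [Prod.mk.injEq] at hxy'
        rw [hxy'.1, hxy'.2, h1]
      · exact hw x y (by simp [hxy, hxy'])
    · refine fun b _ => hw _ _ ?_
      simp only [Set.mem_insert_iff, Prod.mk.injEq, not_or]
      exact ⟨fun h => hpq h.2, fun hb' => hp (h.mem hb').2⟩
    · refine fun b _ hb => hw _ _ ?_
      simp only [Set.mem_insert_iff, Prod.mk.injEq, not_or]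
      exact ⟨fun h => hb h.2, fun hb' => hp (h.mem hb').1⟩
    · simp

/-- The demand at the last leaf is sent through its only edge, which shifts it to the other end of
that edge and leaves a problem on the smaller tree. -/
theorem exists_netFlow_eq (h : GrownTree c a E V) (g : α → k) (hg : ∀ v ∉ V, g v = 0)
    (hsum : ∑ v, g v = 0) :
    ∃ w : Matrix α α k, (∀ x y, (x, y) ∉ E → w x y = 0) ∧ ∀ v, netFlow w v = g v := by
  classical
  induction h generalizing g with
  | base hca =>
    refine ⟨Matrix.single c a (g c), fun x y hxy => ?_, fun v => ?_⟩
    · rw [Matrix.single_apply, if_neg]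
      rintro ⟨rfl, rfl⟩
      exact hxy rfl
    · have hga : g a = -g c := by
        rw [← Finset.sum_subset (Finset.subset_univ {c, a}) fun v _ hv => hg v (by simpa using hv),
          Finset.sum_pair hca] at hsum
        linear_combination hsum
      rw [netFlow_single]
      split_ifs with h1 h2 h2
      · exact absurd (h1.symm.trans h2) hca
      · rw [h1, sub_zero]
      · rw [h2, hga, zero_sub]
      · rw [hg v (by simp [h1, h2]), sub_zero]
  | @up E V p q h hp hq ih =>
    have hpq : p ≠ q := fun h => hq (h ▸ hp)
    obtain ⟨w, hw, hflow⟩ := ih (fun v => g v + netFlow (Matrix.single p q (g q)) v)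
      (fun v hv => by
        rw [netFlow_single, if_neg (c := v = p) fun h => hv (h ▸ hp), zero_sub]
        split_ifs with h1
        · rw [h1, add_neg_cancel]
        · rw [hg v (by simp [h1, hv]), neg_zero, zero_add])
      (by rw [Finset.sum_add_distrib, hsum, sum_netFlow, zero_add])
    refine ⟨w - Matrix.single p q (g q), fun x y hxy => ?_, fun v => ?_⟩
    · simp only [Set.mem_insert_iff, not_or, Prod.mk.injEq] at hxy
      rw [Matrix.sub_apply, hw x y hxy.2, Matrix.single_apply,
        if_neg fun h => hxy.1 ⟨h.1.symm, h.2.symm⟩, sub_zero]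
    · rw [netFlow_sub, hflow, add_sub_cancel_right]
  | @down E V p q h hp hq ih =>
    have hpq : p ≠ q := fun h => hp (h ▸ hq)
    obtain ⟨w, hw, hflow⟩ := ih (fun v => g v - netFlow (Matrix.single p q (g p)) v)
      (fun v hv => by
        rw [netFlow_single, if_neg (c := v = q) fun h => hv (h ▸ hq), sub_zero]
        split_ifs with h1
        · rw [h1, sub_self]
        · rw [hg v (by simp [h1, hv]), sub_zero])
      (by rw [Finset.sum_sub_distrib, hsum, sum_netFlow, sub_zero])
    refine ⟨w + Matrix.single p q (g p), fun x y hxy => ?_, fun v => ?_⟩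
    · simp only [Set.mem_insert_iff, not_or, Prod.mk.injEq] at hxy
      rw [Matrix.add_apply, hw x y hxy.2, Matrix.single_apply,
        if_neg fun h => hxy.1 ⟨h.1.symm, h.2.symm⟩, add_zero]
    · rw [netFlow_add, hflow, sub_add_cancel]

/-- A spanning tree of a forest is the whole forest. -/
theorem eq_of_flowFree (h : GrownTree c a E V) {H : Set (α × α)} (hEH : E ⊆ H)
    (hH : ∀ x y, (x, y) ∈ H → x ∈ V ∧ y ∈ V) (hfree : FlowFree k H) : E = H := by
  classical
  refine hEH.antisymm ?_
  rintro ⟨p, q⟩ hpq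
  by_contra hE
  -- A unit flow on an edge outside the tree can be rerouted through the tree; the difference of the
  -- two flows is a nonzero circulation.
  obtain ⟨w, hw, hflow⟩ := h.exists_netFlow_eq (k := k) (netFlow (Matrix.single p q 1))
    (fun v hv => by
      rw [netFlow_single, if_neg, if_neg, sub_zero]
      · rintro rfl; exact hv (hH _ _ hpq).2
      · rintro rfl; exact hv (hH _ _ hpq).1) (sum_netFlow _)
  have h0 := hfree (w - Matrix.single p q 1)
    (fun x y hxy => by
      rw [Matrix.sub_apply, hw x y fun h => hxy (hEH h), Matrix.single_apply, if_neg, sub_zero]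
      rintro ⟨rfl, rfl⟩
      exact hxy hpq)
    (fun v => by rw [netFlow_sub, hflow, sub_self])
  have := congrFun (congrFun h0 p) q
  rw [Matrix.sub_apply, hw p q hE, Matrix.single_apply_same, Matrix.zero_apply, zero_sub] at this
  exact one_ne_zero (neg_eq_zero.1 this)

end GrownTree

/-! ### Connected posets of height two -/

section Poset

/-- Connectedness is used only in this form and its converse `hasse_connected_of_forall`: a
predicate constant along relations is constant. -/
theorem iff_of_hasse_connected {β : Type*} [PartialOrder β]
    (h : (SimpleGraph.hasse β).Connected) {S : β → Prop} (hS : ∀ x y, x < y → (S x ↔ S y))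
    (x y : β) : S x ↔ S y := by
  obtain ⟨w⟩ := h.preconnected x y
  induction w with
  | nil => rfl
  | cons hadj _ ih =>
    rw [← ih]
    rcases SimpleGraph.hasse_adj.1 hadj with h' | h'
    · exact hS _ _ h'.lt
    · exact (hS _ _ h'.lt).symm

theorem hasse_connected_of_forall {β : Type*} [PartialOrder β] [Finite β] [Nonempty β]
    (h : ∀ S : β → Prop, (∀ x y, x < y → (S x ↔ S y)) → ∀ x y, S x → S y) :
    (SimpleGraph.hasse β).Connected := by
  classical
  cases nonempty_fintype β
  let _ := Fintype.toLocallyFiniteOrder (α := β)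
  have hlt : ∀ x y : β, x < y → (SimpleGraph.hasse β).Reachable x y := by
    intro x y hxy
    induction lt_iff_transGen_covBy.1 hxy with
    | single h' => exact (SimpleGraph.hasse_adj.2 (Or.inl h')).reachable
    | tail _ h' ih =>
      exact (ih (lt_iff_transGen_covBy.2 ‹_›)).trans
        (SimpleGraph.hasse_adj.2 (Or.inl h')).reachable
  refine SimpleGraph.Connected.mk fun x y => ?_
  exact h (fun y => (SimpleGraph.hasse β).Reachable x y)
    (fun y z hyz => ⟨fun h' => h'.trans (hlt _ _ hyz), fun h' => h'.trans (hlt _ _ hyz).symm⟩)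
    x y (SimpleGraph.Reachable.refl x)

theorem not_lt_of_krullDim_le_two {β : Type*} [Preorder β] (h : Order.krullDim β ≤ 2)
    {a b c d : β} (hab : a < b) (hbc : b < c) : ¬ c < d := by
  intro hcd
  let s : LTSeries β := ⟨3, ![a, b, c, d], by
    intro i
    fin_cases i
    · exact hab
    · exact hbc
    · exact hcd⟩
  have h3 : ((3 : ℕ) : WithBot ℕ∞) ≤ 2 := (le_iSup (fun p : LTSeries β => ((p.length : ℕ) :
    WithBot ℕ∞)) s).trans h
  have : ((3 : ℕ) : WithBot ℕ∞) ≤ ((2 : ℕ) : WithBot ℕ∞) := h3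
  have : (3 : ℕ) ≤ 2 := by exact_mod_cast this
  omega

variable {k α : Type*} [Field k] [PartialOrder α]

variable (α) in
/-- The relations between minimal and maximal elements. -/
def minMaxRel : Set (α × α) := {e | e.1 < e.2 ∧ IsMin e.1 ∧ IsMax e.2}

variable (α) in
/-- The minimal and the maximal elements. -/
def extremal : Set α := {x | IsMin x ∨ IsMax x}

theorem mem_extremal_of_mem_minMaxRel {x y : α} (h : (x, y) ∈ minMaxRel α) :
    x ∈ extremal α ∧ y ∈ extremal α := ⟨Or.inl h.2.1, Or.inr h.2.2⟩

theorem exists_isMin_le' [Finite α] (x : α) : ∃ p ≤ x, IsMin p := by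
  obtain ⟨p, hp⟩ := Set.Finite.exists_minimal (Set.toFinite {y | y ≤ x}) ⟨x, le_rfl⟩
  exact ⟨p, hp.1, fun y hy => hp.2 (hy.trans hp.1) hy⟩

theorem exists_le_isMax' [Finite α] (x : α) : ∃ q, x ≤ q ∧ IsMax q := by
  obtain ⟨q, hq⟩ := Set.Finite.exists_maximal (Set.toFinite {y | x ≤ y}) ⟨x, le_rfl⟩
  exact ⟨q, hq.1, fun y hy => hq.2 (hq.1.trans hy) hy⟩

/-- The bipartite graph of minimal and maximal elements of a connected poset is connected. -/
theorem iff_of_mem_extremal [Finite α] (hconn : (SimpleGraph.hasse α).Connected) {S : α → Prop}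
    (hS : ∀ p q, (p, q) ∈ minMaxRel α → (S p ↔ S q)) {x y : α} (hx : x ∈ extremal α)
    (hy : y ∈ extremal α) : S x ↔ S y := by
  have hS' : ∀ p q, IsMin p → IsMax q → p ≤ q → (S p ↔ S q) := by
    intro p q hp hq hpq
    rcases hpq.eq_or_lt with rfl | h
    · rfl
    · exact hS p q ⟨h, hp, hq⟩
  -- The predicate is extended to all elements by asking for a minimal element below that satisfies
  -- it. For `x < y` any maximal element above `y` is above both, so it links the minimal elements
  -- below `y` with those below `x`.
  have hext : ∀ x ∈ extremal α, (∃ p ≤ x, IsMin p ∧ S p) ↔ S x := by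
    rintro x (hx | hx)
    · refine ⟨fun ⟨p, hpx, _, hp⟩ => ?_, fun h => ⟨x, le_rfl, hx, h⟩⟩
      rwa [le_antisymm hpx (hx hpx)] at hp
    · refine ⟨fun ⟨p, hpx, hp, h⟩ => (hS' p x hp hx hpx).1 h, fun h => ?_⟩
      obtain ⟨p, hpx, hp⟩ := exists_isMin_le' x
      exact ⟨p, hpx, hp, (hS' p x hp hx hpx).2 h⟩
  rw [← hext x hx, ← hext y hy]
  refine iff_of_hasse_connected hconn (S := fun x => ∃ p ≤ x, IsMin p ∧ S p)
    (fun x y hxy => ⟨fun ⟨p, hpx, h⟩ => ⟨p, hpx.trans hxy.le, h⟩,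
    fun ⟨p, hpy, hp, h⟩ => ?_⟩) x y
  obtain ⟨q, hyq, hq⟩ := exists_le_isMax' y
  obtain ⟨p', hpx, hp'⟩ := exists_isMin_le' x
  exact ⟨p', hpx, hp', (hS' p' q hp' hq (hpx.trans (hxy.le.trans hyq))).2
    ((hS' p q hp hq (hpy.trans hyq)).1 h)⟩

/-- Every edge between minimal and maximal elements extends to a spanning tree. -/
theorem exists_grownTree [Finite α] (hconn : (SimpleGraph.hasse α).Connected) {c a : α}
    (hca : (c, a) ∈ minMaxRel α) : ∃ E ⊆ minMaxRel α, GrownTree c a E (extremal α) := by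
  have key : ∀ (n : ℕ) (E : Set (α × α)) (V : Set α), E ⊆ minMaxRel α → V ⊆ extremal α →
      GrownTree c a E V → (extremal α \ V).ncard = n →
      ∃ E ⊆ minMaxRel α, GrownTree c a E (extremal α) := by
    intro n
    induction n with
    | zero =>
      intro E V hE hV h hn
      rw [Set.ncard_eq_zero (Set.toFinite _), Set.sdiff_eq_empty] at hn
      exact ⟨E, hE, hV.antisymm hn ▸ h⟩
    | succ n ih =>
      intro E V hE hV h hn
      obtain ⟨x, hx, hxV⟩ := (Set.ncard_pos (Set.toFinite (extremal α \ V))).1 (by omega)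
      have hstep : ∀ y ∈ extremal α, y ∉ V → insert y V ⊆ extremal α ∧
          (extremal α \ insert y V).ncard = n := by
        intro y hy hyV
        refine ⟨Set.insert_subset hy hV, ?_⟩
        have h1 : extremal α \ insert y V = (extremal α \ V) \ {y} := by
          ext z
          simp only [Set.mem_sdiff, Set.mem_insert_iff, Set.mem_singleton_iff]
          tauto
        rw [h1, Set.ncard_sdiff_singleton_of_mem (show y ∈ extremal α \ V from ⟨hy, hyV⟩), hn, Nat.add_sub_cancel]
      -- If no min–max edge left `V`, membership in `V` would be constant along the edges and `V`
      -- would contain all extremal elements.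
      by_contra hcon
      have hcV : c ∈ V := (h.mem h.base_mem).1
      refine hxV ((iff_of_mem_extremal hconn (S := fun x => x ∈ V) (fun p q hpq => ?_)
        (hV hcV) hx).1 hcV)
      obtain ⟨hp, hq⟩ := mem_extremal_of_mem_minMaxRel hpq
      constructor <;> intro h' <;> by_contra hn'
      · exact hcon (ih _ _ (Set.insert_subset hpq hE) (hstep q hq hn').1 (h.up h' hn')
          (hstep q hq hn').2)
      · exact hcon (ih _ _ (Set.insert_subset hpq hE) (hstep p hp hn').1 (h.down hn' h')
          (hstep p hp hn').2)
  exact key _ {(c, a)} {c, a} (Set.singleton_subset_iff.2 hca)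
    (Set.insert_subset (Or.inl hca.2.1) (Set.singleton_subset_iff.2 (Or.inr hca.2.2)))
    (GrownTree.base hca.1.ne) rfl

theorem grownTree_minMaxRel [Fintype α] (hconn : (SimpleGraph.hasse α).Connected)
    (hfree : FlowFree k (minMaxRel α)) {c a : α} (hca : (c, a) ∈ minMaxRel α) :
    GrownTree c a (minMaxRel α) (extremal α) := by
  obtain ⟨E, hE, h⟩ := exists_grownTree hconn hca
  rwa [h.eq_of_flowFree hE (fun x y => mem_extremal_of_mem_minMaxRel) hfree] at h

end Poset

/-! ### Neighbourhoods of middle elements -/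

section Neighbourhood

variable {α : Type*}

/-- `c` is the only element below `m`, and `a` is the only element above `m`. -/
def Nbhd11 (r : α → α → Prop) (m c a : α) : Prop :=
  (∀ x, r x m ↔ x = c) ∧ ∀ y, r m y ↔ y = a

/-- `c` is the only element below `m`, and `a₁, a₂` are the elements above `m`. -/
def Nbhd12 (r : α → α → Prop) (m c a₁ a₂ : α) : Prop :=
  a₁ ≠ a₂ ∧ (∀ x, r x m ↔ x = c) ∧ ∀ y, r m y ↔ y = a₁ ∨ y = a₂

/-- `a₁, a₂` are the elements below `m`, and `c` is the only element above `m`. -/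
def Nbhd21 (r : α → α → Prop) (m a₁ a₂ c : α) : Prop :=
  a₁ ≠ a₂ ∧ (∀ x, r x m ↔ x = a₁ ∨ x = a₂) ∧ ∀ y, r m y ↔ y = c

theorem Nbhd12.not_nbhd11 {r : α → α → Prop} {m c a₁ a₂ : α} (h : Nbhd12 r m c a₁ a₂)
    (c' a' : α) : ¬ Nbhd11 r m c' a' := fun h' =>
  h.1 (((h'.2 a₁).1 ((h.2.2 a₁).2 (Or.inl rfl))).trans
    ((h'.2 a₂).1 ((h.2.2 a₂).2 (Or.inr rfl))).symm)

theorem Nbhd21.not_nbhd11 {r : α → α → Prop} {m a₁ a₂ c : α} (h : Nbhd21 r m a₁ a₂ c)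
    (c' a' : α) : ¬ Nbhd11 r m c' a' := fun h' =>
  h.1 (((h'.1 a₁).1 ((h.2.1 a₁).2 (Or.inl rfl))).trans
    ((h'.1 a₂).1 ((h.2.1 a₂).2 (Or.inr rfl))).symm)

/-- The shape of the coefficients of the standard one-form at a middle element. -/
def StandardAt {k : Type*} [Field k] (r : α → α → Prop) (f : Matrix α α k) (m : α) : Prop :=
  (∃ c a₁ a₂, Nbhd12 r m c a₁ a₂ ∧ f c m = 0 ∧ f m a₁ = 0 ∧ f m a₂ = 1) ∨
  (∃ a₁ a₂ c, Nbhd21 r m a₁ a₂ c ∧ f a₁ m = 0 ∧ f a₂ m = 1 ∧ f m c = 0)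

end Neighbourhood

/-! ### The sums in the radical equations at elements with few neighbours. -/

section Entries

variable {k α : Type*} [Field k] [Fintype α] [PartialOrder α] {f x : Matrix α α k}

theorem sum_left_of_isMin (hx : ∀ i j, ¬ i ≤ j → x i j = 0) {p : α} (hp : IsMin p) (q : α) :
    ∑ r, f r q * x r p = f p q * x p p := by
  classical
  refine Finset.sum_eq_single p (fun r _ hr => ?_) (by simp)
  rw [hx r p fun h => hr (le_antisymm h (hp h)), mul_zero]

theorem sum_right_of_isMax (hx : ∀ i j, ¬ i ≤ j → x i j = 0) (p : α) {q : α} (hq : IsMax q) :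
    ∑ r, x q r * f p r = x q q * f p q := by
  classical
  refine Finset.sum_eq_single q (fun r _ hr => ?_) (by simp)
  rw [hx q r fun h => hr (le_antisymm (hq h) h), zero_mul]

theorem sum_left_of_below_one (hx : ∀ i j, ¬ i ≤ j → x i j = 0) {m c : α}
    (hm : ∀ y, y < m ↔ y = c) (q : α) :
    ∑ r, f r q * x r m = f m q * x m m + f c q * x c m := by
  classical
  rw [← Finset.sum_pair (f := fun r => f r q * x r m) ((hm c).2 rfl).ne']
  refine (Finset.sum_subset (Finset.subset_univ _) fun r _ hr => ?_).symm
  simp only [Finset.mem_insert, Finset.mem_singleton, not_or] at hr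
  rw [hx r m fun h => hr.2 ((hm r).1 (lt_of_le_of_ne h hr.1)), mul_zero]

theorem sum_right_of_above_one (hx : ∀ i j, ¬ i ≤ j → x i j = 0) {m a : α}
    (hm : ∀ y, m < y ↔ y = a) (p : α) :
    ∑ r, x m r * f p r = x m m * f p m + x m a * f p a := by
  classical
  rw [← Finset.sum_pair (f := fun r => x m r * f p r) ((hm a).2 rfl).ne]
  refine (Finset.sum_subset (Finset.subset_univ _) fun r _ hr => ?_).symm
  simp only [Finset.mem_insert, Finset.mem_singleton, not_or] at hr
  rw [hx m r fun h => hr.2 ((hm r).1 (lt_of_le_of_ne h (Ne.symm hr.1))), zero_mul]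

theorem sum_left_of_below_two (hx : ∀ i j, ¬ i ≤ j → x i j = 0) {m a₁ a₂ : α} (hne : a₁ ≠ a₂)
    (hm : ∀ y, y < m ↔ y = a₁ ∨ y = a₂) (q : α) :
    ∑ r, f r q * x r m = f m q * x m m + (f a₁ q * x a₁ m + f a₂ q * x a₂ m) := by
  classical
  have h1 := ((hm a₁).2 (Or.inl rfl)).ne'
  have h2 := ((hm a₂).2 (Or.inr rfl)).ne'
  rw [← Finset.sum_pair (f := fun r => f r q * x r m) hne,
    ← Finset.sum_insert (f := fun r => f r q * x r m) (by simp [h1, h2])]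
  refine (Finset.sum_subset (Finset.subset_univ _) fun r _ hr => ?_).symm
  simp only [Finset.mem_insert, Finset.mem_singleton, not_or] at hr
  rw [hx r m fun h => not_or.2 hr.2 ((hm r).1 (lt_of_le_of_ne h hr.1)), mul_zero]

theorem sum_right_of_above_two (hx : ∀ i j, ¬ i ≤ j → x i j = 0) {m a₁ a₂ : α} (hne : a₁ ≠ a₂)
    (hm : ∀ y, m < y ↔ y = a₁ ∨ y = a₂) (p : α) :
    ∑ r, x m r * f p r = x m m * f p m + (x m a₁ * f p a₁ + x m a₂ * f p a₂) := by
  classical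
  have h1 := ((hm a₁).2 (Or.inl rfl)).ne
  have h2 := ((hm a₂).2 (Or.inr rfl)).ne
  rw [← Finset.sum_pair (f := fun r => x m r * f p r) hne,
    ← Finset.sum_insert (f := fun r => x m r * f p r) (by simp [h1, h2])]
  refine (Finset.sum_subset (Finset.subset_univ _) fun r _ hr => ?_).symm
  simp only [Finset.mem_insert, Finset.mem_singleton, not_or] at hr
  rw [hx m r fun h => not_or.2 hr.2 ((hm r).1 (lt_of_le_of_ne h (Ne.symm hr.1))), zero_mul]

end Entries

/-! ### The radical of the standard one-form -/

section Standard

variable {k α : Type*} [Field k] [PartialOrder α]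

/-- No chain has four elements. -/
def HeightLeTwo (α : Type*) [PartialOrder α] : Prop := ∀ a b c d : α, a < b → b < c → ¬ c < d

theorem HeightLeTwo.isMin (h : HeightLeTwo α) {p m : α} (hpm : p < m) (hm : ¬ IsMax m) :
    IsMin p := by
  obtain ⟨q, hq⟩ := not_isMax_iff.1 hm
  exact isMin_iff_forall_not_lt.2 fun r hr => h r p m q hr hpm hq

theorem HeightLeTwo.isMax (h : HeightLeTwo α) {m q : α} (hmq : m < q) (hm : ¬ IsMin m) :
    IsMax q := by
  obtain ⟨p, hp⟩ := not_isMin_iff.1 hm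
  exact isMax_iff_forall_not_lt.2 fun r hr => h p m q r hp hmq hr

theorem HeightLeTwo.mem_minMaxRel (h : HeightLeTwo α) {p m q : α} (hpm : p < m) (hmq : m < q) :
    (p, q) ∈ minMaxRel α :=
  ⟨hpm.trans hmq, h.isMin hpm hmq.not_isMax, h.isMax hmq hpm.not_isMin⟩

theorem not_mem_extremal_iff {m : α} : m ∉ extremal α ↔ (∃ p, p < m) ∧ ∃ q, m < q := by
  rw [extremal, Set.mem_ofPred_eq, not_or, not_isMin_iff, not_isMax_iff]

theorem not_mem_extremal_of_lt_of_lt {p m q : α} (hpm : p < m) (hmq : m < q) : m ∉ extremal α :=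
  not_mem_extremal_iff.2 ⟨⟨p, hpm⟩, q, hmq⟩

/-- A middle element of type `(1, 1)`. -/
def IsMid11 (α : Type*) [PartialOrder α] (m : α) : Prop := ∃ c a, Nbhd11 (α := α) (· < ·) m c a

/-- The shape of the coefficients of the standard one-form. -/
structure IsStandard (f : Matrix α α k) : Prop where
  minMax : ∀ p q, (p, q) ∈ minMaxRel α → f p q = 1
  mid : ∀ m ∉ extremal α, (∃ c a, Nbhd11 (· < ·) m c a ∧ f c m = 0 ∧ f m a = 1) ∨
    StandardAt (· < ·) f m

variable [Fintype α] {f x : Matrix α α k}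

/-- On a min–max edge the radical equation reads `x p p = x q q`, and the graph of these edges is
connected. -/
theorem IsStandard.diag_eq (hf : IsStandard f) (hconn : (SimpleGraph.hasse α).Connected)
    (hx : ∀ i j, ¬ i ≤ j → x i j = 0) (hrad : RadicalEq f x) {u v : α} (hu : u ∈ extremal α)
    (hv : v ∈ extremal α) : x u u = x v v := by
  refine (iff_of_mem_extremal hconn (S := fun y => x y y = x v v) (fun p q hpq => ?_) hu hv).2 rfl
  have := hrad p q hpq.1.le
  rw [sum_left_of_isMin hx hpq.2.1, sum_right_of_isMax hx p hpq.2.2, hf.minMax p q hpq, one_mul,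
    mul_one] at this
  rw [this]

/-- These are the equations at `(c, m)` and `(m, a)`. The entry `x m m` stays free, and this freedom
is what makes the radical nonzero in trace zero. -/
theorem IsStandard.at_mid11 (hf : IsStandard f) (h2 : HeightLeTwo α)
    (hx : ∀ i j, ¬ i ≤ j → x i j = 0) (hrad : RadicalEq f x) {t : k}
    (ht : ∀ y ∈ extremal α, x y y = t) {m c a : α} (hm : Nbhd11 (· < ·) m c a) (hc : f c m = 0)
    (ha : f m a = 1) : x m a = 0 ∧ x c m = t - x m m := by
  have hcm : c < m := (hm.1 c).2 rfl
  have hma : m < a := (hm.2 a).2 rfl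
  have hca := h2.mem_minMaxRel hcm hma
  have e1 := hrad c m hcm.le
  rw [sum_left_of_isMin hx hca.2.1, sum_right_of_above_one hx hm.2, hc, hf.minMax _ _ hca] at e1
  have e2 := hrad m a hma.le
  rw [sum_left_of_below_one hx hm.1, sum_right_of_isMax hx m hca.2.2, ha, hf.minMax _ _ hca,
    ht a (Or.inr hca.2.2)] at e2
  exact ⟨by linear_combination -e1, by linear_combination e2⟩

/-- The equations at `(c, m)`, `(m, a₁)`, `(m, a₂)` and `(m, m)` determine the four unknown entries;
the coefficient `f m m` cancels. -/
theorem IsStandard.at_mid12 (hf : IsStandard f) (h2 : HeightLeTwo α)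
    (hx : ∀ i j, ¬ i ≤ j → x i j = 0) (hrad : RadicalEq f x) {t : k}
    (ht : ∀ y ∈ extremal α, x y y = t) {m c a₁ a₂ : α} (hm : Nbhd12 (· < ·) m c a₁ a₂)
    (hc : f c m = 0) (ha₁ : f m a₁ = 0) (ha₂ : f m a₂ = 1) :
    x m m = t ∧ x c m = 0 ∧ x m a₁ = 0 ∧ x m a₂ = 0 := by
  obtain ⟨hne, hb, ha⟩ := hm
  have hcm : c < m := (hb c).2 rfl
  have hma₁ : m < a₁ := (ha a₁).2 (Or.inl rfl)
  have hma₂ : m < a₂ := (ha a₂).2 (Or.inr rfl)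
  have hca₁ := h2.mem_minMaxRel hcm hma₁
  have hca₂ := h2.mem_minMaxRel hcm hma₂
  have e1 := hrad c m hcm.le
  rw [sum_left_of_isMin hx hca₁.2.1, sum_right_of_above_two hx hne ha, hc, hf.minMax _ _ hca₁,
    hf.minMax _ _ hca₂] at e1
  have e2 := hrad m a₁ hma₁.le
  rw [sum_left_of_below_one hx hb, sum_right_of_isMax hx m hca₁.2.2, ha₁, hf.minMax _ _ hca₁] at e2
  have e3 := hrad m a₂ hma₂.le
  rw [sum_left_of_below_one hx hb, sum_right_of_isMax hx m hca₂.2.2, ha₂, hf.minMax _ _ hca₂,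
    ht a₂ (Or.inr hca₂.2.2)] at e3
  have e4 := hrad m m le_rfl
  rw [sum_left_of_below_one hx hb, sum_right_of_above_two hx hne ha, hc, ha₁, ha₂] at e4
  exact ⟨by linear_combination e3 - e2, by linear_combination e2,
    by linear_combination -e1 + e4, by linear_combination -e4⟩

theorem IsStandard.at_mid21 (hf : IsStandard f) (h2 : HeightLeTwo α)
    (hx : ∀ i j, ¬ i ≤ j → x i j = 0) (hrad : RadicalEq f x) {t : k}
    (ht : ∀ y ∈ extremal α, x y y = t) {m a₁ a₂ c : α} (hm : Nbhd21 (· < ·) m a₁ a₂ c)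
    (ha₁ : f a₁ m = 0) (ha₂ : f a₂ m = 1) (hc : f m c = 0) :
    x m m = t ∧ x m c = 0 ∧ x a₁ m = 0 ∧ x a₂ m = 0 := by
  obtain ⟨hne, ha, hb⟩ := hm
  have hmc : m < c := (hb c).2 rfl
  have ham₁ : a₁ < m := (ha a₁).2 (Or.inl rfl)
  have ham₂ : a₂ < m := (ha a₂).2 (Or.inr rfl)
  have hac₁ := h2.mem_minMaxRel ham₁ hmc
  have hac₂ := h2.mem_minMaxRel ham₂ hmc
  have e1 := hrad m c hmc.le
  rw [sum_left_of_below_two hx hne ha, sum_right_of_isMax hx m hac₁.2.2, hc, hf.minMax _ _ hac₁,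
    hf.minMax _ _ hac₂] at e1
  have e2 := hrad a₁ m ham₁.le
  rw [sum_left_of_isMin hx hac₁.2.1, sum_right_of_above_one hx hb, ha₁, hf.minMax _ _ hac₁] at e2
  have e3 := hrad a₂ m ham₂.le
  rw [sum_left_of_isMin hx hac₂.2.1, sum_right_of_above_one hx hb, ha₂, hf.minMax _ _ hac₂,
    ht a₂ (Or.inl hac₂.2.1)] at e3
  have e4 := hrad m m le_rfl
  rw [sum_left_of_below_two hx hne ha, sum_right_of_above_one hx hb, hc, ha₁, ha₂] at e4
  exact ⟨by linear_combination -e3 + e2, by linear_combination -e2,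
    by linear_combination e1 - e4, by linear_combination e4⟩

/-- The radical of the standard one-form. -/
theorem IsStandard.radical (hf : IsStandard f) (h2 : HeightLeTwo α)
    (hconn : (SimpleGraph.hasse α).Connected) (hfree : FlowFree k (minMaxRel α))
    (hx : ∀ i j, ¬ i ≤ j → x i j = 0) (hrad : RadicalEq f x) :
    ∃ t, (∀ y ∈ extremal α, x y y = t) ∧
      (∀ m ∉ extremal α, ¬ IsMid11 α m → x m m = t) ∧
      ∀ p q, p < q → (IsMid11 α q ∧ q ∉ extremal α ∧ x p q = t - x q q ∧ f p q = 0) ∨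
        x p q = 0 := by
  classical
  obtain ⟨y₀⟩ := hconn.nonempty
  obtain ⟨e₀, -, he₀⟩ := exists_isMin_le' y₀
  have ht : ∀ y ∈ extremal α, x y y = x e₀ e₀ := fun y hy =>
    hf.diag_eq hconn hx hrad hy (Or.inl he₀)
  have hup : ∀ p q, p < q → p ∉ extremal α → x p q = 0 := by
    intro p q hpq hp
    rcases hf.mid p hp with ⟨c, a, hm, hc, ha⟩ | ⟨c, a₁, a₂, hm, hc, ha₁, ha₂⟩ |
      ⟨a₁, a₂, c, hm, ha₁, ha₂, hc⟩
    · rw [(hm.2 q).1 hpq]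
      exact (hf.at_mid11 h2 hx hrad ht hm hc ha).1
    · obtain ⟨-, -, h3, h4⟩ := hf.at_mid12 h2 hx hrad ht hm hc ha₁ ha₂
      rcases (hm.2.2 q).1 hpq with rfl | rfl
      · exact h3
      · exact h4
    · rw [(hm.2.2 q).1 hpq]
      exact (hf.at_mid21 h2 hx hrad ht hm ha₁ ha₂ hc).2.1
  have hdown : ∀ p q, p < q → q ∉ extremal α →
      (IsMid11 α q ∧ q ∉ extremal α ∧ x p q = x e₀ e₀ - x q q ∧ f p q = 0) ∨ x p q = 0 := by
    intro p q hpq hq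
    rcases hf.mid q hq with ⟨c, a, hm, hc, ha⟩ | ⟨c, a₁, a₂, hm, hc, ha₁, ha₂⟩ |
      ⟨a₁, a₂, c, hm, ha₁, ha₂, hc⟩
    · rw [(hm.1 p).1 hpq]
      exact Or.inl ⟨⟨c, a, hm⟩, hq, (hf.at_mid11 h2 hx hrad ht hm hc ha).2, hc⟩
    · right
      rw [(hm.2.1 p).1 hpq]
      exact (hf.at_mid12 h2 hx hrad ht hm hc ha₁ ha₂).2.1
    · right
      obtain ⟨-, -, h3, h4⟩ := hf.at_mid21 h2 hx hrad ht hm ha₁ ha₂ hc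
      rcases (hm.2.1 p).1 hpq with rfl | rfl
      · exact h3
      · exact h4
  have hnot : ∀ p q, p < q → (p, q) ∉ minMaxRel α → p ∉ extremal α ∨ q ∉ extremal α := by
    intro p q hpq hn
    by_contra hc
    push Not at hc
    exact hn ⟨hpq, hc.1.resolve_right hpq.not_isMax, hc.2.resolve_left hpq.not_isMin⟩
  -- Off the diagonal and off the min–max edges, either the coefficient or the entry vanishes, so
  -- such pairs contribute nothing to the diagonal equations.
  have hprod : ∀ p q, p ≠ q → (p, q) ∉ minMaxRel α → f p q * x p q = 0 := by
    intro p q hne hn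
    by_cases hle : p ≤ q
    · have hpq := lt_of_le_of_ne hle hne
      rcases hnot p q hpq hn with h | h
      · rw [hup p q hpq h, mul_zero]
      · rcases hdown p q hpq h with h' | h'
        · rw [h'.2.2.2, zero_mul]
        · rw [h', mul_zero]
    · rw [hx p q hle, mul_zero]
  let w : Matrix α α k := Matrix.of fun p q => if (p, q) ∈ minMaxRel α then x p q else 0
  have hsplit : ∀ p q, f p q * x p q = w p q + if p = q then f p p * x p p else 0 := by
    intro p q
    by_cases hpq : p = q
    · subst hpq
      simp [w, minMaxRel]
    · by_cases hH : (p, q) ∈ minMaxRel α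
      · simp [w, hH, hpq, hf.minMax p q hH]
      · simp [w, hH, hpq]
        exact mul_eq_zero.1 (hprod p q hpq hH)
  -- The equation at `(v, v)` is conservation of `w` at `v`, and there are no circulations on a
  -- forest.
  have hw : w = 0 := by
    refine hfree w (fun p q h => if_neg h) fun v => ?_
    have h1 := hrad v v le_rfl
    rw [Finset.sum_congr rfl fun r _ => hsplit r v,
      Finset.sum_congr rfl fun r _ => (mul_comm _ _).trans (hsplit v r), Finset.sum_add_distrib,
      Finset.sum_add_distrib] at h1
    simp only [Finset.sum_ite_eq, Finset.sum_ite_eq', Finset.mem_univ, if_true] at h1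
    rw [netFlow]
    linear_combination -h1
  refine ⟨x e₀ e₀, ht, fun m hm h11 => ?_, fun p q hpq => ?_⟩
  · rcases hf.mid m hm with ⟨c, a, h, hc, ha⟩ | ⟨c, a₁, a₂, h, hc, ha₁, ha₂⟩ |
      ⟨a₁, a₂, c, h, ha₁, ha₂, hc⟩
    · exact absurd ⟨c, a, h⟩ h11
    · exact (hf.at_mid12 h2 hx hrad ht h hc ha₁ ha₂).1
    · exact (hf.at_mid21 h2 hx hrad ht h ha₁ ha₂ hc).1
  · by_cases hH : (p, q) ∈ minMaxRel α
    · right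
      simpa [w, hH] using congrFun (congrFun hw p) q
    · rcases hnot p q hpq hH with h | h
      · exact Or.inr (hup p q hpq h)
      · exact hdown p q hpq h

/-- Without middle elements of type `(1, 1)`, the standard one-form is nondegenerate. -/
theorem IsStandard.eq_zero [CharZero k] (hf : IsStandard f) (h2 : HeightLeTwo α)
    (hconn : (SimpleGraph.hasse α).Connected) (hfree : FlowFree k (minMaxRel α))
    (h11 : ∀ m ∉ extremal α, ¬ IsMid11 α m)
    (hx : ∀ i j, ¬ i ≤ j → x i j = 0) (hrad : RadicalEq f x) (htr : x.trace = 0) : x = 0 := by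
  obtain ⟨t, ht1, ht2, ht3⟩ := hf.radical h2 hconn hfree hx hrad
  have hd : ∀ y, x y y = t := fun y => by
    by_cases hy : y ∈ extremal α
    · exact ht1 y hy
    · exact ht2 y hy (h11 y hy)
  have := hconn.nonempty
  have ht : t = 0 := by
    simpa [Matrix.trace, hd] using htr
  ext p q
  by_cases hle : p ≤ q
  · rcases hle.eq_or_lt with rfl | hlt
    · rw [hd, ht, Matrix.zero_apply]
    · exact (ht3 p q hlt).resolve_left fun h => h11 q h.2.1 h.1
  · exact hx p q hle

end Standard

/-! ### Explicit elements of the radical -/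

section Explicit

variable {k α : Type*} [Field k] [PartialOrder α] {f : Matrix α α k}

section

variable [DecidableEq α]

/-- The radical element attached to a middle element of type `(1, 1)`. -/
def mid11Radical (f : Matrix α α k) (m c a : α) : Matrix α α k := Matrix.of fun i j =>
  ((if i = m then 1 else 0) - f m a / f c a * if i = c then 1 else 0) *
    ((if j = m then 1 else 0) - f c m / f c a * if j = a then 1 else 0)

theorem mid11Radical_eq_zero {m c a : α} (hm : Nbhd11 (· < ·) m c a) (i j : α) (hij : ¬ i ≤ j) :
    mid11Radical f m c a i j = 0 := by
  have hcm : c < m := (hm.1 c).2 rfl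
  have hma : m < a := (hm.2 a).2 rfl
  rw [mid11Radical, Matrix.of_apply, mul_eq_zero]
  by_cases hi : i = m
  · right
    subst hi
    rw [if_neg, if_neg]
    · simp
    · rintro rfl; exact hij hma.le
    · rintro rfl; exact hij le_rfl
  · by_cases hi' : i = c
    · right
      subst hi'
      rw [if_neg, if_neg]
      · simp
      · rintro rfl; exact hij (hcm.trans hma).le
      · rintro rfl; exact hij hcm.le
    · left
      simp [hi, hi']

theorem mid11Radical_diag {m c a : α} (hm : Nbhd11 (· < ·) m c a) (i : α) :
    mid11Radical f m c a i i = if i = m then 1 else 0 := by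
  have hcm : c < m := (hm.1 c).2 rfl
  have hma : m < a := (hm.2 a).2 rfl
  rw [mid11Radical, Matrix.of_apply]
  by_cases hi : i = m
  · subst hi
    simp [hcm.ne', hma.ne]
  · by_cases hi' : i = c
    · subst hi'
      simp [hi, (hcm.trans hma).ne]
    · simp [hi, hi']

end

variable [Fintype α]

theorem RadicalEq.add {x y : Matrix α α k} (hx : RadicalEq f x) (hy : RadicalEq f y) :
    RadicalEq f (x + y) := by
  intro p q hpq
  simp only [Matrix.add_apply, mul_add, add_mul, Finset.sum_add_distrib, hx p q hpq, hy p q hpq]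

theorem RadicalEq.smul {x : Matrix α α k} (hx : RadicalEq f x) (t : k) :
    RadicalEq f (t • x) := by
  intro p q hpq
  simp only [Matrix.smul_apply, smul_eq_mul, mul_left_comm _ t, mul_assoc t, ← Finset.mul_sum,
    hx p q hpq]

variable [DecidableEq α]

theorem RadicalEq.one : RadicalEq f 1 := by
  intro p q _
  simp [Matrix.one_apply]

/-- The matrix has rank one, `u vᵀ` with `u` supported on `m, c` and `v` on `m, a`. Both sides of
each equation factor accordingly. The ratios make `u` orthogonal to column `a` of `f` and `v`
orthogonal to row `c`, so only the equation at `(m, m)` has nonzero sides, and there they agree. -/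
theorem radicalEq_mid11Radical {m c a : α} (hm : Nbhd11 (· < ·) m c a) (hc : IsMin c)
    (ha : IsMax a) (hfca : f c a ≠ 0) : RadicalEq f (mid11Radical f m c a) := by
  have hcm : c < m := (hm.1 c).2 rfl
  have hma : m < a := (hm.2 a).2 rfl
  intro p q hpq
  have hl : ∑ r, f r q * mid11Radical f m c a r p = (f m q - f m a / f c a * f c q) *
      ((if p = m then 1 else 0) - f c m / f c a * if p = a then 1 else 0) := by
    simp only [mid11Radical, Matrix.of_apply, ← mul_assoc, ← Finset.sum_mul]
    congr 1
    simp [mul_sub, Finset.sum_sub_distrib]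
    ring
  have hr : ∑ r, mid11Radical f m c a q r * f p r =
      ((if q = m then 1 else 0) - f m a / f c a * if q = c then 1 else 0) *
      (f p m - f c m / f c a * f p a) := by
    simp only [mid11Radical, Matrix.of_apply, mul_assoc, ← Finset.mul_sum]
    congr 1
    simp [sub_mul, Finset.sum_sub_distrib]
  rw [hl, hr]
  by_cases hpa : p = a
  · obtain rfl : q = a := hpa ▸ le_antisymm (hpa ▸ ha (hpa ▸ hpq)) (hpa ▸ hpq)
    rw [if_neg hma.ne', if_neg (hcm.trans hma).ne', div_mul_cancel₀ _ hfca]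
    simp
  · by_cases hqc : q = c
    · obtain rfl : p = c := hqc ▸ le_antisymm (hqc ▸ hpq) (hqc ▸ hc (hqc ▸ hpq))
      rw [if_neg hcm.ne, if_neg (hcm.trans hma).ne, div_mul_cancel₀ _ hfca]
      simp
    · rw [if_neg hpa, if_neg hqc]
      by_cases hpm : p = m
      · subst hpm
        rcases hpq.eq_or_lt with rfl | hlt
        · field_simp
          simp
        · rw [(hm.2 q).1 hlt, div_mul_cancel₀ _ hfca, if_neg hma.ne']
          simp
      · by_cases hqm : q = m
        · subst hqm
          rw [(hm.1 p).1 (lt_of_le_of_ne hpq hpm), div_mul_cancel₀ _ hfca, if_neg hcm.ne]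
          simp
        · rw [if_neg hpm, if_neg hqm]
          simp

theorem trace_mid11Radical {m c a : α} (hm : Nbhd11 (· < ·) m c a) :
    (mid11Radical f m c a).trace = 1 := by
  simp [Matrix.trace, mid11Radical_diag hm]

/-- The standard one-form of a poset with exactly one middle element of type `(1, 1)` is a contact
form. -/
theorem IsStandard.isContactForm [CharZero k] {φ : Module.Dual k (typeALiePosetAlgebra k α)}
    (hφ : ∀ x, φ x = matrixPairing f x.1) (hf : IsStandard f) (h2 : HeightLeTwo α)
    (hconn : (SimpleGraph.hasse α).Connected) (hfree : FlowFree k (minMaxRel α)) {m₀ c a : α}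
    (hm₀ : Nbhd11 (· < ·) m₀ c a) (hc : f c m₀ = 0) (ha : f m₀ a = 1)
    (h11 : ∀ m ∉ extremal α, IsMid11 α m → m = m₀)
    (hdiag : ∀ p, f p p = if p = m₀ then 1 else 0) : IsContactForm k _ φ := by
  have := hconn.nonempty
  have hcm : c < m₀ := (hm₀.1 c).2 rfl
  have hma : m₀ < a := (hm₀.2 a).2 rfl
  have hca := h2.mem_minMaxRel hcm hma
  have hcard : (Fintype.card α : k) ≠ 1 := by
    have : Nontrivial α := ⟨⟨c, m₀, hcm.ne⟩⟩
    exact_mod_cast Fintype.one_lt_card.ne'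
  -- The identity has trace the number `N` of elements and the rank-one element has trace `1`, so
  -- this combination has trace zero. The form takes the value `1` on both, hence `1 - N ≠ 0` on
  -- `z`.
  refine isContactForm_of_matrix hφ (fun x hx htr hrad hpair => ?_)
    (z := 1 + (-(Fintype.card α : k)) • mid11Radical f m₀ c a) (fun i j hij => ?_) ?_
    (RadicalEq.one.add ((radicalEq_mid11Radical hm₀ hca.2.1 hca.2.2
      (by rw [hf.minMax _ _ hca]; exact one_ne_zero)).smul _)) ?_
  · obtain ⟨t, ht1, ht2, ht3⟩ := hf.radical h2 hconn hfree hx hrad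
    have hd : ∀ y, y ≠ m₀ → x y y = t := fun y hy => by
      by_cases hy' : y ∈ extremal α
      · exact ht1 y hy'
      · exact ht2 y hy' fun h => hy (h11 y hy' h)
    -- On the radical the form reads off only the entry at `(m₀, m₀)`. Once that entry is zero,
    -- trace zero says `(N - 1) t = 0`.
    have hpair' : x m₀ m₀ = 0 := by
      rw [matrixPairing, Finset.sum_eq_single m₀, Finset.sum_eq_single m₀, hdiag, if_pos rfl,
        one_mul] at hpair
      · exact hpair
      · intro j _ hj
        by_cases hle : m₀ ≤ j
        · rcases ht3 m₀ j (lt_of_le_of_ne hle hj.symm) with h | h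
          · rw [h.2.2.2, zero_mul]
          · rw [h, mul_zero]
        · rw [hx _ _ hle, mul_zero]
      · simp
      · intro i _ hi
        refine Finset.sum_eq_zero fun j _ => ?_
        by_cases hle : i ≤ j
        · rcases hle.eq_or_lt with rfl | hlt
          · rw [hdiag, if_neg hi, zero_mul]
          · rcases ht3 i j hlt with h | h
            · rw [h.2.2.2, zero_mul]
            · rw [h, mul_zero]
        · rw [hx _ _ hle, mul_zero]
      · simp
    have ht : t = 0 := by
      rw [Matrix.trace, ← Finset.add_sum_erase _ _ (Finset.mem_univ m₀), Matrix.diag_apply, hpair',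
        zero_add, Finset.sum_congr rfl fun y hy => (Matrix.diag_apply x y).trans (hd y (Finset.mem_erase.1 hy).1),
        Finset.sum_const, Finset.card_erase_of_mem (Finset.mem_univ _), nsmul_eq_mul,
        mul_eq_zero, Finset.card_univ, Nat.cast_sub Fintype.card_pos, sub_eq_zero] at htr
      exact htr.resolve_left (by simpa using hcard)
    have hd' : ∀ y, x y y = 0 := fun y => by
      by_cases hy : y = m₀
      · rw [hy, hpair']
      · rw [hd y hy, ht]
    ext p q
    by_cases hle : p ≤ q
    · rcases hle.eq_or_lt with rfl | hlt
      · rw [hd', Matrix.zero_apply]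
      · rcases ht3 p q hlt with h | h
        · rw [h.2.2.1, ht, hd', sub_zero, Matrix.zero_apply]
        · exact h
    · exact hx p q hle
  · rw [Matrix.add_apply, Matrix.smul_apply, mid11Radical_eq_zero hm₀ i j hij, smul_zero, add_zero,
      Matrix.one_apply_ne]
    rintro rfl
    exact hij le_rfl
  · simp [Matrix.trace_add, trace_mid11Radical hm₀]
  · have h1 : matrixPairing f (mid11Radical f m₀ c a) = 1 := by
      have hle : ∀ i j, f i j * mid11Radical f m₀ c a i j = (if i = m₀ then
          (if j = m₀ then 1 else 0) else 0) - if i = c then (if j = m₀ then f c m₀ else 0)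
          else 0 := by
        intro i j
        simp only [mid11Radical, Matrix.of_apply, hc, ha, hf.minMax _ _ hca]
        by_cases hj : j = m₀ <;> by_cases hi : i = m₀ <;> by_cases hi' : i = c <;>
          simp_all
      rw [matrixPairing, Finset.sum_congr rfl fun i _ => Finset.sum_congr rfl fun j _ => hle i j]
      simp [Finset.sum_ite_irrel, hc]
    have h2 : matrixPairing f 1 = 1 := by
      simp [matrixPairing, Matrix.one_apply, hdiag]
    rw [matrixPairing_eq_trace, mul_add, Matrix.trace_add, ← matrixPairing_eq_trace, h2,
      Matrix.mul_smul, Matrix.trace_smul, ← matrixPairing_eq_trace, h1]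
    intro h
    apply hcard
    simp only [smul_eq_mul, mul_one] at h
    linear_combination -h

end Explicit

/-! ### Necessary conditions -/

section Necessary

/-- Three unknowns and two linear conditions. This excludes both a third neighbour on one side of a
middle element and a second (1,1) element. -/
theorem exists_ne_zero_sum_mul_eq_zero {k : Type*} [Field k] (u v : Fin 3 → k) :
    ∃ t : Fin 3 → k, t ≠ 0 ∧ ∑ i, t i * u i = 0 ∧ ∑ i, t i * v i = 0 := by
  let F : (Fin 3 → k) →ₗ[k] k × k :=
    (Fintype.linearCombination k u).prod (Fintype.linearCombination k v)
  have hF : F.ker ≠ ⊥ := LinearMap.ker_ne_bot_of_finrank_lt (by simp)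
  obtain ⟨t, ht, ht0⟩ := Submodule.exists_mem_ne_zero_of_ne_bot hF
  have h := LinearMap.mem_ker.1 ht
  simp only [F, LinearMap.prod_apply, Function.prod_apply, Fintype.linearCombination_apply,
    smul_eq_mul, Prod.mk_eq_zero] at h
  exact ⟨t, ht0, h⟩

variable {k α : Type*} [Field k] [Fintype α] [PartialOrder α]

/-- The one-form with coefficients `f` has no zero on the nonzero elements of its radical. -/
def NoKernelInRadical (f : Matrix α α k) : Prop :=
  ∀ x : Matrix α α k, (∀ i j, ¬ i ≤ j → x i j = 0) → x.trace = 0 → RadicalEq f x →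
    matrixPairing f x = 0 → x = 0

/-- Transposition passes to the opposite poset, so three lower neighbours are excluded together with
three upper ones. -/
theorem NoKernelInRadical.dual {f : Matrix α α k} (h : NoKernelInRadical f) :
    NoKernelInRadical (α := αᵒᵈ)
      (Matrix.of fun i j => f (OrderDual.ofDual j) (OrderDual.ofDual i)) := by
  intro x hx htr hrad hpair
  have h0 := h (Matrix.of fun i j => x (OrderDual.toDual j) (OrderDual.toDual i))
    (fun i j hij => hx _ _ hij) htr
    (fun p q hpq => (Finset.sum_congr rfl fun r _ => mul_comm _ _).trans
      ((hrad (OrderDual.toDual q) (OrderDual.toDual p) hpq).symm.trans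
        (Finset.sum_congr rfl fun r _ => mul_comm _ _)))
    (Finset.sum_comm.trans hpair)
  ext i j
  exact congrFun (congrFun h0 (OrderDual.ofDual j)) (OrderDual.ofDual i)

/-- As `p` is minimal and `q` maximal, the only coefficient entering the radical equations of the
matrix unit at `(p, q)` is `f p q`, which is also its value under the form. -/
theorem NoKernelInRadical.ne_zero {f : Matrix α α k} (h : NoKernelInRadical f) {p q : α}
    (hpq : (p, q) ∈ minMaxRel α) : f p q ≠ 0 := by
  classical
  intro h0
  have hs := h (Matrix.single p q 1) (fun i j hij => ?_) (Matrix.trace_single_eq_of_ne p q 1 hpq.1.ne)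
    (fun i j hij => ?_) ?_
  · simpa using congrFun (congrFun hs p) q
  · rw [Matrix.single_apply, if_neg]
    rintro ⟨rfl, rfl⟩
    exact hij hpq.1.le
  · rw [Finset.sum_eq_zero, Finset.sum_eq_zero]
    · intro r _
      rw [Matrix.single_apply]
      split_ifs with hr
      · obtain ⟨rfl, rfl⟩ := hr
        rw [le_antisymm hij (hpq.2.1 hij), h0, mul_zero]
      · rw [zero_mul]
    · intro r _
      rw [Matrix.single_apply]
      split_ifs with hr
      · obtain ⟨rfl, rfl⟩ := hr
        rw [le_antisymm (hpq.2.2 hij) hij, h0, zero_mul]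
      · rw [mul_zero]
  · simp [matrixPairing, Matrix.single_apply, ite_and, h0]

/-- Divide a circulation entrywise by `f`. The diagonal radical equations become conservation, the
other equations have both sides zero, and the form becomes the total flow. -/
theorem NoKernelInRadical.flowFree {f : Matrix α α k} (h : NoKernelInRadical f) :
    FlowFree k (minMaxRel α) := by
  intro w hw hflow
  have hfw : ∀ p q, f p q * (w p q / f p q) = w p q := by
    intro p q
    by_cases hpq : (p, q) ∈ minMaxRel α
    · exact mul_div_cancel₀ _ (h.ne_zero hpq)
    · rw [hw p q hpq, zero_div, mul_zero]
  have hx0 : ∀ p q, (p, q) ∉ minMaxRel α → w p q / f p q = 0 := fun p q hpq => by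
    rw [hw p q hpq, zero_div]
  have hs := h (Matrix.of fun p q => w p q / f p q) (fun i j hij => hx0 i j fun h => hij h.1.le)
    (Finset.sum_eq_zero fun i _ => hx0 i i fun h => h.1.ne rfl) (fun p q hpq => ?_) ?_
  · ext p q
    have := congrFun (congrFun hs p) q
    rw [Matrix.of_apply, Matrix.zero_apply] at this
    rw [← hfw, this, mul_zero, Matrix.zero_apply]
  · simp only [Matrix.of_apply]
    rcases hpq.eq_or_lt with rfl | hlt
    · simp only [hfw, mul_comm _ (f p _)]
      exact (sub_eq_zero.1 (hflow p)).symm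
    · rw [Finset.sum_eq_zero, Finset.sum_eq_zero]
      · intro r _
        rw [hx0 q r fun h => hlt.not_isMin h.2.1, zero_mul]
      · intro r _
        rw [hx0 r p fun h => hlt.not_isMax h.2.2, mul_zero]
  · simp only [matrixPairing, Matrix.of_apply, hfw]
    -- The total flow is zero: only minimal elements emit flow, and they receive none, so
    -- conservation makes their output zero.
    refine Finset.sum_eq_zero fun i _ => ?_
    by_cases hi : IsMin i
    · have := sub_eq_zero.1 (hflow i)
      rw [this]
      exact Finset.sum_eq_zero fun r _ => hw r i fun h => h.1.not_isMin hi
    · exact Finset.sum_eq_zero fun r _ => hw i r fun h => hi h.2.1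

theorem FlowFree.not_square (h : FlowFree k (minMaxRel α)) {p₁ p₂ q₁ q₂ : α} (hp : p₁ ≠ p₂)
    (hq : q₁ ≠ q₂) (h₁₁ : (p₁, q₁) ∈ minMaxRel α) (h₁₂ : (p₁, q₂) ∈ minMaxRel α)
    (h₂₁ : (p₂, q₁) ∈ minMaxRel α) (h₂₂ : (p₂, q₂) ∈ minMaxRel α) : False := by
  classical
  have h0 := h (Matrix.single p₁ q₁ 1 + Matrix.single p₂ q₂ 1 -
    (Matrix.single p₁ q₂ 1 + Matrix.single p₂ q₁ 1)) (fun x y hxy => ?_) (fun v => ?_)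
  · have := congrFun (congrFun h0 p₁) q₁
    simp [hp.symm, hq.symm] at this
  · have key : ∀ p q, (p, q) ∈ minMaxRel α → Matrix.single p q (1 : k) x y = 0 := by
      intro p q hpq
      rw [Matrix.single_apply, if_neg]
      rintro ⟨rfl, rfl⟩
      exact hxy hpq
    simp [key _ _ h₁₁, key _ _ h₁₂, key _ _ h₂₁, key _ _ h₂₂]
  · simp only [netFlow_sub, netFlow_add, netFlow_single]
    ring

/-- Choose `v ≠ 0` on the three upper elements, orthogonal to the rows `c` and `m` of `f`. Put `v`
into row `m` and correct row `c` so that every column has pairing zero with `f`. The result is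
strictly triangular, in the radical and in the kernel. -/
theorem NoKernelInRadical.not_three_above {f : Matrix α α k} (h : NoKernelInRadical f)
    (h2 : HeightLeTwo α) {m c : α} (hm : ∀ y, y < m ↔ y = c) {q : Fin 3 → α}
    (hq : Function.Injective q) (hmq : ∀ i, m < q i) : False := by
  classical
  have hcm : c < m := (hm c).2 rfl
  obtain ⟨t, ht, htc, htm⟩ := exists_ne_zero_sum_mul_eq_zero (fun i => f c (q i))
    (fun i => f m (q i))
  let v : α → k := fun r => ∑ i, if r = q i then t i else 0
  have hv0 : ∀ r, ¬ m < r → v r = 0 := fun r hr => Finset.sum_eq_zero fun i _ =>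
    if_neg fun (h : r = q i) => hr (h ▸ hmq i)
  have hvsum : ∀ g : α → k, ∑ r, v r * g r = ∑ i, t i * g (q i) := by
    intro g
    simp only [v, Finset.sum_mul]
    rw [Finset.sum_comm]
    simp
  have hvc : ∑ r, v r * f c r = 0 := (hvsum _).trans htc
  have hvm : ∑ r, v r * f m r = 0 := (hvsum _).trans htm
  have hvq : ∀ i, v (q i) = t i := by
    intro i
    simp [v, hq.eq_iff]
  have hs : ∀ r, f c r * (f m r * v r / f c r) = f m r * v r := by
    intro r
    by_cases hr : m < r
    · exact mul_div_cancel₀ _ (h.ne_zero (h2.mem_minMaxRel hcm hr))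
    · rw [hv0 r hr]
      simp
  have h0 := h (Matrix.of fun i j => (if i = m then v j else 0) -
    if i = c then f m j * v j / f c j else 0) (fun i j hij => ?_) ?_ (fun p r hpr => ?_) ?_
  · refine ht (funext fun i => ?_)
    have := congrFun (congrFun h0 m) (q i)
    simpa [hcm.ne', hvq] using this
  · rw [Matrix.of_apply]
    by_cases hmj : m < j
    · rw [if_neg, if_neg, sub_zero]
      · rintro rfl
        exact hij (hcm.trans hmj).le
      · rintro rfl
        exact hij hmj.le
    · simp [hv0 j hmj]
  · refine Finset.sum_eq_zero fun i _ => ?_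
    rw [Matrix.diag_apply, Matrix.of_apply]
    by_cases hmi : m < i
    · rw [if_neg hmi.ne', if_neg (hcm.trans hmi).ne', sub_zero]
    · simp [hv0 i hmi]
  · have hl : ∑ i, f i r * (Matrix.of fun i j => (if i = m then v j else 0) -
        if i = c then f m j * v j / f c j else 0) i p =
        f m r * v p - f c r * (f m p * v p / f c p) := by
      simp [mul_sub, Finset.sum_sub_distrib]
    have hr : ∑ j, (Matrix.of fun i j => (if i = m then v j else 0) -
        if i = c then f m j * v j / f c j else 0) r j * f p j =
        (if r = m then ∑ j, v j * f p j else 0) -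
          if r = c then ∑ j, f m j * v j / f c j * f p j else 0 := by
      simp [sub_mul, Finset.sum_sub_distrib, Finset.sum_ite_irrel]
    rw [hl, hr]
    have hl0 : f m r * v p - f c r * (f m p * v p / f c p) = 0 := by
      by_cases hmp : m < p
      · obtain rfl : p = r := le_antisymm hpr (h2.isMax hmp hcm.not_isMin hpr)
        rw [hs, sub_self]
      · simp [hv0 p hmp]
    rw [hl0]
    by_cases hrm : r = m
    · subst hrm
      rw [if_pos rfl, if_neg hcm.ne', sub_zero]
      rcases hpr.eq_or_lt with rfl | hlt
      · exact hvm.symm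
      · rw [(hm p).1 hlt, hvc]
    · by_cases hrc : r = c
      · subst hrc
        obtain ⟨q₀, hq₀⟩ : ∃ q₀, m < q₀ := ⟨q 0, hmq 0⟩
        obtain rfl : p = r := le_antisymm hpr ((h2.mem_minMaxRel hcm hq₀).2.1 hpr)
        rw [if_neg hrm, if_pos rfl, zero_sub, zero_eq_neg, ← hvm]
        exact Finset.sum_congr rfl fun j _ => by rw [mul_comm, hs, mul_comm]
      · rw [if_neg hrm, if_neg hrc, sub_zero]
  · rw [matrixPairing, Finset.sum_comm]
    refine Finset.sum_eq_zero fun j _ => ?_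
    have : ∑ i, f i j * (Matrix.of fun i j => (if i = m then v j else 0) -
        if i = c then f m j * v j / f c j else 0) i j =
        f m j * v j - f c j * (f m j * v j / f c j) := by
      simp [mul_sub, Finset.sum_sub_distrib]
    rw [this, hs, sub_self]

omit [Fintype α] in
theorem HeightLeTwo.dual (h2 : HeightLeTwo α) : HeightLeTwo αᵒᵈ :=
  fun a b c d hab hbc hcd => h2 d c b a hcd hbc hab

theorem exists_three_of_not_pair {β : Type*} {S : β → Prop} {a : β} (ha : S a)
    (h1 : ¬ ∀ y, S y ↔ y = a) (h2 : ∀ b, b ≠ a → ¬ ∀ y, S y ↔ y = a ∨ y = b) :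
    ∃ q : Fin 3 → β, Function.Injective q ∧ ∀ i, S (q i) := by
  obtain ⟨b, hb, hba⟩ : ∃ b, S b ∧ b ≠ a := by
    by_contra hc
    push Not at hc
    exact h1 fun y => ⟨hc y, fun h => h ▸ ha⟩
  obtain ⟨d, hd, hda, hdb⟩ : ∃ d, S d ∧ d ≠ a ∧ d ≠ b := by
    by_contra hc
    push Not at hc
    refine h2 b hba fun y => ⟨fun hy => ?_, ?_⟩
    · by_cases hya : y = a
      · exact Or.inl hya
      · exact Or.inr (hc y hy hya)
    · rintro (rfl | rfl)
      · exact ha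
      · exact hb
  refine ⟨![a, b, d], ?_, ?_⟩
  · intro i j hij
    fin_cases i <;> fin_cases j <;> simp_all
  · intro i
    fin_cases i
    · exact ha
    · exact hb
    · exact hd

/-- Two lower and two upper neighbours would span a 4-cycle of min–max edges. So one side has a
single element, and the other then has at most two. -/
theorem NoKernelInRadical.mid_type {f : Matrix α α k} (h : NoKernelInRadical f)
    (h2 : HeightLeTwo α) {m : α} (hm : m ∉ extremal α) :
    IsMid11 α m ∨ (∃ c a₁ a₂, Nbhd12 (α := α) (· < ·) m c a₁ a₂) ∨
      ∃ a₁ a₂ c, Nbhd21 (α := α) (· < ·) m a₁ a₂ c := by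
  obtain ⟨⟨c, hc⟩, a, ha⟩ := not_mem_extremal_iff.1 hm
  by_cases hD : ∀ y, y < m ↔ y = c
  · by_cases hU : ∀ y, m < y ↔ y = a
    · exact Or.inl ⟨c, a, hD, hU⟩
    · by_contra hcon
      push Not at hcon
      obtain ⟨q, hq, hmq⟩ := exists_three_of_not_pair (S := fun y => m < y) ha hU
        fun b hb hU' => hcon.2.1 c a b ⟨hb.symm, hD, hU'⟩
      exact h.not_three_above h2 hD hq hmq
  · have hU : ∀ y, m < y ↔ y = a := by
      obtain ⟨c', hc', hcc⟩ : ∃ c', c' < m ∧ c' ≠ c := by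
        by_contra hcon
        push Not at hcon
        exact hD fun y => ⟨hcon y, fun h => h ▸ hc⟩
      refine fun y => ⟨fun hy => ?_, fun h => h ▸ ha⟩
      by_contra hya
      exact h.flowFree.not_square hcc hya (h2.mem_minMaxRel hc' hy) (h2.mem_minMaxRel hc' ha)
        (h2.mem_minMaxRel hc hy) (h2.mem_minMaxRel hc ha)
    by_contra hcon
    push Not at hcon
    obtain ⟨q, hq, hmq⟩ := exists_three_of_not_pair (S := fun y => y < m) hc hD
      fun b hb hD' => hcon.2.2 c b a ⟨hb.symm, hD', hU⟩
    exact h.dual.not_three_above (α := αᵒᵈ) h2.dual (m := m) (c := a) hU hq hmq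

/-- Some nontrivial combination of the identity and the two rank-one radical elements has trace zero
and form zero, hence vanishes. Its diagonal entries at `c`, `m` and `m'` then make all three
coefficients zero. -/
theorem NoKernelInRadical.mid11_unique {f : Matrix α α k}
    (h : NoKernelInRadical f) (h2 : HeightLeTwo α) {m m' : α} (hm : IsMid11 α m)
    (hm' : IsMid11 α m') : m = m' := by
  classical
  by_contra hne
  obtain ⟨c, a, hn⟩ := hm
  obtain ⟨c', a', hn'⟩ := hm'
  have hcm : c < m := (hn.1 c).2 rfl
  have hcm' : c' < m' := (hn'.1 c').2 rfl
  have hca := h2.mem_minMaxRel hcm ((hn.2 a).2 rfl)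
  have hca' := h2.mem_minMaxRel hcm' ((hn'.2 a').2 rfl)
  have hcm'' : c ≠ m' := fun h => (h ▸ hcm').not_isMin hca.2.1
  obtain ⟨t, ht, ht1, ht2⟩ := exists_ne_zero_sum_mul_eq_zero
    ![(1 : Matrix α α k).trace, (mid11Radical f m c a).trace, (mid11Radical f m' c' a').trace]
    ![matrixPairing f 1, matrixPairing f (mid11Radical f m c a),
      matrixPairing f (mid11Radical f m' c' a')]
  simp only [Fin.sum_univ_three, Matrix.cons_val_zero, Matrix.cons_val_one, Matrix.cons_val] at ht1 ht2
  have h0 := h (t 0 • 1 + t 1 • mid11Radical f m c a + t 2 • mid11Radical f m' c' a')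
    (fun i j hij => ?_) ?_
    (((RadicalEq.one.smul _).add ((radicalEq_mid11Radical hn hca.2.1 hca.2.2 (h.ne_zero hca)).smul
      _)).add ((radicalEq_mid11Radical hn' hca'.2.1 hca'.2.2 (h.ne_zero hca')).smul _)) ?_
  · have hd : ∀ i, t 0 + t 1 * (if i = m then 1 else 0) + t 2 * (if i = m' then 1 else 0) = 0 := by
      intro i
      simpa [mid11Radical_diag hn, mid11Radical_diag hn'] using congrFun (congrFun h0 i) i
    have h00 : t 0 = 0 := by simpa [hcm.ne, hcm''] using hd c
    have h01 : t 1 = 0 := by simpa [h00, hne] using hd m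
    have h02 : t 2 = 0 := by simpa [h00, Ne.symm hne] using hd m'
    refine ht (funext fun i => ?_)
    fin_cases i
    · exact h00
    · exact h01
    · exact h02
  · have hij' : i ≠ j := fun h => hij h.le
    simp [mid11Radical_eq_zero hn i j hij, mid11Radical_eq_zero hn' i j hij, hij']
  · simpa only [Matrix.trace_add, Matrix.trace_smul, smul_eq_mul] using ht1
  · simpa only [matrixPairing_eq_trace, mul_add, Matrix.mul_smul, Matrix.trace_add,
      Matrix.trace_smul, smul_eq_mul] using ht2

omit [Fintype α] in
-- One of the paired neighbours of each middle element is marked; the coefficients are `1` on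
-- min–max edges and between a middle element and its mark. The form serves to show that without
-- (1,1) elements the dimension is even.
theorem exists_isStandard (h2 : HeightLeTwo α)
    (hmid : ∀ m ∉ extremal α, (∃ c a₁ a₂, Nbhd12 (α := α) (· < ·) m c a₁ a₂) ∨
      ∃ a₁ a₂ c, Nbhd21 (α := α) (· < ·) m a₁ a₂ c) : ∃ f : Matrix α α k, IsStandard f := by
  classical
  have hmark : ∀ m, ∃ b, m ∉ extremal α → (∃ c a₁, Nbhd12 (α := α) (· < ·) m c a₁ b) ∨
      ∃ a₁ c, Nbhd21 (α := α) (· < ·) m a₁ b c := by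
    intro m
    by_cases hm : m ∈ extremal α
    · exact ⟨m, fun h => absurd hm h⟩
    · rcases hmid m hm with ⟨c, a₁, a₂, h⟩ | ⟨a₁, a₂, c, h⟩
      · exact ⟨a₂, fun _ => Or.inl ⟨c, a₁, h⟩⟩
      · exact ⟨a₂, fun _ => Or.inr ⟨a₁, c, h⟩⟩
  choose mark hmark using hmark
  refine ⟨Matrix.of fun i j => if (i, j) ∈ minMaxRel α ∨ (i ∉ extremal α ∧ j = mark i) ∨
    (j ∉ extremal α ∧ i = mark j) then 1 else 0, fun p q h => if_pos (Or.inl h),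
    fun m hm => Or.inr ?_⟩
  obtain ⟨⟨p, hp⟩, q, hq⟩ := not_mem_extremal_iff.1 hm
  have hlo : ∀ x, x < m → x ≠ mark m →
      ¬ ((x, m) ∈ minMaxRel α ∨ (x ∉ extremal α ∧ m = mark x) ∨
        (m ∉ extremal α ∧ x = mark m)) := by
    rintro x hx hne (h | h | h)
    · exact hm (Or.inr h.2.2)
    · exact h.1 (Or.inl (h2.isMin hx hq.not_isMax))
    · exact hne h.2
  have hup : ∀ x, m < x → x ≠ mark m →
      ¬ ((m, x) ∈ minMaxRel α ∨ (m ∉ extremal α ∧ x = mark m) ∨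
        (x ∉ extremal α ∧ m = mark x)) := by
    rintro x hx hne (h | h | h)
    · exact hm (Or.inl h.2.1)
    · exact hne h.2
    · exact h.1 (Or.inr (h2.isMax hx hp.not_isMin))
  rcases hmark m hm with ⟨c, a₁, h⟩ | ⟨a₁, c, h⟩
  · have hc := (h.2.1 c).2 rfl
    have ha₁ := (h.2.2 a₁).2 (Or.inl rfl)
    have ha₂ := (h.2.2 (mark m)).2 (Or.inr rfl)
    exact Or.inl ⟨c, a₁, mark m, h, if_neg (hlo c hc (hc.trans ha₂).ne), if_neg (hup a₁ ha₁ h.1),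
      if_pos (Or.inr (Or.inl ⟨hm, rfl⟩))⟩
  · have hc := (h.2.2 c).2 rfl
    have ha₁ := (h.2.1 a₁).2 (Or.inl rfl)
    have ha₂ := (h.2.1 (mark m)).2 (Or.inr rfl)
    exact Or.inr ⟨a₁, mark m, c, h, if_neg (hlo a₁ ha₁ h.1),
      if_pos (Or.inr (Or.inr ⟨hm, rfl⟩)), if_neg (hup c hc (ha₂.trans hc).ne')⟩

variable (k α) in
/-- The combinatorial characterisation of the posets of height two with contact algebra. -/
structure IsContactPoset : Prop where
  flowFree : FlowFree k (minMaxRel α)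
  mid : ∀ m ∉ extremal α, IsMid11 α m ∨ (∃ c a₁ a₂, Nbhd12 (α := α) (· < ·) m c a₁ a₂) ∨
    ∃ a₁ a₂ c, Nbhd21 (α := α) (· < ·) m a₁ a₂ c
  exists_mid11 : ∃ m, IsMid11 α m
  mid11_unique : ∀ m m', IsMid11 α m → IsMid11 α m' → m = m'

theorem IsContactLieAlgebra.isContactPoset [CharZero k] [DecidableEq α]
    (h : IsContactLieAlgebra k (typeALiePosetAlgebra k α)) (h2 : HeightLeTwo α)
    (hconn : (SimpleGraph.hasse α).Connected) : IsContactPoset k α := by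
  obtain ⟨φ, hφ⟩ := h
  obtain ⟨f, hf⟩ := exists_matrixPairing φ
  have hk : NoKernelInRadical f := fun x hx htr hrad hpair =>
    hφ.matrix_eq_zero hf hx htr hrad hpair
  refine ⟨hk.flowFree, fun m hm => hk.mid_type h2 hm, ?_, fun m m' => hk.mid11_unique h2⟩
  -- Otherwise a standard form would have derivative with trivial radical, which is impossible in
  -- odd dimension.
  by_contra hno
  push Not at hno
  obtain ⟨g, hg⟩ := exists_isStandard (k := k) h2 fun m hm =>
    (hk.mid_type h2 hm).resolve_left (hno m)
  obtain ⟨n, hdim, -⟩ := hφ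
  have := hconn.nonempty
  obtain ⟨x, hx0, hx, htr, hrad⟩ := exists_radicalEq_of_finrank_odd hdim g
  exact hx0 (hg.eq_zero h2 hconn hk.flowFree (fun m _ => hno m) hx hrad htr)

end Necessary

/-! ### Gluing -/

namespace SubPoset

variable {α : Type*}

/-- The minimal and the maximal elements. -/
def extremes (P : SubPoset α) : Set α := {x | P.IsMinimal x ∨ P.IsMaximal x}

/-- The relations between minimal and maximal elements. -/
def minMax (P : SubPoset α) : Set (α × α) :=
  {e | P.lt e.1 e.2 ∧ P.IsMinimal e.1 ∧ P.IsMaximal e.2}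

theorem extremes_subset (P : SubPoset α) : P.extremes ⊆ P.carrier := by
  rintro x (h | h) <;> exact h.1

end SubPoset

namespace IsGluing

variable {α : Type*} {Q S P : SubPoset α}

theorem symm (h : IsGluing Q S P) : IsGluing S Q P where
  carrier_eq := by rw [h.carrier_eq, Set.union_comm]
  lt_iff x y := by rw [h.lt_iff, or_comm]
  common x hS hQ := (h.common x hQ hS).imp And.symm And.symm

/-- A common element is minimal in both posets or maximal in both, so the union takes away no
extremality. -/
theorem mem_extremes_iff (h : IsGluing Q S P) {x : α} (hx : x ∈ Q.carrier) :
    x ∈ P.extremes ↔ x ∈ Q.extremes := by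
  have hxP : x ∈ P.carrier := h.carrier_eq ▸ Or.inl hx
  refine ⟨?_, fun hQ => ?_⟩
  · rintro (hP | hP)
    · exact Or.inl ⟨hx, fun y hy => hP.2 y ((h.lt_iff _ _).2 (Or.inl hy))⟩
    · exact Or.inr ⟨hx, fun y hy => hP.2 y ((h.lt_iff _ _).2 (Or.inl hy))⟩
  · by_cases hxS : x ∈ S.carrier
    · rcases h.common x hx hxS with ⟨h1, h2⟩ | ⟨h1, h2⟩
      · exact Or.inl ⟨hxP, fun y hy => ((h.lt_iff _ _).1 hy).elim (h1.2 y) (h2.2 y)⟩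
      · exact Or.inr ⟨hxP, fun y hy => ((h.lt_iff _ _).1 hy).elim (h1.2 y) (h2.2 y)⟩
    · rcases hQ with hQ | hQ
      · exact Or.inl ⟨hxP, fun y hy => ((h.lt_iff _ _).1 hy).elim (hQ.2 y)
          fun h' => hxS (S.right_mem _ _ h')⟩
      · exact Or.inr ⟨hxP, fun y hy => ((h.lt_iff _ _).1 hy).elim (hQ.2 y)
          fun h' => hxS (S.left_mem _ _ h')⟩

theorem extremes_eq (h : IsGluing Q S P) : P.extremes = Q.extremes ∪ S.extremes := by
  ext x
  constructor
  · intro hx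
    have := P.extremes_subset hx
    rw [h.carrier_eq] at this
    exact this.imp (fun h' => (h.mem_extremes_iff h').1 hx) fun h' => (h.symm.mem_extremes_iff h').1 hx
  · rintro (hx | hx)
    · exact (h.mem_extremes_iff (Q.extremes_subset hx)).2 hx
    · exact (h.symm.mem_extremes_iff (S.extremes_subset hx)).2 hx

/-- An end of an edge cannot be shared in its opposite role: the lower end has an element above it
and is not maximal, and dually. -/
theorem mem_minMax_of_mem (h : IsGluing Q S P) {x y : α} (hxy : (x, y) ∈ Q.minMax) :
    (x, y) ∈ P.minMax := by
  obtain ⟨hlt, hx, hy⟩ := hxy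
  refine ⟨(h.lt_iff _ _).2 (Or.inl hlt), ⟨h.carrier_eq ▸ Or.inl hx.1, fun z hz => ?_⟩,
    ⟨h.carrier_eq ▸ Or.inl hy.1, fun z hz => ?_⟩⟩
  · refine ((h.lt_iff _ _).1 hz).elim (hx.2 z) fun hz' => ?_
    rcases h.common x hx.1 (S.right_mem _ _ hz') with h' | h'
    · exact h'.2.2 z hz'
    · exact h'.1.2 y hlt
  · refine ((h.lt_iff _ _).1 hz).elim (hy.2 z) fun hz' => ?_
    rcases h.common y hy.1 (S.left_mem _ _ hz') with h' | h'
    · exact h'.1.2 x hlt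
    · exact h'.2.2 z hz'

theorem mem_minMax_of_lt (h : IsGluing Q S P) {x y : α} (hxy : (x, y) ∈ P.minMax)
    (hlt : Q.lt x y) : (x, y) ∈ Q.minMax :=
  ⟨hlt, ⟨Q.left_mem _ _ hlt, fun z hz => hxy.2.1.2 z ((h.lt_iff _ _).2 (Or.inl hz))⟩,
    ⟨Q.right_mem _ _ hlt, fun z hz => hxy.2.2.2 z ((h.lt_iff _ _).2 (Or.inl hz))⟩⟩

theorem minMax_eq (h : IsGluing Q S P) : P.minMax = Q.minMax ∪ S.minMax := by
  ext ⟨x, y⟩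
  constructor
  · intro hxy
    exact ((h.lt_iff _ _).1 hxy.1).imp (h.mem_minMax_of_lt hxy) (h.symm.mem_minMax_of_lt hxy)
  · rintro (hxy | hxy)
    · exact h.mem_minMax_of_mem hxy
    · exact h.symm.mem_minMax_of_mem hxy

/-- The rules demand only comparability. The direction is forced, since `x` is minimal in the glued
poset. -/
theorem lt_of_related (h : IsGluing Q S P) {x y : α} (hxy : (x, y) ∈ S.minMax)
    (hrel : Q.Related x y ∨ Q.Related y x) : Q.lt x y := by
  have hP := h.symm.mem_minMax_of_mem hxy
  have hne : x ≠ y := fun h => S.irrefl x (by simpa [h] using hxy.1)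
  have hyx : ¬ Q.lt y x := fun h' => hP.2.1.2 y ((h.lt_iff _ _).2 (Or.inl h'))
  rcases hrel with (h' | h' | h') | (h' | h' | h')
  · exact absurd h' hne
  · exact h'
  · exact absurd h' hyx
  · exact absurd h'.symm hne
  · exact absurd h' hyx
  · exact h'

/-- An element of `Q` that is not extremal is not touched by the gluing. -/
theorem notMem_of_notMem_extremes (h : IsGluing Q S P) {m : α} (hm : m ∈ Q.carrier)
    (hext : m ∉ Q.extremes) : m ∉ S.carrier := fun hS =>
  hext ((h.common m hm hS).imp And.left And.left)

theorem lt_iff_left (h : IsGluing Q S P) {m : α} (hm : m ∉ S.carrier) (x : α) :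
    P.lt x m ↔ Q.lt x m :=
  (h.lt_iff x m).trans (or_iff_left fun h' => hm (S.right_mem _ _ h'))

theorem lt_iff_right (h : IsGluing Q S P) {m : α} (hm : m ∉ S.carrier) (y : α) :
    P.lt m y ↔ Q.lt m y :=
  (h.lt_iff m y).trans (or_iff_left fun h' => hm (S.left_mem _ _ h'))

end IsGluing

/-! ### Blocks -/

namespace Block

variable {α : Type*}

theorem isMinimal_P11 {c a : α} (h) {x : α} :
    (P11 c a h).poset.IsMinimal x ↔ x = c := by
  constructor
  · rintro ⟨hx, hx'⟩
    simp only [poset, elems, Set.mem_ofPred_eq, List.mem_cons, List.not_mem_nil, or_false] at hx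
    have := hx' c
    simp only [poset, rels, List.mem_cons, Prod.mk.injEq, List.not_mem_nil, or_false] at this
    clear hx'
    grind
  · intro hx
    simp only [List.nodup_cons, List.mem_cons, List.not_mem_nil] at h
    refine ⟨?_, fun y hy => ?_⟩
    · simp only [poset, elems, Set.mem_ofPred_eq, List.mem_cons, List.not_mem_nil, or_false]
      tauto
    · simp only [poset, rels, List.mem_cons, Prod.mk.injEq, List.not_mem_nil, or_false] at hy
      grind

theorem isMaximal_P11 {c a : α} (h) {x : α} :
    (P11 c a h).poset.IsMaximal x ↔ x = a := by
  constructor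
  · rintro ⟨hx, hx'⟩
    simp only [poset, elems, Set.mem_ofPred_eq, List.mem_cons, List.not_mem_nil, or_false] at hx
    have := hx' a
    simp only [poset, rels, List.mem_cons, Prod.mk.injEq, List.not_mem_nil, or_false] at this
    clear hx'
    grind
  · intro hx
    simp only [List.nodup_cons, List.mem_cons, List.not_mem_nil] at h
    refine ⟨?_, fun y hy => ?_⟩
    · simp only [poset, elems, Set.mem_ofPred_eq, List.mem_cons, List.not_mem_nil, or_false]
      tauto
    · simp only [poset, rels, List.mem_cons, Prod.mk.injEq, List.not_mem_nil, or_false] at hy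
      grind

theorem isMinimal_P111 {c m a : α} (h) {x : α} :
    (P111 c m a h).poset.IsMinimal x ↔ x = c := by
  constructor
  · rintro ⟨hx, hx'⟩
    simp only [poset, elems, Set.mem_ofPred_eq, List.mem_cons, List.not_mem_nil, or_false] at hx
    have := hx' c
    simp only [poset, rels, List.mem_cons, Prod.mk.injEq, List.not_mem_nil, or_false] at this
    clear hx'
    grind
  · intro hx
    simp only [List.nodup_cons, List.mem_cons, List.not_mem_nil] at h
    refine ⟨?_, fun y hy => ?_⟩
    · simp only [poset, elems, Set.mem_ofPred_eq, List.mem_cons, List.not_mem_nil, or_false]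
      tauto
    · simp only [poset, rels, List.mem_cons, Prod.mk.injEq, List.not_mem_nil, or_false] at hy
      grind

theorem isMaximal_P111 {c m a : α} (h) {x : α} :
    (P111 c m a h).poset.IsMaximal x ↔ x = a := by
  constructor
  · rintro ⟨hx, hx'⟩
    simp only [poset, elems, Set.mem_ofPred_eq, List.mem_cons, List.not_mem_nil, or_false] at hx
    have := hx' a
    simp only [poset, rels, List.mem_cons, Prod.mk.injEq, List.not_mem_nil, or_false] at this
    clear hx'
    grind
  · intro hx
    simp only [List.nodup_cons, List.mem_cons, List.not_mem_nil] at h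
    refine ⟨?_, fun y hy => ?_⟩
    · simp only [poset, elems, Set.mem_ofPred_eq, List.mem_cons, List.not_mem_nil, or_false]
      tauto
    · simp only [poset, rels, List.mem_cons, Prod.mk.injEq, List.not_mem_nil, or_false] at hy
      grind

theorem isMinimal_P112 {c m a₁ a₂ : α} (h) {x : α} :
    (P112 c m a₁ a₂ h).poset.IsMinimal x ↔ x = c := by
  constructor
  · rintro ⟨hx, hx'⟩
    simp only [poset, elems, Set.mem_ofPred_eq, List.mem_cons, List.not_mem_nil, or_false] at hx
    have := hx' c
    simp only [poset, rels, List.mem_cons, Prod.mk.injEq, List.not_mem_nil, or_false] at this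
    clear hx'
    grind
  · intro hx
    simp only [List.nodup_cons, List.mem_cons, List.not_mem_nil] at h
    refine ⟨?_, fun y hy => ?_⟩
    · simp only [poset, elems, Set.mem_ofPred_eq, List.mem_cons, List.not_mem_nil, or_false]
      tauto
    · simp only [poset, rels, List.mem_cons, Prod.mk.injEq, List.not_mem_nil, or_false] at hy
      grind

theorem isMaximal_P112 {c m a₁ a₂ : α} (h) {x : α} :
    (P112 c m a₁ a₂ h).poset.IsMaximal x ↔ x = a₁ ∨ x = a₂ := by
  constructor
  · rintro ⟨hx, hx'⟩
    simp only [poset, elems, Set.mem_ofPred_eq, List.mem_cons, List.not_mem_nil, or_false] at hx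
    have := hx' a₁
    simp only [poset, rels, List.mem_cons, Prod.mk.injEq, List.not_mem_nil, or_false] at this
    clear hx'
    grind
  · intro hx
    simp only [List.nodup_cons, List.mem_cons, List.not_mem_nil] at h
    refine ⟨?_, fun y hy => ?_⟩
    · simp only [poset, elems, Set.mem_ofPred_eq, List.mem_cons, List.not_mem_nil, or_false]
      tauto
    · simp only [poset, rels, List.mem_cons, Prod.mk.injEq, List.not_mem_nil, or_false] at hy
      grind

theorem isMinimal_P211 {a₁ a₂ m c : α} (h) {x : α} :
    (P211 a₁ a₂ m c h).poset.IsMinimal x ↔ x = a₁ ∨ x = a₂ := by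
  constructor
  · rintro ⟨hx, hx'⟩
    simp only [poset, elems, Set.mem_ofPred_eq, List.mem_cons, List.not_mem_nil, or_false] at hx
    have := hx' a₁
    simp only [poset, rels, List.mem_cons, Prod.mk.injEq, List.not_mem_nil, or_false] at this
    clear hx'
    grind
  · intro hx
    simp only [List.nodup_cons, List.mem_cons, List.not_mem_nil] at h
    refine ⟨?_, fun y hy => ?_⟩
    · simp only [poset, elems, Set.mem_ofPred_eq, List.mem_cons, List.not_mem_nil, or_false]
      tauto
    · simp only [poset, rels, List.mem_cons, Prod.mk.injEq, List.not_mem_nil, or_false] at hy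
      grind

theorem isMaximal_P211 {a₁ a₂ m c : α} (h) {x : α} :
    (P211 a₁ a₂ m c h).poset.IsMaximal x ↔ x = c := by
  constructor
  · rintro ⟨hx, hx'⟩
    simp only [poset, elems, Set.mem_ofPred_eq, List.mem_cons, List.not_mem_nil, or_false] at hx
    have := hx' c
    simp only [poset, rels, List.mem_cons, Prod.mk.injEq, List.not_mem_nil, or_false] at this
    clear hx'
    grind
  · intro hx
    simp only [List.nodup_cons, List.mem_cons, List.not_mem_nil] at h
    refine ⟨?_, fun y hy => ?_⟩
    · simp only [poset, elems, Set.mem_ofPred_eq, List.mem_cons, List.not_mem_nil, or_false]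
      tauto
    · simp only [poset, rels, List.mem_cons, Prod.mk.injEq, List.not_mem_nil, or_false] at hy
      grind

theorem extremes_P11 {c a : α} (h) : (P11 c a h).poset.extremes = {c, a} := by
  ext x
  simp only [SubPoset.extremes, isMinimal_P11, isMaximal_P11, Set.mem_ofPred_eq,
    Set.mem_insert_iff, Set.mem_singleton_iff]

theorem minMax_P11 {c a : α} (h) : (P11 c a h).poset.minMax = {(c, a)} := by
  ext ⟨x, y⟩
  simp only [SubPoset.minMax, isMinimal_P11, isMaximal_P11, Set.mem_ofPred_eq]
  simp only [poset, rels, List.mem_cons, List.not_mem_nil, Prod.mk.injEq, Set.mem_singleton_iff]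
  simp only [List.nodup_cons, List.mem_cons, List.not_mem_nil] at h
  grind

theorem extremes_P111 {c m a : α} (h) : (P111 c m a h).poset.extremes = {c, a} := by
  ext x
  simp only [SubPoset.extremes, isMinimal_P111, isMaximal_P111, Set.mem_ofPred_eq,
    Set.mem_insert_iff, Set.mem_singleton_iff]

theorem minMax_P111 {c m a : α} (h) : (P111 c m a h).poset.minMax = {(c, a)} := by
  ext ⟨x, y⟩
  simp only [SubPoset.minMax, isMinimal_P111, isMaximal_P111, Set.mem_ofPred_eq]
  simp only [poset, rels, List.mem_cons, List.not_mem_nil, Prod.mk.injEq, Set.mem_singleton_iff]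
  simp only [List.nodup_cons, List.mem_cons, List.not_mem_nil] at h
  grind

theorem extremes_P112 {c m a₁ a₂ : α} (h) : (P112 c m a₁ a₂ h).poset.extremes = {c, a₁, a₂} := by
  ext x
  simp only [SubPoset.extremes, isMinimal_P112, isMaximal_P112, Set.mem_ofPred_eq,
    Set.mem_insert_iff, Set.mem_singleton_iff]

theorem minMax_P112 {c m a₁ a₂ : α} (h) : (P112 c m a₁ a₂ h).poset.minMax = {(c, a₁), (c, a₂)} := by
  ext ⟨x, y⟩
  simp only [SubPoset.minMax, isMinimal_P112, isMaximal_P112, Set.mem_ofPred_eq]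
  simp only [poset, rels, List.mem_cons, List.not_mem_nil, Prod.mk.injEq, Set.mem_insert_iff,
    Set.mem_singleton_iff]
  simp only [List.nodup_cons, List.mem_cons, List.not_mem_nil] at h
  grind

theorem extremes_P211 {a₁ a₂ m c : α} (h) : (P211 a₁ a₂ m c h).poset.extremes = {c, a₁, a₂} := by
  ext x
  simp only [SubPoset.extremes, isMinimal_P211, isMaximal_P211, Set.mem_ofPred_eq,
    Set.mem_insert_iff, Set.mem_singleton_iff]
  tauto

theorem minMax_P211 {a₁ a₂ m c : α} (h) : (P211 a₁ a₂ m c h).poset.minMax = {(a₁, c), (a₂, c)} := by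
  ext ⟨x, y⟩
  simp only [SubPoset.minMax, isMinimal_P211, isMaximal_P211, Set.mem_ofPred_eq]
  simp only [poset, rels, List.mem_cons, List.not_mem_nil, Prod.mk.injEq, Set.mem_insert_iff,
    Set.mem_singleton_iff]
  simp only [List.nodup_cons, List.mem_cons, List.not_mem_nil] at h
  grind

theorem nbhd11_P111 {c m a : α} (h) : Nbhd11 (P111 c m a h).poset.lt m c a := by
  simp only [List.nodup_cons, List.mem_cons, List.not_mem_nil] at h
  simp only [Nbhd11, poset, rels, List.mem_cons, List.not_mem_nil, Prod.mk.injEq]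
  grind

theorem nbhd12_P112 {c m a₁ a₂ : α} (h) :
    Nbhd12 (P112 c m a₁ a₂ h).poset.lt m c a₁ a₂ := by
  simp only [List.nodup_cons, List.mem_cons, List.not_mem_nil] at h
  simp only [Nbhd12, poset, rels, List.mem_cons, List.not_mem_nil, Prod.mk.injEq]
  grind

theorem nbhd21_P211 {a₁ a₂ m c : α} (h) :
    Nbhd21 (P211 a₁ a₂ m c h).poset.lt m a₁ a₂ c := by
  simp only [List.nodup_cons, List.mem_cons, List.not_mem_nil] at h
  simp only [Nbhd21, poset, rels, List.mem_cons, List.not_mem_nil, Prod.mk.injEq]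
  grind

end Block

/-! ### The rules -/

section Rules

variable {α : Type*} {Q P : SubPoset α} {b : Block α} {ρ : GluingRule}

/-- This and the next three lemmas contain all that the tree argument uses of the six rules. -/
theorem GluingRule.Applies.touches (h : ρ.Applies Q b) :
    b.c ∈ Q.carrier ∨ b.a₁ ∈ Q.carrier ∨ ∃ z ∈ b.a₂, z ∈ Q.carrier := by
  cases ρ <;> simp only [GluingRule.Applies] at h <;> tauto

theorem GluingRule.Applies.related₁ (h : ρ.Applies Q b) (hc : b.c ∈ Q.carrier)
    (ha : b.a₁ ∈ Q.carrier) : Q.Related b.a₁ b.c := by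
  cases ρ <;> simp only [GluingRule.Applies] at h <;> grind

theorem GluingRule.Applies.related₂ (h : ρ.Applies Q b) (hc : b.c ∈ Q.carrier) {z : α}
    (hz : z ∈ b.a₂) (ha : z ∈ Q.carrier) : Q.Related z b.c := by
  cases ρ <;> simp only [GluingRule.Applies, Option.mem_def] at h hz <;> grind

/-- Gluing `a₁` and `a₂` without `c` would connect two vertices of the tree by a second path. -/
theorem GluingRule.Applies.not_both (h : ρ.Applies Q b) (hc : b.c ∉ Q.carrier) {z : α}
    (hz : z ∈ b.a₂) (ha : b.a₁ ∈ Q.carrier) : z ∉ Q.carrier := by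
  cases ρ <;> simp only [GluingRule.Applies, Option.mem_def] at h hz <;> grind

theorem GrownTree.add {r s p q : α} {E : Set (α × α)} {V : Set α} (h : GrownTree r s E V)
    (hV : p ∈ V ∨ q ∈ V) (hE : p ∈ V → q ∈ V → (p, q) ∈ E) :
    GrownTree r s (insert (p, q) E) (insert p (insert q V)) := by
  by_cases hp : p ∈ V <;> by_cases hq : q ∈ V
  · rwa [Set.insert_eq_of_mem (hE hp hq), Set.insert_eq_of_mem hq, Set.insert_eq_of_mem hp]
  · rw [Set.insert_eq_of_mem (Set.mem_insert_of_mem q hp)]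
    exact h.up hp hq
  · rw [Set.insert_eq_of_mem hq]
    exact h.down hp hq
  · tauto

/-- Adding two edges with a common end to a tree. -/
theorem GrownTree.add_two {r s : α} {E : Set (α × α)} {V : Set α} (h : GrownTree r s E V)
    {c a₁ a₂ : α} {e : α → α × α} (he : (∀ x, e x = (c, x)) ∨ (∀ x, e x = (x, c)))
    (h1 : c ≠ a₁) (h2 : c ≠ a₂) (h12 : a₁ ≠ a₂) (hV : c ∈ V ∨ a₁ ∈ V ∨ a₂ ∈ V)
    (hE₁ : c ∈ V → a₁ ∈ V → e a₁ ∈ E) (hE₂ : c ∈ V → a₂ ∈ V → e a₂ ∈ E)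
    (hnot : c ∉ V → a₁ ∈ V → a₂ ∉ V) : GrownTree r s (E ∪ {e a₁, e a₂}) (V ∪ {c, a₁, a₂}) := by
  have step : ∀ {E : Set (α × α)} {V : Set α}, GrownTree r s E V → ∀ x, (c ∈ V ∨ x ∈ V) →
      (c ∈ V → x ∈ V → e x ∈ E) → GrownTree r s (insert (e x) E) (insert c (insert x V)) := by
    intro E V h x hV hE
    rcases he with he | he
    · rw [he] at hE ⊢
      exact h.add hV hE
    · rw [he] at hE ⊢
      rw [Set.insert_comm]
      exact h.add hV.symm fun h1 h2 => hE h2 h1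
  -- The edge that already touches the tree has to come first; afterwards `c` is a vertex and the
  -- other edge can follow.
  by_cases hfirst : c ∈ V ∨ a₁ ∈ V
  · have := step (step h a₁ hfirst hE₁) a₂ (Or.inl (Set.mem_insert _ _)) fun _ ha => by
      have ha' : a₂ ∈ V := by
        simpa [h2.symm, h12.symm] using ha
      have hc : c ∈ V := by
        by_contra hc
        exact hnot hc (hfirst.resolve_left hc) ha'
      exact Or.inr (hE₂ hc ha')
    convert this using 1 <;> ext <;> simp <;> grind
  · rw [not_or] at hfirst
    have ha₂ : a₂ ∈ V := by tauto
    have := step (step h a₂ (Or.inr ha₂) hE₂) a₁ (Or.inl (Set.mem_insert _ _)) fun _ ha => by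
      have ha' : a₁ ∈ V := by
        simpa [h1.symm, h12] using ha
      exact absurd ha' hfirst.2
    convert this using 1 <;> ext x <;> simp only [Set.mem_union, Set.mem_insert_iff, Set.mem_singleton_iff] <;> grind

/-- A block edge with both ends in `Q` is already an edge of `Q`, by the comparability conditions;
every other block edge can be added as a leaf. -/
theorem IsGluing.grownTree (hG : IsGluing Q b.poset P) (hρ : ρ.Applies Q b) {r s : α}
    (h : GrownTree r s Q.minMax Q.extremes) : GrownTree r s P.minMax P.extremes := by
  rw [hG.minMax_eq, hG.extremes_eq]
  have hmem : ∀ {x}, x ∈ b.poset.extremes → (x ∈ Q.extremes ↔ x ∈ Q.carrier) := fun {x} hx =>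
    ⟨fun h => Q.extremes_subset h, fun h => (hG.mem_extremes_iff h).1 (hG.extremes_eq ▸ Or.inr hx)⟩
  have hedge : ∀ {x y}, (x, y) ∈ b.poset.minMax → Q.Related x y ∨ Q.Related y x →
      (x, y) ∈ Q.minMax := fun hxy hr =>
    hG.mem_minMax_of_lt (hG.symm.mem_minMax_of_mem hxy) (hG.lt_of_related hxy hr)
  have h1 := hρ.touches
  have h2 := hρ.related₁
  have h3 := hρ.related₂
  have h4 := hρ.not_both
  cases b with
  | P11 c a hn =>
    rw [Block.extremes_P11] at hmem
    rw [Block.minMax_P11] at hedge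
    simp only [Block.c, Block.a₁, Block.a₂, Option.mem_def, reduceCtorEq, false_and, exists_false,
      or_false] at h1 h2
    have hc := hmem (x := c) (by simp)
    have ha := hmem (x := a) (by simp)
    rw [Block.minMax_P11, Block.extremes_P11]
    have := h.add (by rwa [hc, ha]) fun h5 h6 =>
      hedge rfl (Or.inr (h2 (hc.1 h5) (ha.1 h6)))
    convert this using 1 <;> ext <;> simp
  | P111 c m a hn =>
    rw [Block.extremes_P111] at hmem
    rw [Block.minMax_P111] at hedge
    simp only [Block.c, Block.a₁, Block.a₂, Option.mem_def, reduceCtorEq, false_and, exists_false,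
      or_false] at h1 h2
    have hc := hmem (x := c) (by simp)
    have ha := hmem (x := a) (by simp)
    rw [Block.minMax_P111, Block.extremes_P111]
    have := h.add (by rwa [hc, ha]) fun h5 h6 =>
      hedge rfl (Or.inr (h2 (hc.1 h5) (ha.1 h6)))
    convert this using 1 <;> ext <;> simp
  | P112 c m a₁ a₂ hn =>
    rw [Block.extremes_P112] at hmem
    rw [Block.minMax_P112] at hedge
    simp only [Block.c, Block.a₁, Block.a₂, Option.mem_def, Option.some.injEq, exists_eq_left',
      forall_eq'] at h1 h2 h3 h4
    have hc := hmem (x := c) (by simp)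
    have ha₁ := hmem (x := a₁) (by simp)
    have ha₂ := hmem (x := a₂) (by simp)
    have hne₁ : c ≠ a₁ := by rintro rfl; simp at hn
    have hne₂ : c ≠ a₂ := by rintro rfl; simp at hn
    have hne : a₁ ≠ a₂ := by rintro rfl; simp at hn
    rw [Block.minMax_P112, Block.extremes_P112]
    exact h.add_two (e := fun x => (c, x)) (Or.inl fun _ => rfl) hne₁ hne₂ hne
      (by rwa [hc, ha₁, ha₂])
      (fun h5 h6 => hedge (by simp) (Or.inr (h2 (hc.1 h5) (ha₁.1 h6))))
      (fun h5 h6 => hedge (by simp) (Or.inr (h3 (hc.1 h5) (ha₂.1 h6)))) (by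
        rw [hc, ha₁, ha₂]; exact fun h5 h6 => h4 h5 h6)
  | P211 a₁ a₂ m c hn =>
    rw [Block.extremes_P211] at hmem
    rw [Block.minMax_P211] at hedge
    simp only [Block.c, Block.a₁, Block.a₂, Option.mem_def, Option.some.injEq, exists_eq_left',
      forall_eq'] at h1 h2 h3 h4
    have hc := hmem (x := c) (by simp)
    have ha₁ := hmem (x := a₁) (by simp)
    have ha₂ := hmem (x := a₂) (by simp)
    have hne₁ : c ≠ a₁ := by rintro rfl; simp at hn
    have hne₂ : c ≠ a₂ := by rintro rfl; simp at hn
    have hne : a₁ ≠ a₂ := by rintro rfl; simp at hn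
    rw [Block.minMax_P211, Block.extremes_P211]
    exact h.add_two (e := fun x => (x, c)) (Or.inr fun _ => rfl) hne₁ hne₂ hne
      (by rwa [hc, ha₁, ha₂])
      (fun h5 h6 => hedge (by simp) (Or.inl (h2 (hc.1 h5) (ha₁.1 h6))))
      (fun h5 h6 => hedge (by simp) (Or.inl (h3 (hc.1 h5) (ha₂.1 h6)))) (by
        rw [hc, ha₁, ha₂]; exact fun h5 h6 => h4 h5 h6)

theorem Block.exists_grownTree (b : Block α) :
    ∃ r s, GrownTree r s b.poset.minMax b.poset.extremes := by
  cases b with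
  | P11 c a hn =>
    refine ⟨c, a, ?_⟩
    rw [Block.minMax_P11, Block.extremes_P11]
    exact .base (by simpa using hn)
  | P111 c m a hn =>
    refine ⟨c, a, ?_⟩
    rw [Block.minMax_P111, Block.extremes_P111]
    exact .base (by simp at hn; tauto)
  | P112 c m a₁ a₂ hn =>
    refine ⟨c, a₁, ?_⟩
    rw [Block.minMax_P112, Block.extremes_P112]
    simp only [List.nodup_cons, List.mem_cons, List.not_mem_nil] at hn
    have := (GrownTree.base (c := c) (a := a₁) (by tauto)).up (p := c) (q := a₂) (by simp)
      (by simp; grind)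
    convert this using 1 <;> ext <;> simp <;> grind
  | P211 a₁ a₂ m c hn =>
    refine ⟨a₁, c, ?_⟩
    rw [Block.minMax_P211, Block.extremes_P211]
    simp only [List.nodup_cons, List.mem_cons, List.not_mem_nil] at hn
    have := (GrownTree.base (c := a₁) (a := c) (by grind)).down (p := a₂) (q := c)
      (by simp; grind) (by simp)
    convert this using 1 <;> ext <;> simp <;> grind

end Rules

/-! ### Contact sequences lead to contact posets -/

section Congr

variable {k α : Type*} [Field k] {r r' : α → α → Prop} {m c a a₁ a₂ : α}

theorem Nbhd11.congr (h : Nbhd11 r m c a) (hb : ∀ x, r' x m ↔ r x m) (ha : ∀ y, r' m y ↔ r m y) :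
    Nbhd11 r' m c a := ⟨fun x => (hb x).trans (h.1 x), fun y => (ha y).trans (h.2 y)⟩

theorem Nbhd12.congr (h : Nbhd12 r m c a₁ a₂) (hb : ∀ x, r' x m ↔ r x m)
    (ha : ∀ y, r' m y ↔ r m y) : Nbhd12 r' m c a₁ a₂ :=
  ⟨h.1, fun x => (hb x).trans (h.2.1 x), fun y => (ha y).trans (h.2.2 y)⟩

theorem Nbhd21.congr (h : Nbhd21 r m a₁ a₂ c) (hb : ∀ x, r' x m ↔ r x m)
    (ha : ∀ y, r' m y ↔ r m y) : Nbhd21 r' m a₁ a₂ c :=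
  ⟨h.1, fun x => (hb x).trans (h.2.1 x), fun y => (ha y).trans (h.2.2 y)⟩

theorem StandardAt.congr {f f' : Matrix α α k} (h : StandardAt r f m)
    (hb : ∀ x, r' x m ↔ r x m) (ha : ∀ y, r' m y ↔ r m y) (hfb : ∀ x, f' x m = f x m)
    (hfa : ∀ y, f' m y = f m y) : StandardAt r' f' m := by
  rcases h with ⟨c, a₁, a₂, h, h1, h2, h3⟩ | ⟨a₁, a₂, c, h, h1, h2, h3⟩
  · exact Or.inl ⟨c, a₁, a₂, h.congr hb ha, by rw [hfb, h1], by rw [hfa, h2], by rw [hfa, h3]⟩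
  · exact Or.inr ⟨a₁, a₂, c, h.congr hb ha, by rw [hfb, h1], by rw [hfb, h2], by rw [hfa, h3]⟩

end Congr

theorem Block.mid_type {α : Type*} (b : Block α) {m : α} (hm : m ∈ b.poset.carrier)
    (hext : m ∉ b.poset.extremes) :
    (∃ c a h, b = .P111 c m a h ∧ Nbhd11 b.poset.lt m c a) ∨
    (∃ c a₁ a₂ h, b = .P112 c m a₁ a₂ h ∧ Nbhd12 b.poset.lt m c a₁ a₂) ∨
    (∃ a₁ a₂ c h, b = .P211 a₁ a₂ m c h ∧ Nbhd21 b.poset.lt m a₁ a₂ c) := by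
  cases b with
  | P11 c a hn =>
    simp only [poset, elems, Set.mem_ofPred_eq, List.mem_cons, List.not_mem_nil, or_false] at hm
    rw [extremes_P11] at hext
    exact absurd hm hext
  | P111 c m' a hn =>
    simp only [poset, elems, Set.mem_ofPred_eq, List.mem_cons, List.not_mem_nil, or_false] at hm
    rw [extremes_P111, Set.mem_insert_iff, Set.mem_singleton_iff] at hext
    obtain rfl : m = m' := by tauto
    exact Or.inl ⟨c, a, hn, rfl, nbhd11_P111 hn⟩
  | P112 c m' a₁ a₂ hn =>
    simp only [poset, elems, Set.mem_ofPred_eq, List.mem_cons, List.not_mem_nil, or_false] at hm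
    rw [extremes_P112, Set.mem_insert_iff, Set.mem_insert_iff, Set.mem_singleton_iff] at hext
    obtain rfl : m = m' := by tauto
    exact Or.inr (Or.inl ⟨c, a₁, a₂, hn, rfl, nbhd12_P112 hn⟩)
  | P211 a₁ a₂ m' c hn =>
    simp only [poset, elems, Set.mem_ofPred_eq, List.mem_cons, List.not_mem_nil, or_false] at hm
    rw [extremes_P211, Set.mem_insert_iff, Set.mem_insert_iff, Set.mem_singleton_iff] at hext
    obtain rfl : m = m' := by tauto
    exact Or.inr (Or.inr ⟨a₁, a₂, c, hn, rfl, nbhd21_P211 hn⟩)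

theorem Block.mid_P111 {α : Type*} {c m a : α} (h) :
    m ∈ (P111 c m a h).poset.carrier ∧ m ∉ (P111 c m a h).poset.extremes := by
  refine ⟨by simp [poset, elems], ?_⟩
  rw [extremes_P111]
  simp only [List.nodup_cons, List.mem_cons, List.not_mem_nil] at h
  simp only [Set.mem_insert_iff, Set.mem_singleton_iff]
  grind

/-! ### Translation between the ambient order and `SubPoset.whole`. -/

section Whole

variable {α : Type*} [PartialOrder α]

theorem isMinimal_whole {x : α} : (SubPoset.whole α).IsMinimal x ↔ IsMin x :=
  (and_iff_right trivial).trans isMin_iff_forall_not_lt.symm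

theorem isMaximal_whole {x : α} : (SubPoset.whole α).IsMaximal x ↔ IsMax x :=
  (and_iff_right trivial).trans isMax_iff_forall_not_lt.symm

theorem extremes_whole : (SubPoset.whole α).extremes = extremal α := by
  ext x
  exact or_congr isMinimal_whole isMaximal_whole

theorem minMax_whole : (SubPoset.whole α).minMax = minMaxRel α := by
  ext x
  exact and_congr Iff.rfl (and_congr isMinimal_whole isMaximal_whole)

end Whole

namespace ContactSequence

variable {α : Type*} {n : ℕ} (s : ContactSequence α n)

theorem exists_grownTree (j : ℕ) (hj : j ≤ n) :
    ∃ r t, GrownTree r t (s.P j).minMax (s.P j).extremes := by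
  induction j with
  | zero =>
    rw [s.start]
    exact (s.S 0).exists_grownTree
  | succ j ih =>
    obtain ⟨r, t, h⟩ := ih (by omega)
    exact ⟨r, t, (s.gluing j hj).grownTree (s.rule_applies j hj) h⟩

/-- Only extremal elements are identified, so a middle element keeps the neighbourhood it has in the
block that brought it in. -/
theorem mid_type (j : ℕ) (hj : j ≤ n) {m : α} (hm : m ∈ (s.P j).carrier)
    (hext : m ∉ (s.P j).extremes) :
    (∃ i ≤ j, ∃ c a h, s.S i = .P111 c m a h) ∨
      (∃ c a₁ a₂, Nbhd12 (s.P j).lt m c a₁ a₂) ∨ ∃ a₁ a₂ c, Nbhd21 (s.P j).lt m a₁ a₂ c := by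
  induction j with
  | zero =>
    rw [s.start] at hm hext ⊢
    rcases (s.S 0).mid_type hm hext with ⟨c, a, h, hb, -⟩ | ⟨c, a₁, a₂, -, -, h⟩ |
      ⟨a₁, a₂, c, -, -, h⟩
    · exact Or.inl ⟨0, le_rfl, c, a, h, hb⟩
    · exact Or.inr (Or.inl ⟨c, a₁, a₂, h⟩)
    · exact Or.inr (Or.inr ⟨a₁, a₂, c, h⟩)
  | succ j ih =>
    have hG := s.gluing j hj
    have hm' := hm
    rw [hG.carrier_eq] at hm'
    rcases hm' with hm' | hm'
    · rw [hG.mem_extremes_iff hm'] at hext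
      have hS := hG.notMem_of_notMem_extremes hm' hext
      rcases ih (by omega) hm' hext with ⟨i, hi, h⟩ | ⟨c, a₁, a₂, h⟩ | ⟨a₁, a₂, c, h⟩
      · exact Or.inl ⟨i, by omega, h⟩
      · exact Or.inr (Or.inl ⟨c, a₁, a₂, h.congr (hG.lt_iff_left hS) (hG.lt_iff_right hS)⟩)
      · exact Or.inr (Or.inr ⟨a₁, a₂, c, h.congr (hG.lt_iff_left hS) (hG.lt_iff_right hS)⟩)
    · rw [hG.symm.mem_extremes_iff hm'] at hext
      have hQ := hG.symm.notMem_of_notMem_extremes hm' hext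
      rcases (s.S (j + 1)).mid_type hm' hext with ⟨c, a, h, hb, -⟩ | ⟨c, a₁, a₂, -, -, h⟩ |
        ⟨a₁, a₂, c, -, -, h⟩
      · exact Or.inl ⟨j + 1, le_rfl, c, a, h, hb⟩
      · exact Or.inr (Or.inl ⟨c, a₁, a₂,
          h.congr (hG.symm.lt_iff_left hQ) (hG.symm.lt_iff_right hQ)⟩)
      · exact Or.inr (Or.inr ⟨a₁, a₂, c,
          h.congr (hG.symm.lt_iff_left hQ) (hG.symm.lt_iff_right hQ)⟩)

theorem nbhd11_of_P111 (j : ℕ) (hj : j ≤ n) {i : ℕ} (hi : i ≤ j) {c m a : α} {h}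
    (hS : s.S i = .P111 c m a h) :
    m ∈ (s.P j).carrier ∧ m ∉ (s.P j).extremes ∧ Nbhd11 (s.P j).lt m c a := by
  induction j with
  | zero =>
    obtain rfl : i = 0 := by omega
    rw [s.start, hS]
    exact ⟨(Block.mid_P111 h).1, (Block.mid_P111 h).2, Block.nbhd11_P111 h⟩
  | succ j ih =>
    have hG := s.gluing j hj
    rcases hi.eq_or_lt with rfl | hi
    · rw [hS] at hG
      obtain ⟨hm, hext⟩ := Block.mid_P111 h
      have hQ := hG.symm.notMem_of_notMem_extremes hm hext
      exact ⟨hG.carrier_eq ▸ Or.inr hm, by rwa [hG.symm.mem_extremes_iff hm],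
        (Block.nbhd11_P111 h).congr (hG.symm.lt_iff_left hQ) (hG.symm.lt_iff_right hQ)⟩
    · obtain ⟨hm, hext, hn⟩ := ih (by omega) (by omega)
      have hS := hG.notMem_of_notMem_extremes hm hext
      exact ⟨hG.carrier_eq ▸ Or.inl hm, by rwa [hG.mem_extremes_iff hm],
        hn.congr (hG.lt_iff_left hS) (hG.lt_iff_right hS)⟩

theorem isContactPoset (k : Type*) [Field k] [Fintype α] [PartialOrder α]
    (hs : s.P n = SubPoset.whole α) : IsContactPoset k α := by
  have hmid := fun {m} hm hext => s.mid_type n le_rfl (m := m) hm hext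
  have h111 := fun {i} (hi : i ≤ n) {c m a h} hS =>
    s.nbhd11_of_P111 n le_rfl hi (c := c) (m := m) (a := a) (h := h) hS
  rw [hs, extremes_whole] at hmid h111
  obtain ⟨j₀, ⟨hj₀, hP⟩, huniq⟩ := s.existsUnique_P111
  refine ⟨?_, fun m hm => ?_, ?_, ?_⟩
  · obtain ⟨r, t, h⟩ := s.exists_grownTree n le_rfl
    rw [hs, minMax_whole] at h
    exact h.flowFree
  · rcases hmid trivial hm with ⟨i, hi, c, a, h, hS⟩ | h
    · exact Or.inl ⟨c, a, (h111 hi hS).2.2⟩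
    · exact Or.inr h
  · rcases hS : s.S j₀ with _ | ⟨c, m, a, h⟩ | _ | _
    · simp [hS, Block.IsP111] at hP
    · exact ⟨m, c, a, (h111 hj₀ hS).2.2⟩
    · simp [hS, Block.IsP111] at hP
    · simp [hS, Block.IsP111] at hP
  · have key : ∀ m, IsMid11 α m → ∃ c a h, s.S j₀ = .P111 c m a h := by
      rintro m ⟨c, a, hm⟩
      have hext : m ∉ extremal α :=
        not_mem_extremal_of_lt_of_lt ((hm.1 c).2 rfl) ((hm.2 a).2 rfl)
      rcases hmid trivial hext with ⟨i, hi, c, a, h, hS⟩ | ⟨_, _, _, h⟩ | ⟨_, _, _, h⟩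
      · rw [← huniq i ⟨hi, by rw [hS]; trivial⟩]
        exact ⟨c, a, h, hS⟩
      · exact absurd hm (h.not_nbhd11 c a)
      · exact absurd hm (h.not_nbhd11 c a)
    intro m m' hm hm'
    obtain ⟨c, a, h, h1⟩ := key m hm
    obtain ⟨c', a', h', h2⟩ := key m' hm'
    rw [h1] at h2
    injection h2

end ContactSequence

/-! ### The coefficients of the recursively defined one-form -/

section Coefficients

variable {k α : Type*} [Field k] {Q P : SubPoset α} {ρ : GluingRule}

/-- This and the next two lemmas replace the table of rules by one principle: a functional is added
for each min–max edge of the block not yet in `Q`, and one more for the middle element if there is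
one. -/
theorem stepForm_P11 {c a : α} {h} (hρ : ρ.Applies Q (.P11 c a h))
    (h₁ : c ∈ Q.carrier → a ∈ Q.carrier → Q.lt c a) [Decidable (Q.lt c a)] :
    ρ.stepForm k (.P11 c a h) = if Q.lt c a then 0 else coordForm k c a := by
  have l₁ := Q.left_mem c a
  have r₁ := Q.right_mem c a
  cases ρ <;> by_cases q₁ : Q.lt c a <;>
    simp_all [GluingRule.Applies, GluingRule.stepForm, Block.c, Block.a₁, Block.a₂]

theorem stepForm_P112 {c m a₁ a₂ : α} {h} (hρ : ρ.Applies Q (.P112 c m a₁ a₂ h))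
    (h₁ : c ∈ Q.carrier → a₁ ∈ Q.carrier → Q.lt c a₁)
    (h₂ : c ∈ Q.carrier → a₂ ∈ Q.carrier → Q.lt c a₂)
    [Decidable (Q.lt c a₁)] [Decidable (Q.lt c a₂)] :
    ρ.stepForm k (.P112 c m a₁ a₂ h) = (if Q.lt c a₁ then 0 else coordForm k c a₁) +
      (if Q.lt c a₂ then 0 else coordForm k c a₂) + coordForm k m a₂ := by
  have l₁ := Q.left_mem c a₁
  have r₁ := Q.right_mem c a₁
  have l₂ := Q.left_mem c a₂
  have r₂ := Q.right_mem c a₂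
  cases ρ <;> by_cases q₁ : Q.lt c a₁ <;> by_cases q₂ : Q.lt c a₂ <;>
    simp_all [GluingRule.Applies, GluingRule.stepForm, Block.c, Block.a₁, Block.a₂]

theorem stepForm_P211 {a₁ a₂ m c : α} {h} (hρ : ρ.Applies Q (.P211 a₁ a₂ m c h))
    (h₁ : c ∈ Q.carrier → a₁ ∈ Q.carrier → Q.lt a₁ c)
    (h₂ : c ∈ Q.carrier → a₂ ∈ Q.carrier → Q.lt a₂ c)
    [Decidable (Q.lt a₁ c)] [Decidable (Q.lt a₂ c)] :
    ρ.stepForm k (.P211 a₁ a₂ m c h) = (if Q.lt a₁ c then 0 else coordForm k a₁ c) +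
      (if Q.lt a₂ c then 0 else coordForm k a₂ c) + coordForm k a₂ m := by
  have l₁ := Q.left_mem a₁ c
  have r₁ := Q.right_mem a₁ c
  have l₂ := Q.left_mem a₂ c
  have r₂ := Q.right_mem a₂ c
  cases ρ <;> by_cases q₁ : Q.lt a₁ c <;> by_cases q₂ : Q.lt a₂ c <;>
    simp_all [GluingRule.Applies, GluingRule.stepForm, Block.c, Block.a₁, Block.a₂]

variable [DecidableEq α]

theorem coordForm_single (p q x y : α) :
    coordForm k p q (Matrix.single x y 1) = if x = p ∧ y = q then 1 else 0 := by
  simp [coordForm, Matrix.single_apply]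

/-- The matrix of coefficients of a one-form. -/
def coeffMatrix (ψ : Module.Dual k (Matrix α α k)) : Matrix α α k :=
  Matrix.of fun i j => ψ (Matrix.single i j 1)

/-- The properties of the coefficients that are added when a block is adjoined. -/
structure StepCoefficients (Q : SubPoset α) (b : Block α) (g : Matrix α α k) : Prop where
  lt_of_ne_zero : ∀ x y, g x y ≠ 0 → b.poset.lt x y
  eq_one : ∀ x y, (x, y) ∈ b.poset.minMax → ¬ Q.lt x y → g x y = 1
  eq_zero : ∀ x y, (x, y) ∈ b.poset.minMax → Q.lt x y → g x y = 0
  standardAt : ∀ m, m ∈ b.poset.carrier → m ∉ b.poset.extremes → StandardAt b.poset.lt g m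

theorem IsGluing.stepCoefficients {b : Block α} (hG : IsGluing Q b.poset P) (hρ : ρ.Applies Q b)
    (hb : ¬ b.IsP111) : StepCoefficients Q b (coeffMatrix (ρ.stepForm k b)) := by
  classical
  have hmid := fun {m} => b.mid_type (m := m)
  have hedge := fun {x y} => hG.lt_of_related (x := x) (y := y)
  have h1 := hρ.related₁
  have h2 := hρ.related₂
  cases b with
  | P11 c a hn =>
    have h₁ : c ∈ Q.carrier → a ∈ Q.carrier → Q.lt c a := fun hc ha =>
      hedge (by rw [Block.minMax_P11]; simp) (Or.inr (h1 hc ha))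
    rw [stepForm_P11 hρ h₁]
    have hg : ∀ x y, coeffMatrix (if Q.lt c a then 0 else coordForm k c a) x y =
        if Q.lt c a then 0 else if x = c ∧ y = a then 1 else 0 := by
      intro x y
      split_ifs <;> simp_all [coeffMatrix, coordForm_single]
    constructor
    · intro x y h
      rw [hg] at h
      simp only [Block.poset, Block.rels]
      grind
    · intro x y h hlt
      rw [Block.minMax_P11] at h
      simp only [Set.mem_singleton_iff, Prod.mk.injEq] at h
      rw [hg]
      grind
    · intro x y h hlt
      rw [Block.minMax_P11] at h
      simp only [Set.mem_singleton_iff, Prod.mk.injEq] at h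
      rw [hg]
      grind
    · intro m hm hext
      rcases hmid hm hext with ⟨_, _, _, h, _⟩ | ⟨_, _, _, _, h, _⟩ | ⟨_, _, _, _, h, _⟩ <;>
        cases h
  | P111 c m a hn => exact absurd trivial hb
  | P112 c m a₁ a₂ hn =>
    have h₁ : c ∈ Q.carrier → a₁ ∈ Q.carrier → Q.lt c a₁ := fun hc ha =>
      hedge (by rw [Block.minMax_P112]; simp) (Or.inr (h1 hc ha))
    have h₂ : c ∈ Q.carrier → a₂ ∈ Q.carrier → Q.lt c a₂ := fun hc ha =>
      hedge (by rw [Block.minMax_P112]; simp) (Or.inr (h2 hc rfl ha))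
    rw [stepForm_P112 hρ h₁ h₂]
    have hg : ∀ x y, coeffMatrix ((if Q.lt c a₁ then 0 else coordForm k c a₁) +
        (if Q.lt c a₂ then 0 else coordForm k c a₂) + coordForm k m a₂) x y =
        (if Q.lt c a₁ then 0 else if x = c ∧ y = a₁ then 1 else 0) +
        (if Q.lt c a₂ then 0 else if x = c ∧ y = a₂ then 1 else 0) +
        if x = m ∧ y = a₂ then 1 else 0 := by
      intro x y
      by_cases q₁ : Q.lt c a₁ <;> by_cases q₂ : Q.lt c a₂ <;>
        simp [coeffMatrix, coordForm_single, q₁, q₂]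
    have hcm : c ≠ m := by rintro rfl; simp at hn
    have hne₁ : m ≠ a₁ := by rintro rfl; simp at hn
    have hne₂ : m ≠ a₂ := by rintro rfl; simp at hn
    have hne : a₁ ≠ a₂ := by rintro rfl; simp at hn
    constructor
    · intro x y h
      rw [hg] at h
      simp only [Block.poset, Block.rels, List.mem_cons, Prod.mk.injEq, List.not_mem_nil, or_false]
      by_contra hc
      simp only [not_or] at hc
      simp [hc] at h
    · intro x y h hlt
      rw [Block.minMax_P112] at h
      simp only [Set.mem_singleton_iff, Set.mem_insert_iff, Prod.mk.injEq] at h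
      rcases h with ⟨rfl, rfl⟩ | ⟨rfl, rfl⟩ <;> rw [hg] <;> simp [hlt, hcm, hne, hne.symm]
    · intro x y h hlt
      rw [Block.minMax_P112] at h
      simp only [Set.mem_singleton_iff, Set.mem_insert_iff, Prod.mk.injEq] at h
      rcases h with ⟨rfl, rfl⟩ | ⟨rfl, rfl⟩ <;> rw [hg] <;> simp [hlt, hcm, hne, hne.symm]
    · intro m' hm hext
      rcases hmid hm hext with ⟨_, _, _, h, _⟩ | ⟨_, _, _, _, h, hnb⟩ | ⟨_, _, _, _, h, _⟩ <;>
        cases h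
      refine Or.inl ⟨c, a₁, a₂, hnb, ?_, ?_, ?_⟩ <;> rw [hg] <;>
        simp [hcm, hcm.symm, hne, hne₁, hne₂]
  | P211 a₁ a₂ m c hn =>
    have h₁ : c ∈ Q.carrier → a₁ ∈ Q.carrier → Q.lt a₁ c := fun hc ha =>
      hedge (by rw [Block.minMax_P211]; simp) (Or.inl (h1 hc ha))
    have h₂ : c ∈ Q.carrier → a₂ ∈ Q.carrier → Q.lt a₂ c := fun hc ha =>
      hedge (by rw [Block.minMax_P211]; simp) (Or.inl (h2 hc rfl ha))
    rw [stepForm_P211 hρ h₁ h₂]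
    have hg : ∀ x y, coeffMatrix ((if Q.lt a₁ c then 0 else coordForm k a₁ c) +
        (if Q.lt a₂ c then 0 else coordForm k a₂ c) + coordForm k a₂ m) x y =
        (if Q.lt a₁ c then 0 else if x = a₁ ∧ y = c then 1 else 0) +
        (if Q.lt a₂ c then 0 else if x = a₂ ∧ y = c then 1 else 0) +
        if x = a₂ ∧ y = m then 1 else 0 := by
      intro x y
      by_cases q₁ : Q.lt a₁ c <;> by_cases q₂ : Q.lt a₂ c <;>
        simp [coeffMatrix, coordForm_single, q₁, q₂]
    have hcm : c ≠ m := by rintro rfl; simp at hn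
    have hne₁ : m ≠ a₁ := by rintro rfl; simp at hn
    have hne₂ : m ≠ a₂ := by rintro rfl; simp at hn
    have hne : a₁ ≠ a₂ := by rintro rfl; simp at hn
    constructor
    · intro x y h
      rw [hg] at h
      simp only [Block.poset, Block.rels, List.mem_cons, Prod.mk.injEq, List.not_mem_nil, or_false]
      by_contra hc
      simp only [not_or] at hc
      simp [hc] at h
    · intro x y h hlt
      rw [Block.minMax_P211] at h
      simp only [Set.mem_singleton_iff, Set.mem_insert_iff, Prod.mk.injEq] at h
      rcases h with ⟨rfl, rfl⟩ | ⟨rfl, rfl⟩ <;> rw [hg] <;> simp [hlt, hcm, hne, hne.symm]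
    · intro x y h hlt
      rw [Block.minMax_P211] at h
      simp only [Set.mem_singleton_iff, Set.mem_insert_iff, Prod.mk.injEq] at h
      rcases h with ⟨rfl, rfl⟩ | ⟨rfl, rfl⟩ <;> rw [hg] <;> simp [hlt, hcm, hne, hne.symm]
    · intro m' hm hext
      rcases hmid hm hext with ⟨_, _, _, h, _⟩ | ⟨_, _, _, _, h, _⟩ | ⟨_, _, _, _, h, hnb⟩ <;>
        cases h
      refine Or.inr ⟨a₁, a₂, c, hnb, ?_, ?_, ?_⟩ <;> rw [hg] <;>
        simp [hcm, hcm.symm, hne, hne₁, hne₂]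

/-- The properties of the coefficients of the one-form of a contact sequence. -/
structure SequenceCoefficients (P : SubPoset α) (f : Matrix α α k) (c₀ m₀ a₀ : α) : Prop where
  eq_one : ∀ x y, (x, y) ∈ P.minMax → f x y = 1
  lt_of_ne_zero : ∀ x y, f x y ≠ 0 → P.lt x y ∨ x = m₀ ∧ y = m₀
  mid : ∀ m, m ∈ P.carrier → m ∉ P.extremes → m ≠ m₀ → StandardAt P.lt f m
  diag : f m₀ m₀ = 1
  below : f c₀ m₀ = 0
  above : f m₀ a₀ = 1

theorem SequenceCoefficients.initial {c m a : α} (h) :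
    SequenceCoefficients (Block.P111 c m a h).poset
      (coeffMatrix ((Block.P111 c m a h).initialForm k)) c m a := by
  have hg : ∀ x y, coeffMatrix ((Block.P111 c m a h).initialForm k) x y =
      (if x = m ∧ y = m then 1 else 0) + (if x = c ∧ y = a then 1 else 0) +
        if x = m ∧ y = a then 1 else 0 := by
    intro x y
    simp [coeffMatrix, Block.initialForm, coordForm_single]
  have hcm : c ≠ m := by rintro rfl; simp at h
  have hca : c ≠ a := by rintro rfl; simp at h
  have hma : m ≠ a := by rintro rfl; simp at h
  constructor
  · intro x y hxy
    rw [Block.minMax_P111] at hxy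
    simp only [Set.mem_singleton_iff, Prod.mk.injEq] at hxy
    rw [hg, hxy.1, hxy.2]
    simp [hcm]
  · intro x y hxy
    rw [hg] at hxy
    simp only [Block.poset, Block.rels, List.mem_cons, Prod.mk.injEq, List.not_mem_nil, or_false]
    by_contra hc
    simp only [not_or] at hc
    simp [hc] at hxy
  · intro m' hm hext hne
    rcases Block.mid_type _ hm hext with ⟨_, _, _, h, _⟩ | ⟨_, _, _, _, h, _⟩ |
      ⟨_, _, _, _, h, _⟩ <;> cases h
    exact absurd rfl hne
  · rw [hg]; simp [hcm.symm, hma]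
  · rw [hg]; simp [hcm, hma]
  · rw [hg]; simp [hcm.symm, hma.symm]

omit [DecidableEq α] in
-- A min–max edge receives its coefficient `1` exactly once, from `f` if it is in `Q` and from `g`
-- otherwise. A middle element sees only the coefficients of its own part, because `g` is supported
-- on relations of the block and `f` on relations of `Q` and the place `(m₀, m₀)`.
theorem SequenceCoefficients.step {b : Block α} {f g : Matrix α α k} {c₀ m₀ a₀ : α}
    (hf : SequenceCoefficients Q f c₀ m₀ a₀) (hG : IsGluing Q b.poset P)
    (hg : StepCoefficients Q b g) (hm₀ : m₀ ∈ Q.carrier) (hext₀ : m₀ ∉ Q.extremes) :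
    SequenceCoefficients P (f + g) c₀ m₀ a₀ := by
  have hg0 : ∀ x y, ¬ b.poset.lt x y → g x y = 0 := fun x y h =>
    not_not.1 fun h' => h (hg.lt_of_ne_zero x y h')
  have hQg : ∀ m, m ∈ Q.carrier → m ∉ Q.extremes → (∀ x, g x m = 0) ∧ ∀ y, g m y = 0 := by
    intro m hm hext
    have hS := hG.notMem_of_notMem_extremes hm hext
    exact ⟨fun x => hg0 _ _ fun h => hS (b.poset.right_mem _ _ h),
      fun x => hg0 _ _ fun h => hS (b.poset.left_mem _ _ h)⟩
  constructor
  · intro x y hxy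
    rw [Matrix.add_apply]
    by_cases hlt : Q.lt x y
    · rw [hf.eq_one x y (hG.mem_minMax_of_lt hxy hlt)]
      by_cases hS : b.poset.lt x y
      · rw [hg.eq_zero x y (hG.symm.mem_minMax_of_lt hxy hS) hlt, add_zero]
      · rw [hg0 x y hS, add_zero]
    · have hS := ((hG.lt_iff x y).1 hxy.1).resolve_left hlt
      rw [hg.eq_one x y (hG.symm.mem_minMax_of_lt hxy hS) hlt, add_eq_right]
      by_contra h0
      rcases hf.lt_of_ne_zero x y h0 with h | ⟨rfl, rfl⟩
      · exact hlt h
      · exact b.poset.irrefl _ hS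
  · intro x y hxy
    by_contra hc
    simp only [not_or, hG.lt_iff] at hc
    apply hxy
    rw [Matrix.add_apply, hg0 x y hc.1.2, add_zero]
    by_contra h0
    exact (hf.lt_of_ne_zero x y h0).elim hc.1.1 hc.2
  · intro m hm hext hne
    have hm' := hm
    rw [hG.carrier_eq] at hm'
    rcases hm' with hm' | hm'
    · rw [hG.mem_extremes_iff hm'] at hext
      have hS := hG.notMem_of_notMem_extremes hm' hext
      obtain ⟨h1, h2⟩ := hQg m hm' hext
      exact (hf.mid m hm' hext hne).congr (hG.lt_iff_left hS) (hG.lt_iff_right hS)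
        (fun x => by rw [Matrix.add_apply, h1, add_zero])
        (fun x => by rw [Matrix.add_apply, h2, add_zero])
    · rw [hG.symm.mem_extremes_iff hm'] at hext
      have hQ := hG.symm.notMem_of_notMem_extremes hm' hext
      refine (hg.standardAt m hm' hext).congr (hG.symm.lt_iff_left hQ) (hG.symm.lt_iff_right hQ)
        (fun x => ?_) (fun x => ?_)
      · rw [Matrix.add_apply, add_eq_right]
        by_contra h0
        exact (hf.lt_of_ne_zero _ _ h0).elim (fun h => hQ (Q.right_mem _ _ h)) fun h => hne h.2
      · rw [Matrix.add_apply, add_eq_right]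
        by_contra h0
        exact (hf.lt_of_ne_zero _ _ h0).elim (fun h => hQ (Q.left_mem _ _ h)) fun h => hne h.1
  · rw [Matrix.add_apply, (hQg m₀ hm₀ hext₀).1, add_zero, hf.diag]
  · rw [Matrix.add_apply, (hQg m₀ hm₀ hext₀).1, add_zero, hf.below]
  · rw [Matrix.add_apply, (hQg m₀ hm₀ hext₀).2, add_zero, hf.above]

namespace ContactSequence

variable {n : ℕ} (s : ContactSequence α n)

theorem sequenceCoefficients {c₀ m₀ a₀ : α} {h} (hS : s.S 0 = .P111 c₀ m₀ a₀ h) (j : ℕ)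
    (hj : j ≤ n) : SequenceCoefficients (s.P j) (coeffMatrix (s.form k j)) c₀ m₀ a₀ := by
  induction j with
  | zero =>
    rw [s.start, hS]
    simp only [ContactSequence.form, hS]
    exact SequenceCoefficients.initial h
  | succ j ih =>
    -- The single `P(1,1,1)` is used up at index `0`.
    have hb : ¬ (s.S (j + 1)).IsP111 := fun hb => by
      have := s.existsUnique_P111.unique ⟨hj, hb⟩ ⟨Nat.zero_le n, by rw [hS]; trivial⟩
      omega
    obtain ⟨hm, hext, -⟩ := s.nbhd11_of_P111 j (by omega) (Nat.zero_le j) hS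
    exact (ih (by omega)).step (s.gluing j hj)
      ((s.gluing j hj).stepCoefficients (s.rule_applies j hj) hb) hm hext

theorem isContactForm_contactForm [CharZero k] [Fintype α] [PartialOrder α]
    (hconn : (SimpleGraph.hasse α).Connected) (h2 : HeightLeTwo α)
    (hs : s.P n = SubPoset.whole α) (hS : (s.S 0).IsP111) :
    IsContactForm k (typeALiePosetAlgebra k α) (s.contactForm k) := by
  obtain ⟨c₀, m₀, a₀, h, hS⟩ : ∃ c₀ m₀ a₀ h, s.S 0 = .P111 c₀ m₀ a₀ h := by
    rcases hS' : s.S 0 with _ | ⟨c, m, a, h⟩ | _ | _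
    · simp [hS', Block.IsP111] at hS
    · exact ⟨c, m, a, h, rfl⟩
    · simp [hS', Block.IsP111] at hS
    · simp [hS', Block.IsP111] at hS
  have hf := s.sequenceCoefficients (k := k) hS n le_rfl
  obtain ⟨-, -, hn⟩ := s.nbhd11_of_P111 n le_rfl (Nat.zero_le n) hS
  have hP := s.isContactPoset k hs
  rw [hs] at hf hn
  refine IsStandard.isContactForm (f := coeffMatrix (s.form k n))
    (fun x => dual_eq_matrixPairing _ _) ⟨fun p q hpq => hf.eq_one p q ?_, fun m hm => ?_⟩
    h2 hconn hP.flowFree hn hf.below hf.above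
    (fun m _ hm => hP.mid11_unique m m₀ hm ⟨c₀, a₀, hn⟩) fun p => ?_
  · rwa [minMax_whole]
  · by_cases hm₀ : m = m₀
    · exact Or.inl ⟨c₀, a₀, hm₀ ▸ hn, hm₀ ▸ hf.below, hm₀ ▸ hf.above⟩
    · exact Or.inr (hf.mid m trivial (by rwa [extremes_whole]) hm₀)
  · split_ifs with hp
    · rw [hp, hf.diag]
    · by_contra h0
      exact (hf.lt_of_ne_zero p p h0).elim (lt_irrefl p) fun h => hp h.1

end ContactSequence

end Coefficients

/-! ### Construction of contact sequences -/

section Reach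

variable {α : Type*}

/-- `Q` is the last poset of a contact sequence that starts with `P(1,1,1)`. -/
def Reachable (Q : SubPoset α) : Prop :=
  ∃ (n : ℕ) (s : ContactSequence α n), s.P n = Q ∧ (s.S 0).IsP111

theorem reachable_block {b : Block α} (hb : b.IsP111) (hc : b.poset.Connected)
    (hh : Order.krullDim b.poset.Elem ≤ 2) : Reachable b.poset :=
  ⟨0, { P := fun _ => b.poset
        S := fun _ => b
        rule := fun _ => .C
        connected := fun _ _ => hc
        height_le_two := fun _ _ => hh
        start := rfl
        gluing := fun j hj => absurd hj (Nat.not_lt_zero j)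
        rule_applies := fun j hj => absurd hj (Nat.not_lt_zero j)
        existsUnique_P111 := ⟨0, ⟨le_rfl, hb⟩, fun _ hj => Nat.le_zero.1 hj.1⟩ }, rfl, hb⟩

theorem Reachable.step {Q P : SubPoset α} (hQ : Reachable Q) {b : Block α} {ρ : GluingRule}
    (hG : IsGluing Q b.poset P) (hρ : ρ.Applies Q b) (hb : ¬ b.IsP111) (hc : P.Connected)
    (hh : Order.krullDim P.Elem ≤ 2) : Reachable P := by
  obtain ⟨n, s, rfl, hS⟩ := hQ
  refine ⟨n + 1,
    { P := fun j => if j ≤ n then s.P j else P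
      S := fun j => if j ≤ n then s.S j else b
      rule := fun j => if j ≤ n then s.rule j else ρ
      connected := fun j hj => ?_
      height_le_two := fun j hj => ?_
      start := by simpa using s.start
      gluing := fun j hj => ?_
      rule_applies := fun j hj => ?_
      existsUnique_P111 := ?_ }, by simp, by simpa using hS⟩
  · split_ifs with h
    · exact s.connected j h
    · exact hc
  · by_cases h : j ≤ n
    · exact (congrArg (fun Q : SubPoset α => Order.krullDim Q.Elem) (if_pos h)).trans_le
        (s.height_le_two j h)
    · exact (congrArg (fun Q : SubPoset α => Order.krullDim Q.Elem) (if_neg h)).trans_le hh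
  · rcases Nat.lt_succ_iff_lt_or_eq.1 hj with h | rfl
    · simp only [if_pos h.le, if_pos (Nat.succ_le_of_lt h)]
      exact s.gluing j h
    · simpa using hG
  · rcases Nat.lt_succ_iff_lt_or_eq.1 hj with h | rfl
    · simp only [if_pos h.le, if_pos (Nat.succ_le_of_lt h)]
      exact s.rule_applies j h
    · simpa using hρ
  · obtain ⟨j, ⟨hj, hP⟩, huniq⟩ := s.existsUnique_P111
    refine ⟨j, ⟨by omega, by simpa [hj] using hP⟩, fun i ⟨_, hi'⟩ => ?_⟩
    by_cases h : i ≤ n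
    · simp only [if_pos h] at hi'
      exact huniq i ⟨h, hi'⟩
    · simp only [if_neg h] at hi'
      exact absurd hi' hb

theorem SubPoset.Connected.insert [Finite α] {Q P : SubPoset α} (hQ : Q.Connected) {v u : α}
    (hcar : P.carrier = insert v Q.carrier) (hlt : ∀ x y, Q.lt x y → P.lt x y)
    (hu : u ∈ Q.carrier) (huv : P.lt u v ∨ P.lt v u) : P.Connected := by
  have hsub : ∀ x : Q.Elem, x.1 ∈ P.carrier := fun x => hcar ▸ Or.inr x.2
  have hv : v ∈ P.carrier := hcar ▸ Or.inl rfl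
  have : Finite P.Elem := inferInstanceAs (Finite {x // x ∈ P.carrier})
  have : Nonempty P.Elem := ⟨⟨v, hv⟩⟩
  refine hasse_connected_of_forall fun S hS => ?_
  have hall : ∀ y : P.Elem, S y ↔ S ⟨u, hsub ⟨u, hu⟩⟩ := by
    rintro ⟨y, hy⟩
    have hy' := hy
    rw [hcar] at hy'
    rcases hy' with rfl | hy'
    · rcases huv with h | h
      · exact (hS ⟨u, hsub ⟨u, hu⟩⟩ ⟨y, hy⟩ h).symm
      · exact hS ⟨y, hy⟩ ⟨u, hsub ⟨u, hu⟩⟩ h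
    · exact iff_of_hasse_connected hQ (S := fun x : Q.Elem => S ⟨x.1, hsub x⟩)
        (fun x y hxy => hS _ _ (hlt _ _ hxy)) ⟨y, hy'⟩ ⟨u, hu⟩
  intro x y hx
  exact (hall y).2 ((hall x).1 hx)

theorem Block.connected_P111 {c m a : α} (h) : (P111 c m a h).poset.Connected := by
  have hmem : ∀ x, x ∈ (P111 c m a h).poset.carrier ↔ x = c ∨ x = m ∨ x = a := by
    intro x
    simp [poset, elems]
  have hm : m ∈ (P111 c m a h).poset.carrier := (hmem m).2 (by simp)
  have hfin : (P111 c m a h).poset.carrier.Finite := by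
    have : (P111 c m a h).poset.carrier = {c, m, a} := by
      ext x
      exact hmem x
    rw [this]
    exact Set.toFinite _
  have : Finite (P111 c m a h).poset.Elem := hfin
  have : Nonempty (P111 c m a h).poset.Elem := ⟨⟨m, hm⟩⟩
  refine hasse_connected_of_forall fun S hS => ?_
  have hall : ∀ y : (P111 c m a h).poset.Elem, S y ↔ S ⟨m, hm⟩ := by
    rintro ⟨y, hy⟩
    rcases (hmem y).1 hy with rfl | rfl | rfl
    · exact hS _ _ (by simp [LT.lt, poset, rels])
    · rfl
    · exact (hS _ _ (by simp [LT.lt, poset, rels])).symm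
  intro x y hx
  exact (hall y).2 ((hall x).1 hx)

end Reach

/-! ### Building a contact sequence inside the given poset. -/

section Stage

variable {α : Type*} [PartialOrder α] {E : Set (α × α)} {V M : Set α}

/-- Edges `E`, extremal elements `V` and middle elements `M` that span a poset in `α`. -/
structure IsStage (E : Set (α × α)) (V M : Set α) : Prop where
  subset : E ⊆ minMaxRel α
  mem : ∀ x y, (x, y) ∈ E → x ∈ V ∧ y ∈ V
  subset_extremal : V ⊆ extremal α
  mid : ∀ m ∈ M, m ∉ extremal α
  edge : ∀ m ∈ M, ∀ p q, p < m → m < q → (p, q) ∈ E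

theorem IsStage.mem_of_lt (h : IsStage E V M) {x y : α} (hxy : x < y) (hM : x ∈ M ∨ y ∈ M) :
    x ∈ V ∪ M ∧ y ∈ V ∪ M := by
  rcases hM with hx | hy
  · obtain ⟨⟨p, hp⟩, -⟩ := not_mem_extremal_iff.1 (h.mid x hx)
    exact ⟨Or.inr hx, Or.inl (h.mem _ _ (h.edge x hx p y hp hxy)).2⟩
  · obtain ⟨-, q, hq⟩ := not_mem_extremal_iff.1 (h.mid y hy)
    exact ⟨Or.inl (h.mem _ _ (h.edge y hy x q hxy hq)).1, Or.inr hy⟩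

/-- The poset spanned by `E`, `V` and `M`. -/
def stage (h2 : HeightLeTwo α) (h : IsStage E V M) : SubPoset α where
  carrier := V ∪ M
  lt x y := (x, y) ∈ E ∨ x < y ∧ (x ∈ M ∨ y ∈ M)
  left_mem x y := by
    rintro (hxy | ⟨hxy, hM⟩)
    · exact Or.inl (h.mem x y hxy).1
    · exact (h.mem_of_lt hxy hM).1
  right_mem x y := by
    rintro (hxy | ⟨hxy, hM⟩)
    · exact Or.inl (h.mem x y hxy).2
    · exact (h.mem_of_lt hxy hM).2
  irrefl x := by
    rintro (hxx | ⟨hxx, -⟩)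
    · exact lt_irrefl x (h.subset hxx).1
    · exact lt_irrefl x hxx
  trans x y z := by
    rintro (hxy | ⟨hxy, hM⟩) hyz
    · have hmax := (h.subset hxy).2.2
      rcases hyz with hyz | ⟨hyz, -⟩
      · exact absurd hmax (h.subset hyz).1.not_isMax
      · exact absurd hmax hyz.not_isMax
    · rcases hyz with hyz | ⟨hyz, hM'⟩
      · exact absurd (h.subset hyz).2.1 hxy.not_isMin
      -- Transitivity through a middle element is the reason for the field `edge`: such an element
      -- may be present only together with the min–max edges across it.
      · by_cases hy : y ∈ M
        · exact Or.inl (h.edge y hy x z hxy hyz)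
        · obtain ⟨⟨p, hp⟩, -⟩ := not_mem_extremal_iff.1 (h.mid x (hM.resolve_right hy))
          exact absurd hyz (h2 p x y z hp hxy)

theorem stage_lt_iff (h2 : HeightLeTwo α) (h : IsStage E V M) {x y : α} :
    (stage h2 h).lt x y ↔ (x, y) ∈ E ∨ x < y ∧ (x ∈ M ∨ y ∈ M) := Iff.rfl

theorem lt_of_stage_lt (h2 : HeightLeTwo α) (h : IsStage E V M) {x y : α}
    (hxy : (stage h2 h).lt x y) : x < y :=
  hxy.elim (fun h' => (h.subset h').1) And.left

theorem isMinimal_stage (h2 : HeightLeTwo α) (h : IsStage E V M) {x : α} (hx : x ∈ V)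
    (hmin : IsMin x) : (stage h2 h).IsMinimal x :=
  ⟨Or.inl hx, fun _ hy => (lt_of_stage_lt h2 h hy).not_isMin hmin⟩

theorem isMaximal_stage (h2 : HeightLeTwo α) (h : IsStage E V M) {x : α} (hx : x ∈ V)
    (hmax : IsMax x) : (stage h2 h).IsMaximal x :=
  ⟨Or.inl hx, fun _ hy => (lt_of_stage_lt h2 h hy).not_isMax hmax⟩

theorem krullDim_stage_le (h2 : HeightLeTwo α) (h : IsStage E V M) :
    Order.krullDim (stage h2 h).Elem ≤ Order.krullDim α :=
  Order.krullDim_le_of_strictMono (fun x : (stage h2 h).Elem => x.1)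
    fun _ _ hxy => lt_of_stage_lt h2 h hxy

/-- The stage `E, V, M` is the end of a contact sequence with connected last poset. -/
def ReachableStage (h2 : HeightLeTwo α) (E : Set (α × α)) (V M : Set α) : Prop :=
  ∃ h : IsStage E V M, (stage h2 h).Connected ∧ Reachable (stage h2 h)

theorem reachableStage_initial (h2 : HeightLeTwo α) (hdim : Order.krullDim α ≤ 2) {c m a : α}
    (hm : Nbhd11 (· < ·) m c a) : ReachableStage h2 {(c, a)} {c, a} {m} := by
  have hcm : c < m := (hm.1 c).2 rfl
  have hma : m < a := (hm.2 a).2 rfl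
  have hca := h2.mem_minMaxRel hcm hma
  have hstage : IsStage {(c, a)} {c, a} {m} := by
    refine ⟨Set.singleton_subset_iff.2 hca, ?_, ?_, ?_, ?_⟩
    · rintro x y h
      simp only [Set.mem_singleton_iff, Prod.mk.injEq] at h
      simp [h]
    · rintro x (rfl | rfl)
      · exact Or.inl hca.2.1
      · exact Or.inr hca.2.2
    · rintro _ rfl
      exact not_mem_extremal_of_lt_of_lt hcm hma
    · rintro _ rfl p q hp hq
      rw [(hm.1 p).1 hp, (hm.2 q).1 hq]
      rfl
  have hn : [c, m, a].Nodup := by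
    simp [hcm.ne, hma.ne, (hcm.trans hma).ne]
  have heq : stage h2 hstage = (Block.P111 c m a hn).poset := by
    refine SubPoset.ext ?_ ?_
    · ext x
      simp only [stage, Block.poset, Block.elems, Set.mem_union, Set.mem_insert_iff,
        Set.mem_singleton_iff, Set.mem_ofPred_eq, List.mem_cons, List.not_mem_nil, or_false]
      tauto
    · ext x y
      simp only [stage_lt_iff, Block.poset, Block.rels, Set.mem_singleton_iff, List.mem_cons,
        List.not_mem_nil, or_false, Prod.mk.injEq]
      constructor
      · rintro (h | ⟨h, rfl | rfl⟩)
        · exact Or.inr (Or.inl h)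
        · exact Or.inr (Or.inr ⟨rfl, (hm.2 y).1 h⟩)
        · exact Or.inl ⟨(hm.1 x).1 h, rfl⟩
      · rintro (⟨rfl, rfl⟩ | h | ⟨rfl, rfl⟩)
        · exact Or.inr ⟨hcm, Or.inr rfl⟩
        · exact Or.inl h
        · exact Or.inr ⟨hma, Or.inl rfl⟩
  have hc : (stage h2 hstage).Connected := heq ▸ Block.connected_P111 hn
  have hd := (krullDim_stage_le h2 hstage).trans hdim
  rw [heq] at hd
  exact ⟨hstage, hc, heq ▸ reachable_block trivial (Block.connected_P111 hn) hd⟩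

theorem IsStage.insert_mid {h2 : HeightLeTwo α} (hst : IsStage (minMaxRel α) (extremal α) M)
    {m : α} (hm : m ∉ extremal α) : IsStage (minMaxRel α) (extremal α) (insert m M) := by
  refine ⟨hst.subset, hst.mem, hst.subset_extremal, ?_, ?_⟩
  · rintro x (rfl | hx)
    · exact hm
    · exact hst.mid x hx
  · intro x _ p q hp hq
    exact h2.mem_minMaxRel hp hq

variable [Finite α]

/-- A new maximal element is attached to `p` by a copy of `P(1,1)` with only its lower end
identified, which is rule `C`. -/
theorem ReachableStage.up {h2 : HeightLeTwo α} (hdim : Order.krullDim α ≤ 2)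
    (h : ReachableStage h2 E V M) {p q : α} (hpq : (p, q) ∈ minMaxRel α) (hp : p ∈ V)
    (hq : q ∉ V) : ReachableStage h2 (insert (p, q) E) (insert q V) M := by
  obtain ⟨hst, hc, hr⟩ := h
  have hqM : q ∉ M := fun h => hst.mid q h (Or.inr hpq.2.2)
  have hst' : IsStage (insert (p, q) E) (insert q V) M := by
    refine ⟨Set.insert_subset hpq hst.subset, ?_, Set.insert_subset (Or.inr hpq.2.2) hst.subset_extremal,
      hst.mid, fun m hm x y hx hy => Or.inr (hst.edge m hm x y hx hy)⟩
    rintro x y (hxy | hxy)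
    · simp only [Prod.mk.injEq] at hxy
      rw [hxy.1, hxy.2]
      exact ⟨Or.inr hp, Or.inl rfl⟩
    · exact ⟨Or.inr (hst.mem x y hxy).1, Or.inr (hst.mem x y hxy).2⟩
  have hn : [p, q].Nodup := by simp [hpq.1.ne]
  have hcar : (stage h2 hst').carrier = insert q (stage h2 hst).carrier := Set.insert_union
  have hcon : (stage h2 hst').Connected :=
    hc.insert hcar (fun x y hxy => hxy.imp Or.inr id) (Or.inl hp) (Or.inl (Or.inl (Or.inl rfl)))
  refine ⟨hst', hcon, hr.step (b := .P11 p q hn) (ρ := .C) ⟨?_, ?_, ?_⟩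
    ⟨Or.inl hp, fun h => h.elim hq hqM, by simp [Block.a₂]⟩ id hcon
    ((krullDim_stage_le h2 hst').trans hdim)⟩
  · rw [hcar]
    ext x
    simp only [Block.poset, Block.elems, Set.mem_union, Set.mem_insert_iff, Set.mem_ofPred_eq,
      List.mem_cons, List.not_mem_nil, or_false]
    have : p ∈ (stage h2 hst).carrier := Or.inl hp
    grind
  · intro x y
    simp only [stage_lt_iff, Block.poset, Block.rels, Set.mem_insert_iff, List.mem_cons,
      List.not_mem_nil, or_false]
    tauto
  · intro x hx hx'
    simp only [Block.poset, Block.elems, Set.mem_ofPred_eq, List.mem_cons, List.not_mem_nil,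
      or_false] at hx'
    rcases hx' with rfl | rfl
    · exact Or.inl ⟨isMinimal_stage h2 hst hp hpq.2.1, (Block.isMinimal_P11 hn).2 rfl⟩
    · exact absurd hx fun h => h.elim hq hqM

/-- Now only the upper end of `P(1,1)` is identified, which is rule `A₁`. -/
theorem ReachableStage.down {h2 : HeightLeTwo α} (hdim : Order.krullDim α ≤ 2)
    (h : ReachableStage h2 E V M) {p q : α} (hpq : (p, q) ∈ minMaxRel α) (hp : p ∉ V)
    (hq : q ∈ V) : ReachableStage h2 (insert (p, q) E) (insert p V) M := by
  obtain ⟨hst, hc, hr⟩ := h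
  have hpM : p ∉ M := fun h => hst.mid p h (Or.inl hpq.2.1)
  have hst' : IsStage (insert (p, q) E) (insert p V) M := by
    refine ⟨Set.insert_subset hpq hst.subset, ?_, Set.insert_subset (Or.inl hpq.2.1) hst.subset_extremal,
      hst.mid, fun m hm x y hx hy => Or.inr (hst.edge m hm x y hx hy)⟩
    rintro x y (hxy | hxy)
    · simp only [Prod.mk.injEq] at hxy
      rw [hxy.1, hxy.2]
      exact ⟨Or.inl rfl, Or.inr hq⟩
    · exact ⟨Or.inr (hst.mem x y hxy).1, Or.inr (hst.mem x y hxy).2⟩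
  have hn : [p, q].Nodup := by simp [hpq.1.ne]
  have hcar : (stage h2 hst').carrier = insert p (stage h2 hst).carrier := Set.insert_union
  have hcon : (stage h2 hst').Connected :=
    hc.insert hcar (fun x y hxy => hxy.imp Or.inr id) (Or.inl hq) (Or.inr (Or.inl (Or.inl rfl)))
  refine ⟨hst', hcon, hr.step (b := .P11 p q hn) (ρ := .A₁) ⟨?_, ?_, ?_⟩
    ⟨fun h => h.elim hp hpM, Or.inl hq, by simp [Block.a₂]⟩ id hcon
    ((krullDim_stage_le h2 hst').trans hdim)⟩
  · rw [hcar]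
    ext x
    simp only [Block.poset, Block.elems, Set.mem_union, Set.mem_insert_iff, Set.mem_ofPred_eq,
      List.mem_cons, List.not_mem_nil, or_false]
    have : q ∈ (stage h2 hst).carrier := Or.inl hq
    grind
  · intro x y
    simp only [stage_lt_iff, Block.poset, Block.rels, Set.mem_insert_iff, List.mem_cons,
      List.not_mem_nil, or_false]
    tauto
  · intro x hx hx'
    simp only [Block.poset, Block.elems, Set.mem_ofPred_eq, List.mem_cons, List.not_mem_nil,
      or_false] at hx'
    rcases hx' with rfl | rfl
    · exact absurd hx fun h => h.elim hp hpM
    · exact Or.inr ⟨isMaximal_stage h2 hst hq hpq.2.2, (Block.isMaximal_P11 hn).2 rfl⟩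

theorem GrownTree.reachableStage {h2 : HeightLeTwo α} (hdim : Order.krullDim α ≤ 2) {c m a : α}
    (hm : Nbhd11 (· < ·) m c a) (h : GrownTree c a E V) (hE : E ⊆ minMaxRel α) :
    ReachableStage h2 E V {m} := by
  induction h with
  | base => exact reachableStage_initial h2 hdim hm
  | up _ hp hq ih =>
    exact (ih ((Set.subset_insert _ _).trans hE)).up hdim (hE (Set.mem_insert _ _)) hp hq
  | down _ hp hq ih =>
    exact (ih ((Set.subset_insert _ _).trans hE)).down hdim (hE (Set.mem_insert _ _)) hp hq

/-- All extremal elements and min–max edges are present, so `c, a₁, a₂` are all identified, with the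
required comparabilities: this is rule `F`, and `m` is the only new element. -/
theorem ReachableStage.mid12 {h2 : HeightLeTwo α} (hdim : Order.krullDim α ≤ 2)
    (h : ReachableStage h2 (minMaxRel α) (extremal α) M) {m c a₁ a₂ : α}
    (hm : Nbhd12 (· < ·) m c a₁ a₂) (hmM : m ∉ M) :
    ReachableStage h2 (minMaxRel α) (extremal α) (insert m M) := by
  obtain ⟨hst, hc, hr⟩ := h
  obtain ⟨hne, hb, ha⟩ := hm
  have hcm : c < m := (hb c).2 rfl
  have hma₁ : m < a₁ := (ha a₁).2 (Or.inl rfl)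
  have hma₂ : m < a₂ := (ha a₂).2 (Or.inr rfl)
  have he₁ := h2.mem_minMaxRel hcm hma₁
  have he₂ := h2.mem_minMaxRel hcm hma₂
  have hcV : c ∈ extremal α := Or.inl he₁.2.1
  have haV₁ : a₁ ∈ extremal α := Or.inr he₁.2.2
  have haV₂ : a₂ ∈ extremal α := Or.inr he₂.2.2
  have hmV := not_mem_extremal_of_lt_of_lt hcm hma₁
  have hst' := hst.insert_mid (h2 := h2) hmV
  have hn : [c, m, a₁, a₂].Nodup := by
    simp [hcm.ne, hma₁.ne, hma₂.ne, hne, he₁.1.ne, he₂.1.ne]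
  have hcar : (stage h2 hst').carrier = insert m (stage h2 hst).carrier := Set.union_insert
  have hcon : (stage h2 hst').Connected :=
    hc.insert hcar (fun x y hxy => hxy.imp id (And.imp_right (Or.imp Or.inr Or.inr))) (Or.inl hcV)
      (Or.inl (Or.inr ⟨hcm, Or.inr (Or.inl rfl)⟩))
  refine ⟨hst', hcon, hr.step (b := .P112 c m a₁ a₂ hn) (ρ := .F) ⟨?_, ?_, ?_⟩
    ⟨Or.inl hcV, ⟨Or.inl haV₁, Or.inr (Or.inr (Or.inl he₁))⟩, a₂, rfl, Or.inl haV₂,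
      Or.inr (Or.inr (Or.inl he₂))⟩ id hcon ((krullDim_stage_le h2 hst').trans hdim)⟩
  · rw [hcar]
    ext x
    simp only [Block.poset, Block.elems, Set.mem_union, Set.mem_insert_iff, Set.mem_ofPred_eq,
      List.mem_cons, List.not_mem_nil, or_false]
    have hc' : c ∈ (stage h2 hst).carrier := Or.inl hcV
    have ha₁ : a₁ ∈ (stage h2 hst).carrier := Or.inl haV₁
    have ha₂ : a₂ ∈ (stage h2 hst).carrier := Or.inl haV₂
    grind
  · intro x y
    simp only [stage_lt_iff, Block.poset, Block.rels, Set.mem_insert_iff, List.mem_cons,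
      List.not_mem_nil, or_false, Prod.mk.injEq]
    constructor
    · rintro (h | ⟨h, (rfl | h') | (rfl | h')⟩)
      · exact Or.inl (Or.inl h)
      · have := (ha y).1 h
        tauto
      · exact Or.inl (Or.inr ⟨h, Or.inl h'⟩)
      · have := (hb x).1 h
        tauto
      · exact Or.inl (Or.inr ⟨h, Or.inr h'⟩)
    · rintro ((h | h) | ⟨rfl, rfl⟩ | ⟨rfl, rfl⟩ | ⟨rfl, rfl⟩ | ⟨rfl, rfl⟩ | ⟨rfl, rfl⟩)
      · exact Or.inl h
      · exact Or.inr ⟨h.1, h.2.imp Or.inr Or.inr⟩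
      · exact Or.inr ⟨hcm, Or.inr (Or.inl rfl)⟩
      · exact Or.inl he₁
      · exact Or.inl he₂
      · exact Or.inr ⟨hma₁, Or.inl (Or.inl rfl)⟩
      · exact Or.inr ⟨hma₂, Or.inl (Or.inl rfl)⟩
  · intro x hx hx'
    simp only [Block.poset, Block.elems, Set.mem_ofPred_eq, List.mem_cons, List.not_mem_nil,
      or_false] at hx'
    rcases hx' with rfl | rfl | rfl | rfl
    · exact Or.inl ⟨isMinimal_stage h2 hst hcV he₁.2.1, (Block.isMinimal_P112 hn).2 rfl⟩
    · exact absurd hx fun h => h.elim hmV hmM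
    · exact Or.inr ⟨isMaximal_stage h2 hst haV₁ he₁.2.2, (Block.isMaximal_P112 hn).2 (Or.inl rfl)⟩
    · exact Or.inr ⟨isMaximal_stage h2 hst haV₂ he₂.2.2, (Block.isMaximal_P112 hn).2 (Or.inr rfl)⟩

theorem ReachableStage.mid21 {h2 : HeightLeTwo α} (hdim : Order.krullDim α ≤ 2)
    (h : ReachableStage h2 (minMaxRel α) (extremal α) M) {m a₁ a₂ c : α}
    (hm : Nbhd21 (· < ·) m a₁ a₂ c) (hmM : m ∉ M) :
    ReachableStage h2 (minMaxRel α) (extremal α) (insert m M) := by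
  obtain ⟨hst, hc, hr⟩ := h
  obtain ⟨hne, ha, hb⟩ := hm
  have hmc : m < c := (hb c).2 rfl
  have ham₁ : a₁ < m := (ha a₁).2 (Or.inl rfl)
  have ham₂ : a₂ < m := (ha a₂).2 (Or.inr rfl)
  have he₁ := h2.mem_minMaxRel ham₁ hmc
  have he₂ := h2.mem_minMaxRel ham₂ hmc
  have hcV : c ∈ extremal α := Or.inr he₁.2.2
  have haV₁ : a₁ ∈ extremal α := Or.inl he₁.2.1
  have haV₂ : a₂ ∈ extremal α := Or.inl he₂.2.1
  have hmV := not_mem_extremal_of_lt_of_lt ham₁ hmc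
  have hst' := hst.insert_mid (h2 := h2) hmV
  have hn : [a₁, a₂, m, c].Nodup := by
    simp [hmc.ne, ham₁.ne, ham₂.ne, hne, he₁.1.ne, he₂.1.ne]
  have hcar : (stage h2 hst').carrier = insert m (stage h2 hst).carrier := Set.union_insert
  have hcon : (stage h2 hst').Connected :=
    hc.insert hcar (fun x y hxy => hxy.imp id (And.imp_right (Or.imp Or.inr Or.inr))) (Or.inl hcV)
      (Or.inr (Or.inr ⟨hmc, Or.inl (Or.inl rfl)⟩))
  refine ⟨hst', hcon, hr.step (b := .P211 a₁ a₂ m c hn) (ρ := .F) ⟨?_, ?_, ?_⟩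
    ⟨Or.inl hcV, ⟨Or.inl haV₁, Or.inr (Or.inl (Or.inl he₁))⟩, a₂, rfl, Or.inl haV₂,
      Or.inr (Or.inl (Or.inl he₂))⟩ id hcon ((krullDim_stage_le h2 hst').trans hdim)⟩
  · rw [hcar]
    ext x
    simp only [Block.poset, Block.elems, Set.mem_union, Set.mem_insert_iff, Set.mem_ofPred_eq,
      List.mem_cons, List.not_mem_nil, or_false]
    have hc' : c ∈ (stage h2 hst).carrier := Or.inl hcV
    have ha₁ : a₁ ∈ (stage h2 hst).carrier := Or.inl haV₁
    have ha₂ : a₂ ∈ (stage h2 hst).carrier := Or.inl haV₂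
    grind
  · intro x y
    simp only [stage_lt_iff, Block.poset, Block.rels, Set.mem_insert_iff, List.mem_cons,
      List.not_mem_nil, or_false, Prod.mk.injEq]
    constructor
    · rintro (h | ⟨h, (rfl | h') | (rfl | h')⟩)
      · exact Or.inl (Or.inl h)
      · have := (hb y).1 h
        tauto
      · exact Or.inl (Or.inr ⟨h, Or.inl h'⟩)
      · have := (ha x).1 h
        tauto
      · exact Or.inl (Or.inr ⟨h, Or.inr h'⟩)
    · rintro ((h | h) | ⟨rfl, rfl⟩ | ⟨rfl, rfl⟩ | ⟨rfl, rfl⟩ | ⟨rfl, rfl⟩ | ⟨rfl, rfl⟩)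
      · exact Or.inl h
      · exact Or.inr ⟨h.1, h.2.imp Or.inr Or.inr⟩
      · exact Or.inr ⟨ham₁, Or.inr (Or.inl rfl)⟩
      · exact Or.inr ⟨ham₂, Or.inr (Or.inl rfl)⟩
      · exact Or.inl he₁
      · exact Or.inl he₂
      · exact Or.inr ⟨hmc, Or.inl (Or.inl rfl)⟩
  · intro x hx hx'
    simp only [Block.poset, Block.elems, Set.mem_ofPred_eq, List.mem_cons, List.not_mem_nil,
      or_false] at hx'
    rcases hx' with rfl | rfl | rfl | rfl
    · exact Or.inl ⟨isMinimal_stage h2 hst haV₁ he₁.2.1, (Block.isMinimal_P211 hn).2 (Or.inl rfl)⟩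
    · exact Or.inl ⟨isMinimal_stage h2 hst haV₂ he₂.2.1, (Block.isMinimal_P211 hn).2 (Or.inr rfl)⟩
    · exact absurd hx fun h => h.elim hmV hmM
    · exact Or.inr ⟨isMaximal_stage h2 hst hcV he₁.2.2, (Block.isMaximal_P211 hn).2 rfl⟩

end Stage

theorem IsContactPoset.reachable {k α : Type*} [Field k] [Fintype α] [PartialOrder α]
    (h : IsContactPoset k α) (hconn : (SimpleGraph.hasse α).Connected) (h2 : HeightLeTwo α)
    (hdim : Order.krullDim α ≤ 2) : Reachable (SubPoset.whole α) := by
  classical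
  obtain ⟨m₀, c₀, a₀, hm₀⟩ := h.exists_mid11
  -- The tree is rooted at the edge across `m₀`, so that its growth starts from the copy of
  -- `P(1,1,1)` at `m₀`.
  have htree := grownTree_minMaxRel hconn h.flowFree
    (h2.mem_minMaxRel ((hm₀.1 c₀).2 rfl) ((hm₀.2 a₀).2 rfl))
  have hstart := htree.reachableStage (h2 := h2) hdim hm₀ subset_rfl
  -- Once the tree is complete, the other middle elements can be added in any order.
  have hall : ∀ T : Finset α, (∀ m ∈ T, m ∉ extremal α ∧ m ≠ m₀) →
      ReachableStage h2 (minMaxRel α) (extremal α) (↑T ∪ {m₀}) := by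
    intro T
    induction T using Finset.induction_on with
    | empty =>
      intro _
      rwa [Finset.coe_empty, Set.empty_union]
    | insert m T hmT ih =>
      intro hT
      have ih := ih fun x hx => hT x (Finset.mem_insert_of_mem hx)
      obtain ⟨hext, hne⟩ := hT m (Finset.mem_insert_self m T)
      have hmM : m ∉ (↑T ∪ {m₀} : Set α) := by
        simp [hmT, hne]
      rw [Finset.coe_insert, Set.insert_union]
      rcases h.mid m hext with h' | ⟨c, a₁, a₂, h'⟩ | ⟨a₁, a₂, c, h'⟩
      · exact absurd (h.mid11_unique m m₀ h' ⟨c₀, a₀, hm₀⟩) hne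
      · exact ih.mid12 hdim h' hmM
      · exact ih.mid21 hdim h' hmM
  obtain ⟨hst, -, hr⟩ := hall (Finset.univ.filter fun m => m ∉ extremal α ∧ m ≠ m₀)
    fun m hm => (Finset.mem_filter.1 hm).2
  have hmem : ∀ x, x ∈ (↑(Finset.univ.filter fun m => m ∉ extremal α ∧ m ≠ m₀) ∪ {m₀} : Set α) ↔
      x ∉ extremal α := by
    intro x
    have : m₀ ∉ extremal α :=
      not_mem_extremal_of_lt_of_lt ((hm₀.1 c₀).2 rfl) ((hm₀.2 a₀).2 rfl)
    simp only [Finset.coe_filter, Finset.mem_univ, true_and, Set.mem_union, Set.mem_ofPred_eq,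
      Set.mem_singleton_iff]
    by_cases hx : x = m₀
    · simp [hx, this]
    · simp [hx]
  have heq : stage h2 hst = SubPoset.whole α := by
    refine SubPoset.ext ?_ ?_
    · refine Set.eq_univ_of_forall fun x => ?_
      by_cases hx : x ∈ extremal α
      · exact Or.inl hx
      · exact Or.inr ((hmem x).2 hx)
    · ext x y
      refine ⟨fun hxy => lt_of_stage_lt h2 hst hxy, fun (hxy : x < y) => ?_⟩
      rw [stage_lt_iff, hmem, hmem]
      by_cases hx : x ∈ extremal α
      · by_cases hy : y ∈ extremal α
        · exact Or.inl ⟨hxy, hx.resolve_right hxy.not_isMax, hy.resolve_left hxy.not_isMin⟩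
        · exact Or.inr ⟨hxy, Or.inr hy⟩
      · exact Or.inr ⟨hxy, Or.inl hx⟩
  rwa [heq] at hr

theorem mainTheorem1 (k : Type*) [Field k] [IsAlgClosed k] [CharZero k]
    (α : Type*) [Fintype α] [DecidableEq α] [PartialOrder α]
    (hconn : (SimpleGraph.hasse α).Connected) (hheight : Order.krullDim α = 2) :
    (IsContactLieAlgebra k (typeALiePosetAlgebra k α) ↔
      ∃ (n : ℕ) (s : ContactSequence α n), s.P n = SubPoset.whole α) ∧
    ((∃ (n : ℕ) (s : ContactSequence α n), s.P n = SubPoset.whole α) →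
      ∃ (n : ℕ) (s : ContactSequence α n), s.P n = SubPoset.whole α ∧ (s.S 0).IsP111) ∧
    (∀ (n : ℕ) (s : ContactSequence α n), s.P n = SubPoset.whole α → (s.S 0).IsP111 →
      IsContactForm k (typeALiePosetAlgebra k α) (s.contactForm k)) := by
  have h2 : HeightLeTwo α := fun _ _ _ _ => not_lt_of_krullDim_le_two hheight.le
  -- An arbitrary sequence is used only to obtain `IsContactPoset`, from which a new one starting
  -- with `P(1,1,1)` is built; its form then proves that the algebra is contact.
  have hreach : (∃ (n : ℕ) (s : ContactSequence α n), s.P n = SubPoset.whole α) →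
      Reachable (SubPoset.whole α) := fun ⟨_, s, hs⟩ =>
    (s.isContactPoset k hs).reachable hconn h2 hheight.le
  refine ⟨⟨fun h => ?_, fun h => ?_⟩, hreach, fun n s hs hS =>
    s.isContactForm_contactForm hconn h2 hs hS⟩
  · obtain ⟨n, s, hs, -⟩ := (h.isContactPoset h2 hconn).reachable hconn h2 hheight.le
    exact ⟨n, s, hs⟩
  · obtain ⟨n, s, hs, hS⟩ := hreach h
    exact ⟨_, s.isContactForm_contactForm hconn h2 hs hS⟩
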